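/- \textbf{Theorem (Irreversibility cost of effective erasure).} \emph{Conventions.} A machine is a deterministic multitape Turing machine with finitely many two-way infinite tapes whose cells hold a bit or a blank; one tape is the input tape, a different one the output tape, the others are work tapes. It starts with the input in the cells $0,1,\dots$ of the input tape, everything else blank and all heads at cell $0$. Let $\langle x,y\rangle$ be the self-delimiting pairing of binary strings that writes each bit $b$ of $x$ as $1b$, followed by $0$ and then by $y$. Natural numbers are identified with binary strings by $0\mapsto\epsilon,\ 1\mapsto 0,\ 2\mapsto 1,\ 3\mapsto 00,\dots$. For a reference machine $U$ and $s\in\mathbb N$ let \[ C_{s}(x|y)=\min\{|p| : U(\langle p,y\rangle)=x \text{ in at most } s \text{ steps}\}\in\mathbb N\cup\{\infty\}, \] where $U(u)=x$ means that $U$ on input $u$ halts with $x$ on its output tape (the other tapes are arbitrary). For a time bound $t:\mathbb N\to\mathbb N$ put $C^t(x)=C_{t(|x|)}(x|\epsilon)$. A machine $R$ is reversible if each of its configurations has at most one predecessor. Its irreversibility cost of computing $y$ from $x$ in at most $s$ steps is \[ E_R^{s}(x,y)=\min\{|p|+|q| : R \text{ turns } \langle x,p\rangle \text{ into } \langle y,q\rangle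 \text{ in at most } s \text{ steps}\}, \] that is, the number of irreversibly provided bits $p$ plus the number of irreversibly erased bits $q$; here $R$ must halt cleanly, with $\langle y,q\rangle$ in the cells $0,1,\dots$ of the output tape, all other tapes blank and all heads at cell $0$. Erasing $x$ means computing the empty string $\epsilon$ from $x$. \emph{Statement.} Let $U$ be any machine (in particular, the universal machine with two work tapes that is used as the reference machine for time-limited Kolmogorov complexity). There are a reversible machine $R$ and a constant $c$, depending only on $U$, such that the following holds for every time bound $t$, every binary string $x$ with $t(|x|)\ge |x|$, and every number of steps $s\le 2^{|x|}t(|x|)$ (for instance $s=t(|x|)$). Write $K=C_{s}(t(|x|)\,|\,x)$ for the least length of a program that computes the number $t(|x|)$ from $x$ in at most $s$ steps. If $C^t(x)$ and $K$ are finite, then $x$ can be erased by $R$ within $c\,(2^{|x|}t(|x|)+1)$ steps at irreversibility cost at most \[ C^t(x)+2K+4\lfloor\log_2 K\rfloor+c \] bits, i.e. \[ E_R^{\,c(2^{|x|}t(|x|)+1)}(x,\epsilon)\le C^t(x)+2K+4\lfloor\log_2 K\rfloor+c , \] with the convention that the logarithmic term is $0$ when $K=0$. -/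

import Mathlib

/-- The three possible head movements of a Turing machine. -/
inductive HeadMove : Type
  | left | stay | right

/-- The displacement of the head caused by a movement. -/
def HeadMove.shift : HeadMove → ℤ
  | .left => -1
  | .stay => 0
  | .right => 1

/-- A deterministic multitape Turing machine with binary storage: it has finitely many states and
finitely many two-way infinite tapes, and every cell holds a bit or is blank (`none`).  One tape is
the input tape, a different one is the output tape, and all others are work tapes.  Given the state
and the scanned symbols, the partial transition function yields the new state and, for every tape,
the symbol to write and the movement of the head. -/
structure MultitapeTM where
  State : Type
  finite_state : Finite State
  Tape : Type
  finite_tape : Finite Tape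
  inp : Tape
  out : Tape
  inp_ne_out : inp ≠ out
  start : State
  halt : State
  trans : State → (Tape → Option Bool) → Option (State × (Tape → Option Bool × HeadMove))

/-- The tape with the binary string `u` in the cells `0, 1, …, |u| - 1` and blanks elsewhere. -/
def tapeOf (u : List Bool) : ℤ → Option Bool :=
  fun z => if 0 ≤ z then u[z.toNat]? else none

namespace MultitapeTM

/-- A configuration (instantaneous description): state, head positions and tape contents. -/
@[ext]
structure Cfg (M : MultitapeTM) where
  state : M.State
  head : M.Tape → ℤ
  cells : M.Tape → ℤ → Option Bool

open Classical in
/-- One step.  There is no step from the halting state or where the transition is undefined. -/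
noncomputable def step (M : MultitapeTM) (c : M.Cfg) : Option M.Cfg :=
  if c.state = M.halt then none
  else (M.trans c.state fun i => c.cells i (c.head i)).map fun a =>
    { state := a.1
      head := fun i => c.head i + (a.2 i).2.shift
      cells := fun i => Function.update (c.cells i) (c.head i) (a.2 i).1 }

/-- The configuration after exactly `n` steps (`none` if the machine stops earlier). -/
noncomputable def stepN (M : MultitapeTM) : ℕ → M.Cfg → Option M.Cfg
  | 0, c => some c
  | n + 1, c => (M.step c).bind (M.stepN n)

open Classical in
/-- The initial configuration: `u` on the input tape, all other tapes blank, heads at `0`. -/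
noncomputable def init (M : MultitapeTM) (u : List Bool) : M.Cfg where
  state := M.start
  head := fun _ => 0
  cells := fun i => if i = M.inp then tapeOf u else tapeOf []

open Classical in
/-- The clean final configuration: halting state, `v` on the output tape, all other tapes
blank, heads at `0`. -/
noncomputable def final (M : MultitapeTM) (v : List Bool) : M.Cfg where
  state := M.halt
  head := fun _ => 0
  cells := fun i => if i = M.out then tapeOf v else tapeOf []

/-- `M(u) = v` in at most `s` steps, for an ordinary (not necessarily reversible) computation:
the machine halts with `v` on its output tape; the rest of the final configuration is arbitrary. -/
def OutputsWithin (M : MultitapeTM) (s : ℕ) (u v : List Bool) : Prop :=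
  ∃ n ≤ s, ∃ c : M.Cfg, M.stepN n (M.init u) = some c ∧ c.state = M.halt ∧
    c.cells M.out = tapeOf v

/-- `M(u) = v` in at most `s` steps with nothing left over: `u` has been replaced by `v`, so that
no information except `v` is in the memory at the end. -/
def ReplacesWithin (M : MultitapeTM) (s : ℕ) (u v : List Bool) : Prop :=
  ∃ n ≤ s, M.stepN n (M.init u) = some (M.final v)

/-- A machine is (logically) reversible if every configuration has at most one predecessor. -/
def Reversible (M : MultitapeTM) : Prop :=
  ∀ c₁ c₂ c : M.Cfg, M.step c₁ = some c → M.step c₂ = some c → c₁ = c₂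

end MultitapeTM

/-- The self-delimiting pairing `⟨x, y⟩` of binary strings: every bit `b` of `x` is written as
`1b`, then comes the end marker `0`, and then `y`. -/
def pairCode (x y : List Bool) : List Bool :=
  x.flatMap (fun b => [true, b]) ++ false :: y

/-- The binary string identified with a natural number under the correspondence
`0 ↦ ε, 1 ↦ 0, 2 ↦ 1, 3 ↦ 00, 4 ↦ 01, …`: the binary expansion of `n + 1` (most significant bit
first) without its leading `1`. -/
def natString (n : ℕ) : List Bool :=
  (Nat.bits (n + 1)).reverse.tail

namespace MultitapeTM

/-- Time-limited conditional Kolmogorov complexity with reference machine `U`: the least length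
of a program `p` with `U(⟨p, y⟩) = x` in at most `s` steps (`⊤` if there is none).
For a time bound `t : ℕ → ℕ`, the quantity `C^t(x|y)` is the case `s = t(|x|)`, and `C^t(x)` is
the case where moreover `y` is the empty string. -/
noncomputable def timeC (U : MultitapeTM) (s : ℕ) (x y : List Bool) : ℕ∞ :=
  ⨅ (p : List Bool) (_ : U.OutputsWithin s (pairCode p y) x), (p.length : ℕ∞)

/-- Time-limited irreversibility cost of computing `y` from `x` with the machine `R`: the least
number `|p| + |q|` of irreversibly provided bits `p` and irreversibly erased bits `q` with
`R(⟨x, p⟩) = ⟨y, q⟩`, cleanly and in at most `s` steps (`⊤` if there are none). -/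
noncomputable def irrevCost (R : MultitapeTM) (s : ℕ) (x y : List Bool) : ℕ∞ :=
  ⨅ (p : List Bool) (q : List Bool) (_ : R.ReplacesWithin s (pairCode x p) (pairCode y q)),
    ((p.length + q.length : ℕ) : ℕ∞)

end MultitapeTM

/-! The construction is Bennett's. Suppose an ordinary program turns `u` into `v` and also `v` into
`u`. Computing `v` from `u` with a recorded history, copying `v` and then undoing the computation
gives a reversible passage from `u` to the pair of `u` and `v`. The inverse of the same passage for
`v`, with the roles of the two tapes exchanged, removes `u`. So a reversible machine replaces `u` by
`v` with only constant slowdown: this is `Block.exists_reversible`. It remains to find codes ⟨x, p⟩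
and ⟨ε, q⟩ that can be computed from each other, with |p| + |q| small.

Let τ = t(|x|), let r be a shortest program for τ given x, and let ℓ be the length of the binary
string for |r|. Provide p = ⟨|r|, r⟩. From x and r one computes τ, and then tries all strings in
order of length as programs, each for at most τ + 1 steps, until one prints x. The program w' so
found is no longer than C^t(x). Erase q = 1⟨|r|, r w'⟩. Conversely, q contains r, and running w'
gives x back; no clock is needed, since w' is known to halt. As r must occur in both p and q, it is
paid twice, and each occurrence needs 2ℓ + 1 bits to announce its length. Since ℓ ≤ log |r| + 1, the
total is at most C^t(x) + 2K + 4 log K + 7. These two directions are `exchanges_forward` and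
`exchanges_backward`.

If C^t(x) < |x|, the search makes at most 2^|x| attempts, each taking O(τ + 1) steps. If C^t(x) ≥
|x|, no search is made: p is empty and q is x with a flag bit in front. One program handles all
cases, because the first bit of a code tells whether its first component is empty. Finally |r| ≤ s,
because a machine running for s steps cannot see more than s bits of its program (`le_of_timeC_eq`),
so handling r fits into the time bound.

The ordinary programs are assembled from blocks with explicit running times (`Block.RunsIn`). The
reference machine is simulated by `simBlock_exec`. Reversibility is read off from a local criterion,
a partial injection on states and scanned symbols (`RevProgram.reversible_toTM`). -/

/-! ### Tapes seen from the head -/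

/-- The tape `f`, seen from a head that has moved by `d`. -/
def shiftTape (d : ℤ) (f : ℤ → Option Bool) : ℤ → Option Bool := fun z => f (z + d)

/-- The tape with the string `r` from the head on to the right and the string `l` (read from right
to left) immediately to the left of the head. -/
def strTape (l r : List Bool) : ℤ → Option Bool :=
  fun z => if 0 ≤ z then r[z.toNat]? else l[(-1 - z).toNat]?

/-- The string `r` is what a head reads when it moves to the right up to the first blank. -/
def Reads (f : ℤ → Option Bool) (r : List Bool) : Prop :=
  ∀ i : ℕ, i ≤ r.length → f i = r[i]?

@[simp] theorem shiftTape_apply (d : ℤ) (f : ℤ → Option Bool) (z : ℤ) :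
    shiftTape d f z = f (z + d) := rfl

@[simp] theorem shiftTape_zero (f : ℤ → Option Bool) : shiftTape 0 f = f := by
  funext z; simp

@[simp] theorem shiftTape_shiftTape (d e : ℤ) (f : ℤ → Option Bool) :
    shiftTape d (shiftTape e f) = shiftTape (d + e) f := by
  funext z; simp [add_assoc]

theorem strTape_natCast (l r : List Bool) (n : ℕ) : strTape l r n = r[n]? := by
  simp [strTape]

theorem strTape_negSucc (l r : List Bool) (n : ℕ) : strTape l r (Int.negSucc n) = l[n]? := by
  have h : ¬ (0 : ℤ) ≤ Int.negSucc n := by omega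
  have h' : (-1 - Int.negSucc n).toNat = n := by omega
  simp only [strTape, h, if_false, h']

@[simp] theorem strTape_zero (l r : List Bool) : strTape l r 0 = r.head? := by
  have := strTape_natCast l r 0
  simpa [List.head?_eq_getElem?] using this

theorem strTape_nil_left (u : List Bool) : strTape [] u = tapeOf u := by
  funext z; simp [strTape, tapeOf]

theorem tapeOf_nil : tapeOf [] = fun _ => none := by
  funext z; simp [tapeOf]

theorem strTape_nil_nil : strTape [] [] = fun _ => none := by
  rw [strTape_nil_left, tapeOf_nil]

theorem shiftTape_right (l r : List Bool) (a : Bool) :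
    shiftTape 1 (strTape l (a :: r)) = strTape (a :: l) r := by
  funext z
  rw [shiftTape_apply]
  rcases z with n | n
  · have := strTape_natCast l (a :: r) (n + 1)
    rw [Int.ofNat_eq_natCast, strTape_natCast]
    push_cast at this
    rw [this]; simp
  · cases n with
    | zero => rw [strTape_negSucc]; simp
    | succ n =>
      have h : Int.negSucc (n + 1) + 1 = Int.negSucc n := by omega
      rw [h, strTape_negSucc, strTape_negSucc]; simp

theorem shiftTape_left (l r : List Bool) (a : Bool) :
    shiftTape (-1) (strTape (a :: l) r) = strTape l (a :: r) := by
  rw [← shiftTape_right, shiftTape_shiftTape]; simp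

theorem shiftTape_length (l r : List Bool) :
    shiftTape r.length (strTape l r) = strTape (r.reverse ++ l) [] := by
  induction r generalizing l with
  | nil => simp
  | cons a r ih =>
    have := ih (a :: l)
    rw [← shiftTape_right, shiftTape_shiftTape] at this
    simpa using this

@[simp] theorem update_strTape_nil (l : List Bool) (a : Bool) :
    Function.update (strTape l []) 0 (some a) = strTape l [a] := by
  funext z
  rcases z with n | n
  · rw [Int.ofNat_eq_natCast, strTape_natCast]
    cases n with
    | zero => simp
    | succ n =>
      rw [Function.update_of_ne (by omega), strTape_natCast]; simp
  · rw [Function.update_of_ne (by omega), strTape_negSucc, strTape_negSucc]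

@[simp] theorem update_strTape_cons (l r : List Bool) (a b : Bool) :
    Function.update (strTape l (b :: r)) 0 (some a) = strTape l (a :: r) := by
  funext z
  rcases z with n | n
  · rw [Int.ofNat_eq_natCast, strTape_natCast]
    cases n with
    | zero => simp
    | succ n =>
      rw [Function.update_of_ne (by omega), strTape_natCast]; simp
  · rw [Function.update_of_ne (by omega), strTape_negSucc, strTape_negSucc]

@[simp] theorem update_strTape_singleton (l : List Bool) (b : Bool) :
    Function.update (strTape l [b]) 0 none = strTape l [] := by
  funext z
  rcases z with n | n
  · rw [Int.ofNat_eq_natCast, strTape_natCast]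
    cases n with
    | zero => simp
    | succ n =>
      rw [Function.update_of_ne (by omega), strTape_natCast]; simp
  · rw [Function.update_of_ne (by omega), strTape_negSucc, strTape_negSucc]

/-- With nothing to the left of the head, the erased cell merges with the blanks there. A unary
counter can thus be consumed from its left end without leaving a trace. -/
theorem erase_shiftTape_right (r : List Bool) (b : Bool) :
    shiftTape 1 (Function.update (strTape [] (b :: r)) 0 none) = strTape [] r := by
  funext z
  rw [shiftTape_apply]
  rcases z with n | n
  · rw [Int.ofNat_eq_natCast, Function.update_of_ne (by omega), strTape_natCast]
    have := strTape_natCast [] (b :: r) (n + 1)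
    push_cast at this
    rw [this]; simp
  · cases n with
    | zero => rw [strTape_negSucc]; simp
    | succ n =>
      have h : Int.negSucc (n + 1) + 1 = Int.negSucc n := by omega
      rw [h, Function.update_of_ne (by omega), strTape_negSucc, strTape_negSucc]
      simp

theorem reads_strTape (l r : List Bool) : Reads (strTape l r) r :=
  fun i _ => strTape_natCast l r i

theorem reads_tapeOf (r : List Bool) : Reads (tapeOf r) r := by
  rw [← strTape_nil_left]; exact reads_strTape _ _

theorem Reads.zero {f : ℤ → Option Bool} {r : List Bool} (h : Reads f r) : f 0 = r.head? := by
  have := h 0 (Nat.zero_le _)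
  rw [List.head?_eq_getElem?]
  simpa using this

theorem Reads.tail {f : ℤ → Option Bool} {a : Bool} {r : List Bool} (h : Reads f (a :: r)) :
    Reads (shiftTape 1 f) r := by
  intro i hi
  have := h (i + 1) (by simpa using hi)
  simpa using this

theorem Reads.drop {f : ℤ → Option Bool} {q r : List Bool} (h : Reads f (q ++ r)) :
    Reads (shiftTape q.length f) r := by
  intro i hi
  have := h (i + q.length) (by simp; omega)
  rw [List.getElem?_append_right (by omega)] at this
  simpa using this

theorem pairCode_cons (a : Bool) (x y : List Bool) :
    pairCode (a :: x) y = true :: a :: pairCode x y := by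
  simp [pairCode]

theorem pairCode_nil (y : List Bool) : pairCode [] y = false :: y := by
  simp [pairCode]

theorem pairCode_eq_append (x y : List Bool) : pairCode x y = pairCode x [] ++ y := by
  simp [pairCode]

theorem length_pairCode (x y : List Bool) :
    (pairCode x y).length = 2 * x.length + 1 + y.length := by
  induction x with
  | nil => simp [pairCode_nil]; omega
  | cons a x ih => simp [pairCode_cons, ih]; omega

theorem Reads.pair_snd {f : ℤ → Option Bool} {x y : List Bool} (h : Reads f (pairCode x y)) :
    Reads (shiftTape (2 * x.length + 1) f) y := by
  rw [pairCode_eq_append] at h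
  have := h.drop
  rw [length_pairCode] at this
  simpa using this

/-! ### Program blocks -/

/-- A block of a deterministic multitape program: control states, one of them the entry, and a
total transition function; the block is left when the transition yields no next state. -/
structure Block (T : Type) where
  State : Type
  finite_state : Finite State
  entry : State
  next : State → (T → Option Bool) → (T → Option Bool × HeadMove) × Option State

/-- The symbols under the heads. -/
def scan {T : Type} (t : T → ℤ → Option Bool) : T → Option Bool := fun i => t i 0

/-- Write on all tapes and move all heads. -/
def applyAct {T : Type} (a : T → Option Bool × HeadMove) (t : T → ℤ → Option Bool) :
    T → ℤ → Option Bool :=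
  fun i => shiftTape (a i).2.shift (Function.update (t i) 0 (a i).1)

namespace Block

variable {T : Type}

/-- `B.Exec s t n t'`: started in state `s` on the tapes `t`, the block is left after `n` steps with
the tapes `t'`. -/
inductive Exec (B : Block T) :
    B.State → (T → ℤ → Option Bool) → ℕ → (T → ℤ → Option Bool) → Prop
  | exit {s t a} : B.next s (scan t) = (a, none) → Exec B s t 1 (applyAct a t)
  | step {s t a s' n t'} : B.next s (scan t) = (a, some s') → Exec B s' (applyAct a t) n t' →
      Exec B s t (n + 1) t'

/-- Execution of a block from its entry to its exit in at most `n` steps. -/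
def RunsIn (B : Block T) (n : ℕ) (t t' : T → ℤ → Option Bool) : Prop :=
  ∃ k ≤ n, B.Exec B.entry t k t'

theorem RunsIn.mono {B : Block T} {n m : ℕ} {t t' : T → ℤ → Option Bool} (h : B.RunsIn n t t')
    (hnm : n ≤ m) : B.RunsIn m t t' := by
  obtain ⟨k, hk, e⟩ := h
  exact ⟨k, hk.trans hnm, e⟩

/-- The block consisting of one step. -/
def act (f : (T → Option Bool) → T → Option Bool × HeadMove) : Block T where
  State := Unit
  finite_state := inferInstance
  entry := ()
  next := fun _ σ => (f σ, none)

/-- Sequential composition. -/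
def seq (P Q : Block T) : Block T where
  State := P.State ⊕ Q.State
  finite_state := by
    have := P.finite_state
    have := Q.finite_state
    infer_instance
  entry := .inl P.entry
  next := fun s σ => match s with
    | .inl s => ((P.next s σ).1, some (match (P.next s σ).2 with
        | none => .inr Q.entry
        | some s' => .inl s'))
    | .inr s => ((Q.next s σ).1, (Q.next s σ).2.map .inr)

open Classical in
/-- Conditional execution. -/
noncomputable def cond (c : (T → Option Bool) → Prop) (P Q : Block T) : Block T where
  State := Option (P.State ⊕ Q.State)
  finite_state := by
    have := P.finite_state
    have := Q.finite_state
    infer_instance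
  entry := none
  next := fun s σ => match s with
    | none => (fun i => (σ i, .stay), some (some (if c σ then .inl P.entry else .inr Q.entry)))
    | some (.inl s) => ((P.next s σ).1, (P.next s σ).2.map fun s' => some (.inl s'))
    | some (.inr s) => ((Q.next s σ).1, (Q.next s σ).2.map fun s' => some (.inr s'))

open Classical in
/-- Conditional iteration. -/
noncomputable def loop (c : (T → Option Bool) → Prop) (P : Block T) : Block T where
  State := Option P.State
  finite_state := by
    have := P.finite_state
    infer_instance
  entry := none
  next := fun s σ => match s with
    | none => (fun i => (σ i, .stay), if c σ then some (some P.entry) else none)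
    | some s => ((P.next s σ).1, some (P.next s σ).2)

infixr:60 " ;; " => seq

/-- The tests in `cond` and `loop` are steps that rewrite the scanned symbols and do not move; they
cost time but change no tape. -/
theorem applyAct_stay (t : T → ℤ → Option Bool) :
    applyAct (fun i => (scan t i, HeadMove.stay)) t = t := by
  funext i
  simp [applyAct, HeadMove.shift, scan]

theorem runsIn_act (f : (T → Option Bool) → T → Option Bool × HeadMove)
    (t : T → ℤ → Option Bool) : (act f).RunsIn 1 t (applyAct (f (scan t)) t) :=
  ⟨1, le_rfl, .exit rfl⟩

theorem Exec.seq_right {P Q : Block T} {s : Q.State} {n : ℕ} {t t' : T → ℤ → Option Bool}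
    (h : Q.Exec s t n t') : (P ;; Q).Exec (.inr s) t n t' := by
  induction h with
  | exit h => exact .exit (by simp [seq, h])
  | step h _ ih => exact .step (by simp [seq, h]) ih

/-- The last step of `P` already enters `Q`, so that running times add up without overhead. -/
theorem Exec.seq_left {P Q : Block T} {s : P.State} {n m : ℕ} {t t' t'' : T → ℤ → Option Bool}
    (h : P.Exec s t n t') (h' : Q.Exec Q.entry t' m t'') :
    (P ;; Q).Exec (.inl s) t (m + n) t'' := by
  induction h with
  | exit h => exact .step (by simp [seq, h]) h'.seq_right
  | step h _ ih => exact .step (by simp [seq, h]) (ih h')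

theorem RunsIn.seq {P Q : Block T} {n m : ℕ} {t t' t'' : T → ℤ → Option Bool}
    (h : P.RunsIn n t t') (h' : Q.RunsIn m t' t'') : (P ;; Q).RunsIn (n + m) t t'' := by
  obtain ⟨k, hk, e⟩ := h
  obtain ⟨k', hk', e'⟩ := h'
  exact ⟨k' + k, by omega, e.seq_left e'⟩

theorem Exec.cond_inl {c : (T → Option Bool) → Prop} {P Q : Block T} {s : P.State} {n : ℕ}
    {t t' : T → ℤ → Option Bool} (h : P.Exec s t n t') :
    (cond c P Q).Exec (some (.inl s)) t n t' := by
  induction h with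
  | exit h => exact .exit (by simp [cond, h])
  | step h _ ih => exact .step (by simp [cond, h]) ih

theorem Exec.cond_inr {c : (T → Option Bool) → Prop} {P Q : Block T} {s : Q.State} {n : ℕ}
    {t t' : T → ℤ → Option Bool} (h : Q.Exec s t n t') :
    (cond c P Q).Exec (some (.inr s)) t n t' := by
  induction h with
  | exit h => exact .exit (by simp [cond, h])
  | step h _ ih => exact .step (by simp [cond, h]) ih

theorem RunsIn.cond_pos {c : (T → Option Bool) → Prop} {P Q : Block T} {n : ℕ}
    {t t' : T → ℤ → Option Bool} (hc : c (scan t)) (h : P.RunsIn n t t') :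
    (cond c P Q).RunsIn (n + 1) t t' := by
  obtain ⟨k, hk, e⟩ := h
  refine ⟨k + 1, by omega, .step (s' := some (.inl P.entry)) (a := fun i => (scan t i, .stay)) ?_ ?_⟩
  · simp [cond, hc]
  · rw [applyAct_stay]
    exact e.cond_inl

theorem RunsIn.cond_neg {c : (T → Option Bool) → Prop} {P Q : Block T} {n : ℕ}
    {t t' : T → ℤ → Option Bool} (hc : ¬ c (scan t)) (h : Q.RunsIn n t t') :
    (cond c P Q).RunsIn (n + 1) t t' := by
  obtain ⟨k, hk, e⟩ := h
  refine ⟨k + 1, by omega, .step (s' := some (.inr Q.entry)) (a := fun i => (scan t i, .stay)) ?_ ?_⟩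
  · simp [cond, hc]
  · rw [applyAct_stay]
    exact e.cond_inr

theorem RunsIn.loop_done {c : (T → Option Bool) → Prop} {P : Block T}
    {t : T → ℤ → Option Bool} (hc : ¬ c (scan t)) : (loop c P).RunsIn 1 t t := by
  refine ⟨1, le_rfl, ?_⟩
  have := Exec.exit (B := loop c P) (s := none) (t := t) (a := fun i => (scan t i, .stay))
    (by simp [loop, hc])
  rwa [applyAct_stay] at this

theorem Exec.loop_body {c : (T → Option Bool) → Prop} {P : Block T} {s : P.State} {n m : ℕ}
    {t t' t'' : T → ℤ → Option Bool} (h : P.Exec s t n t')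
    (h' : (loop c P).Exec none t' m t'') : (loop c P).Exec (some s) t (m + n) t'' := by
  induction h with
  | exit h => exact .step (s' := none) (by simp [loop, h]) h'
  | step h _ ih => exact .step (by simp [loop, h]) (ih h')

theorem RunsIn.loop_step {c : (T → Option Bool) → Prop} {P : Block T} {n m : ℕ}
    {t t' t'' : T → ℤ → Option Bool} (hc : c (scan t)) (h : P.RunsIn n t t')
    (h' : (loop c P).RunsIn m t' t'') : (loop c P).RunsIn (n + 1 + m) t t'' := by
  obtain ⟨k, hk, e⟩ := h
  obtain ⟨k', hk', e'⟩ := h'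
  refine ⟨k' + k + 1, by omega, .step (s' := some P.entry) (a := fun i => (scan t i, .stay)) ?_ ?_⟩
  · simp [loop, hc]
  · rw [applyAct_stay]
    exact e.loop_body e'

end Block

namespace Block

variable {T : Type}

theorem RunsIn.congr {B : Block T} {n m : ℕ} {t t' t'' : T → ℤ → Option Bool}
    (h : B.RunsIn n t t') (hnm : n ≤ m) (ht : t' = t'') : B.RunsIn m t t'' :=
  ht ▸ h.mono hnm

/-- Do nothing. -/
def skip : Block T := act fun σ i => (σ i, .stay)

theorem runsIn_skip (t : T → ℤ → Option Bool) : (skip (T := T)).RunsIn 1 t t := by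
  refine (runsIn_act _ t).congr le_rfl ?_
  exact applyAct_stay t

variable [DecidableEq T]

/-- Write the symbol `g σ` on the tape `A`. -/
def put (A : T) (g : (T → Option Bool) → Option Bool) : Block T :=
  act fun σ i => (if i = A then g σ else σ i, .stay)

/-- Move the head of the tape `A`. -/
def go (A : T) (d : HeadMove) : Block T :=
  act fun σ i => (σ i, if i = A then d else .stay)

theorem runsIn_put (A : T) (g : (T → Option Bool) → Option Bool) (t : T → ℤ → Option Bool) :
    (put A g).RunsIn 1 t (Function.update t A (Function.update (t A) 0 (g (scan t)))) := by
  refine (runsIn_act _ t).congr le_rfl ?_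
  funext i
  by_cases h : i = A
  · subst h; simp [applyAct, HeadMove.shift]
  · simp [applyAct, HeadMove.shift, h, scan]

theorem runsIn_goRight (A : T) (t : T → ℤ → Option Bool) :
    (go A .right).RunsIn 1 t (Function.update t A (shiftTape 1 (t A))) := by
  refine (runsIn_act _ t).congr le_rfl ?_
  funext i
  by_cases h : i = A
  · subst h; simp [applyAct, HeadMove.shift, scan]
  · simp [applyAct, HeadMove.shift, h, scan]

theorem runsIn_goLeft (A : T) (t : T → ℤ → Option Bool) :
    (go A .left).RunsIn 1 t (Function.update t A (shiftTape (-1) (t A))) := by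
  refine (runsIn_act _ t).congr le_rfl ?_
  funext i
  by_cases h : i = A
  · subst h; simp [applyAct, HeadMove.shift, scan]
  · simp [applyAct, HeadMove.shift, h, scan]

/-! ### Moving along a string and copying strings -/

/-- Move the head of `A` to the beginning of the string that it stands on. -/
noncomputable def rewind (A : T) : Block T :=
  go A .left ;; loop (fun σ => σ A ≠ none) (go A .left) ;; go A .right

/-- The invariant places the head one cell to the left of the border between `l` and `r`. The loop
therefore overshoots to the blank in front of the string, and `rewind` ends with a move to the
right. -/
theorem runsIn_rewind_loop (A : T) (l r : List Bool) (t : T → ℤ → Option Bool)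
    (hA : t A = shiftTape (-1) (strTape l r)) :
    (loop (fun σ => σ A ≠ none) (go A .left)).RunsIn (2 * l.length + 1) t
      (Function.update t A (shiftTape (-1) (strTape [] (l.reverse ++ r)))) := by
  induction l generalizing r t with
  | nil =>
    refine (RunsIn.loop_done ?_).congr (by simp) ?_
    · have := strTape_negSucc [] r 0
      simpa [scan, hA] using this
    · simp [← hA]
  | cons a l ih =>
    rw [shiftTape_left] at hA
    refine (RunsIn.loop_step ?_ (runsIn_goLeft A t) (ih (a :: r) _ ?_)).congr ?_ ?_
    · simp [scan, hA]
    · simp [hA]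
    · simp; omega
    · simp

theorem runsIn_rewind (A : T) (l r : List Bool) (t : T → ℤ → Option Bool)
    (hA : t A = strTape l r) :
    (rewind A).RunsIn (2 * l.length + 3) t
      (Function.update t A (strTape [] (l.reverse ++ r))) := by
  refine ((runsIn_goLeft A t).seq ((runsIn_rewind_loop A l r _ (by simp [hA])).seq
    (runsIn_goRight A _))).congr (by omega) ?_
  simp

/-- Copy the string on `A` to `B`. -/
noncomputable def copy (A B : T) : Block T :=
  loop (fun σ => σ A ≠ none) (put B (fun σ => σ A) ;; go A .right ;; go B .right)

/-- Only `Reads` is asked of the source: its cells to the left of the head and beyond the first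
blank do not matter. This allows copying from the output tape that `U` leaves behind. -/
theorem runsIn_copy {A B : T} (hAB : A ≠ B) (r m : List Bool) (t : T → ℤ → Option Bool)
    (hA : Reads (t A) r) (hB : t B = strTape m []) :
    (copy A B).RunsIn (4 * r.length + 1) t
      (Function.update (Function.update t A (shiftTape r.length (t A))) B
        (strTape (r.reverse ++ m) [])) := by
  induction r generalizing m t with
  | nil =>
    refine (RunsIn.loop_done ?_).congr (by simp) ?_
    · simp [scan, hA.zero]
    · simp [← hB]
  | cons a r ih =>
    refine (RunsIn.loop_step ?_ ((runsIn_put B _ t).seq ((runsIn_goRight A _).seq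
      (runsIn_goRight B _))) (ih (a :: m) _ ?_ ?_)).congr ?_ ?_
    · simp [scan, hA.zero]
    · simpa [hAB] using hA.tail
    · simp [hB, scan, hA.zero, hAB.symm, shiftTape_right]
    · simp; omega
    · funext i
      by_cases h : i = B
      · subst h; simp
      · by_cases h' : i = A
        · subst h'; simp [h]
        · simp [h, h']

/-- Write the constant string `w` on `A`. -/
def emit (A : T) : List Bool → Block T
  | [] => skip
  | a :: w => put A (fun _ => some a) ;; go A .right ;; emit A w

theorem runsIn_emit (A : T) (w m : List Bool) (t : T → ℤ → Option Bool)
    (hA : t A = strTape m []) :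
    (emit A w).RunsIn (2 * w.length + 1) t
      (Function.update t A (strTape (w.reverse ++ m) [])) := by
  induction w generalizing m t with
  | nil => exact (runsIn_skip t).congr (by simp) (by simp [← hA])
  | cons a w ih =>
    refine ((runsIn_put A _ t).seq ((runsIn_goRight A _).seq (ih (a :: m) _ ?_))).congr ?_ ?_
    · simp [hA, shiftTape_right]
    · simp; omega
    · simp

/-- Write the string on `A` to `B` as the first component of a pair. -/
noncomputable def pairOut (A B : T) : Block T :=
  loop (fun σ => σ A ≠ none) (put B (fun _ => some true) ;; go B .right ;;
    put B (fun σ => σ A) ;; go A .right ;; go B .right) ;; emit B [false]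

theorem runsIn_pairOut_loop {A B : T} (hAB : A ≠ B) (r m : List Bool) (t : T → ℤ → Option Bool)
    (hA : Reads (t A) r) (hB : t B = strTape m []) :
    (loop (fun σ => σ A ≠ none) (put B (fun _ => some true) ;; go B .right ;;
      put B (fun σ => σ A) ;; go A .right ;; go B .right)).RunsIn (6 * r.length + 1) t
      (Function.update (Function.update t A (shiftTape r.length (t A))) B
        (strTape ((r.flatMap fun b => [true, b]).reverse ++ m) [])) := by
  induction r generalizing m t with
  | nil =>
    refine (RunsIn.loop_done ?_).congr (by simp) ?_
    · simp [scan, hA.zero]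
    · simp [← hB]
  | cons a r ih =>
    refine (RunsIn.loop_step ?_ ((runsIn_put B _ t).seq ((runsIn_goRight B _).seq
      ((runsIn_put B _ _).seq ((runsIn_goRight A _).seq
      (runsIn_goRight B _))))) (ih (a :: true :: m) _ ?_ ?_)).congr ?_ ?_
    · simp [scan, hA.zero]
    · simpa [hAB] using hA.tail
    · simp [hB, scan, hA.zero, hAB, hAB.symm, shiftTape_right]
    · simp; omega
    · funext i
      by_cases h : i = B
      · subst h; simp
      · by_cases h' : i = A
        · subst h'; simp [h]
        · simp [h, h']

theorem runsIn_pairOut {A B : T} (hAB : A ≠ B) (r m : List Bool) (t : T → ℤ → Option Bool)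
    (hA : Reads (t A) r) (hB : t B = strTape m []) :
    (pairOut A B).RunsIn (6 * r.length + 4) t
      (Function.update (Function.update t A (shiftTape r.length (t A))) B
        (strTape ((pairCode r []).reverse ++ m) [])) := by
  refine ((runsIn_pairOut_loop hAB r m t hA hB).seq (runsIn_emit B [false]
    ((r.flatMap fun b => [true, b]).reverse ++ m) _ ?_)).congr ?_ ?_
  · simp
  · simp
  · simp [pairCode]

/-- Read the first component of the pair on `A`, and write it to `B`. -/
noncomputable def unpair (A B : T) : Block T :=
  loop (fun σ => σ A = some true) (go A .right ;; put B (fun σ => σ A) ;; go A .right ;;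
    go B .right) ;; go A .right

theorem runsIn_unpair_loop {A B : T} (hAB : A ≠ B) (x y m : List Bool)
    (t : T → ℤ → Option Bool) (hA : Reads (t A) (pairCode x y)) (hB : t B = strTape m []) :
    (loop (fun σ => σ A = some true) (go A .right ;; put B (fun σ => σ A) ;; go A .right ;;
      go B .right)).RunsIn (5 * x.length + 1) t
      (Function.update (Function.update t A (shiftTape (2 * x.length) (t A))) B
        (strTape (x.reverse ++ m) [])) := by
  induction x generalizing m t with
  | nil =>
    refine (RunsIn.loop_done ?_).congr (by simp) ?_
    · simp [scan, hA.zero, pairCode_nil]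
    · simp [← hB]
  | cons a x ih =>
    rw [pairCode_cons] at hA
    refine (RunsIn.loop_step ?_ ((runsIn_goRight A t).seq ((runsIn_put B _ _).seq
      ((runsIn_goRight A _).seq
      (runsIn_goRight B _)))) (ih (a :: m) _ ?_ ?_)).congr ?_ ?_
    · simp [scan, hA.zero]
    · simpa [hAB, hAB.symm] using hA.tail.tail
    · have := hA.tail.zero
      simp only [shiftTape_apply, zero_add, List.head?_cons] at this
      simp [hB, scan, this, hAB.symm, shiftTape_right]
    · simp; omega
    · funext i
      by_cases h : i = B
      · subst h; simp
      · by_cases h' : i = A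
        · subst h'; simp [h, mul_add]
        · simp [h, h']

theorem runsIn_unpair {A B : T} (hAB : A ≠ B) (x y m : List Bool)
    (t : T → ℤ → Option Bool) (hA : Reads (t A) (pairCode x y)) (hB : t B = strTape m []) :
    (unpair A B).RunsIn (5 * x.length + 2) t
      (Function.update (Function.update t A (shiftTape (2 * x.length + 1) (t A))) B
        (strTape (x.reverse ++ m) [])) := by
  refine ((runsIn_unpair_loop hAB x y m t hA hB).seq (runsIn_goRight A _)).congr le_rfl ?_
  funext i
  by_cases h : i = B
  · subst h; simp [hAB.symm]
  · by_cases h' : i = A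
    · subst h'; simp [h, add_comm]
    · simp [h, h']

/-- Copy from `A` to `B` as many symbols as there are on `C`, erasing `C`. -/
noncomputable def copyCount (C A B : T) : Block T :=
  loop (fun σ => σ C ≠ none) (put C (fun _ => none) ;; go C .right ;;
    put B (fun σ => σ A) ;; go A .right ;; go B .right)

/-- Further bits `q` may follow on the source, so no blank shows where `r` ends; the counter on `C`
does. -/
theorem runsIn_copyCount {A B C : T} (hAB : A ≠ B) (hCA : C ≠ A) (hCB : C ≠ B)
    (r q m : List Bool) (t : T → ℤ → Option Bool) (hA : Reads (t A) (r ++ q))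
    (hB : t B = strTape m []) (hC : t C = strTape [] (List.replicate r.length true)) :
    (copyCount C A B).RunsIn (6 * r.length + 1) t
      (Function.update (Function.update (Function.update t A (shiftTape r.length (t A))) B
        (strTape (r.reverse ++ m) [])) C (strTape [] [])) := by
  induction r generalizing m t with
  | nil =>
    simp only [List.length_nil, List.replicate_zero] at hC
    refine (RunsIn.loop_done ?_).congr (by simp) ?_
    · simp [scan, hC]
    · simp [← hC, ← hB]
  | cons a r ih =>
    simp only [List.length_cons, List.replicate_succ] at hC
    refine (RunsIn.loop_step ?_ ((runsIn_put C _ t).seq ((runsIn_goRight C _).seq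
      ((runsIn_put B _ _).seq ((runsIn_goRight A _).seq
      (runsIn_goRight B _))))) (ih (a :: m) _ ?_ ?_ ?_)).congr ?_ ?_
    · simp [scan, hC]
    · simpa [hAB, hCA.symm] using hA.tail
    · simp [hB, scan, hA.zero, hAB.symm, hCA.symm, hCB.symm, shiftTape_right]
    · simp [hC, hCA, hCB, erase_shiftTape_right]
    · simp; omega
    · funext i
      by_cases h : i = C
      · subst h; simp
      · by_cases h' : i = B
        · subst h'; simp [h]
        · by_cases h'' : i = A
          · subst h''; simp [h, h']
          · simp [h, h', h'']

end Block

/-- The number in unary that a binary string denotes, given what has been read before. -/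
def hornerValue (k : ℕ) (v : List Bool) : ℕ := v.foldl (fun k b => 2 * k + b.toNat) k

@[simp] theorem hornerValue_cons (k : ℕ) (a : Bool) (v : List Bool) :
    hornerValue k (a :: v) = hornerValue (2 * k + a.toNat) v := rfl

theorem le_hornerValue (k : ℕ) (v : List Bool) : k ≤ hornerValue k v := by
  induction v generalizing k with
  | nil => exact le_rfl
  | cons a v ih => exact le_trans (show k ≤ 2 * k + a.toNat by omega) (ih _)

/-- The successor in the enumeration `ε, 0, 1, 00, 10, 01, 11, 000, …` of the binary strings. -/
def succStr : List Bool → List Bool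
  | [] => [false]
  | false :: w => true :: w
  | true :: w => false :: succStr w

namespace Block

variable {T : Type} [DecidableEq T]

/-! ### Unary numbers -/

/-- Write two marks on `C` for every mark on `B`, erasing `B`. -/
noncomputable def twice (B C : T) : Block T :=
  loop (fun σ => σ B ≠ none) (put B (fun _ => none) ;; go B .right ;; emit C [true, true])

theorem runsIn_twice {B C : T} (hBC : B ≠ C) (k j : ℕ) (t : T → ℤ → Option Bool)
    (hB : t B = strTape [] (List.replicate k true))
    (hC : t C = strTape (List.replicate j true) []) :
    (twice B C).RunsIn (8 * k + 1) t (Function.update (Function.update t B (strTape [] []))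
      C (strTape (List.replicate (2 * k + j) true) [])) := by
  induction k generalizing j t with
  | zero =>
    simp only [List.replicate_zero] at hB
    refine (RunsIn.loop_done ?_).congr (by simp) ?_
    · simp [scan, hB]
    · simp [← hB, ← hC]
  | succ k ih =>
    simp only [List.replicate_succ] at hB
    refine (RunsIn.loop_step ?_ ((runsIn_put B _ t).seq ((runsIn_goRight B _).seq
      (runsIn_emit C [true, true] (List.replicate j true) _ ?_))) (ih (j + 2) _ ?_ ?_)).congr ?_ ?_
    · simp [scan, hB]
    · simp [hC, hBC.symm]
    · simp [hB, hBC, erase_shiftTape_right]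
    · simp [List.replicate_succ]
    · simp; omega
    · have h2 : 2 * k + (j + 2) = 2 * (k + 1) + j := by ring
      rw [h2]
      funext i
      by_cases h : i = C
      · subst h; simp
      · by_cases h' : i = B
        · subst h'; simp [h]
        · simp [h, h']

/-- Move the marks on `C` to `B`. -/
noncomputable def transfer (C B : T) : Block T :=
  loop (fun σ => σ C ≠ none) (put C (fun _ => none) ;; go C .right ;; emit B [true])

theorem runsIn_transfer {B C : T} (hBC : B ≠ C) (k j : ℕ) (t : T → ℤ → Option Bool)
    (hC : t C = strTape [] (List.replicate k true))
    (hB : t B = strTape (List.replicate j true) []) :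
    (transfer C B).RunsIn (6 * k + 1) t (Function.update (Function.update t C (strTape [] []))
      B (strTape (List.replicate (k + j) true) [])) := by
  induction k generalizing j t with
  | zero =>
    simp only [List.replicate_zero] at hC
    refine (RunsIn.loop_done ?_).congr (by simp) ?_
    · simp [scan, hC]
    · simp [← hB, ← hC]
  | succ k ih =>
    simp only [List.replicate_succ] at hC
    refine (RunsIn.loop_step ?_ ((runsIn_put C _ t).seq ((runsIn_goRight C _).seq
      (runsIn_emit B [true] (List.replicate j true) _ ?_))) (ih (j + 1) _ ?_ ?_)).congr ?_ ?_
    · simp [scan, hC]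
    · simp [hB, hBC]
    · simp [hC, hBC.symm, erase_shiftTape_right]
    · simp [List.replicate_succ]
    · simp; omega
    · have h2 : k + (j + 1) = k + 1 + j := by ring
      rw [h2]
      funext i
      by_cases h : i = B
      · subst h; simp
      · by_cases h' : i = C
        · subst h'; simp [h]
        · simp [h, h']

/-- Replace the unary number `k` on `B` by `2 * k + b`, where `b` is the bit scanned on `A`. -/
noncomputable def double (A B C : T) : Block T :=
  twice B C ;; cond (fun σ => σ A = some true) (emit C [true]) skip ;; rewind C ;;
    transfer C B ;; rewind B

theorem runsIn_double {A B C : T} (hAB : A ≠ B) (hAC : A ≠ C) (hBC : B ≠ C) (k : ℕ) (b : Bool)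
    (t : T → ℤ → Option Bool) (hA : t A 0 = some b)
    (hB : t B = strTape [] (List.replicate k true)) (hC : t C = strTape [] []) :
    (double A B C).RunsIn (28 * k + 28) t
      (Function.update t B (strTape [] (List.replicate (2 * k + b.toNat) true))) := by
  have h1 := runsIn_twice hBC k 0 t hB (by simpa using hC)
  set t1 := Function.update (Function.update t B (strTape [] []))
      C (strTape (List.replicate (2 * k + 0) true) []) with ht1
  have h2 : (cond (fun σ => σ A = some true) (emit C [true]) skip).RunsIn 4 t1
      (Function.update t1 C (strTape (List.replicate (2 * k + b.toNat) true) [])) := by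
    cases b with
    | true =>
      refine (RunsIn.cond_pos ?_ (runsIn_emit C [true] (List.replicate (2 * k) true) _ ?_)).congr
        (by simp) ?_
      · simp [scan, ht1, hAB, hAC, hA]
      · simp [ht1]
      · simp [List.replicate_succ]
    | false =>
      refine (RunsIn.cond_neg ?_ (runsIn_skip _)).congr (by simp) ?_
      · simp [scan, ht1, hAB, hAC, hA]
      · simp [ht1]
  refine (h1.seq (h2.seq ((runsIn_rewind C (List.replicate (2 * k + b.toNat) true) [] _ ?_).seq
    ((runsIn_transfer hBC (2 * k + b.toNat) 0 _ ?_ ?_).seq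
      (runsIn_rewind B (List.replicate (2 * k + b.toNat) true) [] _ ?_))))).congr ?_ ?_
  · simp
  · simp
  · simp [ht1, hBC]
  · simp
  · have : b.toNat ≤ 1 := Bool.toNat_le b
    simp; omega
  · funext i
    by_cases h : i = B
    · subst h; simp
    · by_cases h' : i = C
      · subst h'; simp [h, hC]
      · simp [h, h', ht1]

/-- Write on `B` in unary the number that the string on `A` denotes. -/
noncomputable def horner (A B C : T) : Block T :=
  emit B [true] ;; rewind B ;; loop (fun σ => σ A ≠ none) (double A B C ;; go A .right)

/-- Amortised bound: a pass takes at most 28k + 30 steps, which is at most 70k because `1 ≤ k`, and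
it raises the value by at least k. The sum telescopes to the total growth, so the time is linear in
the resulting number. -/
theorem runsIn_horner_loop {A B C : T} (hAB : A ≠ B) (hAC : A ≠ C) (hBC : B ≠ C) (k : ℕ)
    (hk : 1 ≤ k) (v : List Bool) (t : T → ℤ → Option Bool) (hA : Reads (t A) v)
    (hB : t B = strTape [] (List.replicate k true)) (hC : t C = strTape [] []) :
    (loop (fun σ => σ A ≠ none) (double A B C ;; go A .right)).RunsIn
      (70 * (hornerValue k v - k) + 1) t
      (Function.update (Function.update t A (shiftTape v.length (t A))) B
        (strTape [] (List.replicate (hornerValue k v) true))) := by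
  induction v generalizing k t with
  | nil =>
    refine (RunsIn.loop_done ?_).congr (by simp) ?_
    · simp [scan, hA.zero]
    · simp [hornerValue, ← hB]
  | cons a v ih =>
    refine (RunsIn.loop_step ?_ ((runsIn_double hAB hAC hBC k a t ?_ hB hC).seq
      (runsIn_goRight A _)) (ih (2 * k + a.toNat) (by omega) _ ?_ ?_ ?_)).congr ?_ ?_
    · simp [scan, hA.zero]
    · simp [hA.zero]
    · simpa [hAB] using hA.tail
    · simp [hAB.symm]
    · simp [hC, hBC.symm, hAC.symm]
    · have := le_hornerValue (2 * k + a.toNat) v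
      simp only [hornerValue_cons]
      omega
    · funext i
      by_cases h : i = B
      · subst h; simp
      · by_cases h' : i = A
        · subst h'; simp [h]
        · simp [h, h']

theorem runsIn_horner {A B C : T} (hAB : A ≠ B) (hAC : A ≠ C) (hBC : B ≠ C)
    (v : List Bool) (t : T → ℤ → Option Bool) (hA : Reads (t A) v)
    (hB : t B = strTape [] []) (hC : t C = strTape [] []) :
    (horner A B C).RunsIn (70 * hornerValue 1 v) t
      (Function.update (Function.update t A (shiftTape v.length (t A))) B
        (strTape [] (List.replicate (hornerValue 1 v) true))) := by
  refine ((runsIn_emit B [true] [] t hB).seq ((runsIn_rewind B [true] [] _ ?_).seq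
    (runsIn_horner_loop hAB hAC hBC 1 le_rfl v _ ?_ ?_ ?_))).congr ?_ ?_
  · simp
  · simpa [hAB] using hA
  · simp
  · simp [hC, hBC.symm]
  · have := le_hornerValue 1 v
    simp; omega
  · funext i
    by_cases h : i = B
    · subst h; simp
    · by_cases h' : i = A
      · subst h'; simp [h]
      · simp [h, h']

/-! ### Enumerating and comparing strings -/

/-- Replace the string on `A` by its successor. -/
noncomputable def incr (A : T) : Block T :=
  loop (fun σ => σ A = some true) (put A (fun _ => some false) ;; go A .right) ;;
    put A (fun σ => some (σ A).isSome) ;; rewind A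

/-- The carry runs over the leading `true` bits. The invariant is the final result `l.reverse ++
succStr w`, which passing a carry does not change. -/
theorem runsIn_incr_loop (A : T) (l w : List Bool) (t : T → ℤ → Option Bool)
    (hA : t A = strTape l w) : ∃ l' w', w'.head? ≠ some true ∧
      l'.reverse ++ succStr w' = l.reverse ++ succStr w ∧ l'.length ≤ l.length + w.length ∧
      (loop (fun σ => σ A = some true) (put A (fun _ => some false) ;; go A .right)).RunsIn
        (3 * w.length + 1) t (Function.update t A (strTape l' w')) := by
  induction w generalizing l t with
  | nil =>
    refine ⟨l, [], by simp, rfl, by simp, (RunsIn.loop_done ?_).congr (by simp) ?_⟩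
    · simp [scan, hA]
    · simp [← hA]
  | cons a w ih =>
    cases a with
    | false =>
      refine ⟨l, false :: w, by simp, rfl, by simp, (RunsIn.loop_done ?_).congr (by simp) ?_⟩
      · simp [scan, hA]
      · simp [← hA]
    | true =>
      obtain ⟨l', w', h1, h2, h3, h4⟩ := ih (false :: l)
        (Function.update t A (strTape (false :: l) w)) (by simp)
      have e : Function.update (Function.update t A (Function.update (t A) 0 (some false))) A
          (shiftTape 1 (Function.update t A (Function.update (t A) 0 (some false)) A)) =
          Function.update t A (strTape (false :: l) w) := by
        simp [hA, shiftTape_right]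
      rw [← e] at h4
      refine ⟨l', w', h1, by simpa [succStr] using h2, by simp at h3 ⊢; omega, ?_⟩
      refine (RunsIn.loop_step ?_ ((runsIn_put A _ t).seq (runsIn_goRight A _)) h4).congr ?_ ?_
      · simp [scan, hA]
      · simp; omega
      · simp

theorem runsIn_incr (A : T) (w : List Bool) (t : T → ℤ → Option Bool)
    (hA : t A = strTape [] w) :
    (incr A).RunsIn (5 * w.length + 5) t (Function.update t A (strTape [] (succStr w))) := by
  obtain ⟨l', w', h1, h2, h3, h4⟩ := runsIn_incr_loop A [] w t hA
  -- `isSome` handles both ends of the carry at once: a blank becomes `false` and the string grows,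
  -- a `false` becomes `true`.
  have h5 : Function.update (strTape l' w') 0 (some w'.head?.isSome) =
      strTape l' (succStr w') := by
    rcases w' with _ | ⟨_ | _, w'⟩
    · simp [succStr]
    · simp [succStr]
    · simp at h1
  refine (h4.seq ((runsIn_put A _ _).seq (runsIn_rewind A l' (succStr w') _ ?_))).congr ?_ ?_
  · simp [scan, h5]
  · simp at h3; omega
  · simp [h2]

/-- Mark `F` if the string on `X` is what is read on `A`. -/
noncomputable def compare (A X F : T) : Block T :=
  loop (fun σ => σ X ≠ none ∧ σ X = σ A) (go X .right ;; go A .right) ;;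
    cond (fun σ => σ X = none ∧ σ A = none) (put F fun _ => some true) skip ;; rewind X

/-- Both heads advance while the symbols agree. Since `Reads` includes the blank after the string,
success means that `X` is exhausted and `A` shows a blank at the same moment. -/
theorem runsIn_compare_loop {A X : T} (hAX : A ≠ X) (l x : List Bool)
    (t : T → ℤ → Option Bool) (hX : t X = strTape l x) : ∃ (j : ℕ) (l' x' : List Bool),
      j ≤ x.length ∧ l'.reverse ++ x' = l.reverse ++ x ∧ l'.length ≤ l.length + x.length ∧
      ((x' = [] ∧ t A j = none) ↔ Reads (t A) x) ∧
      (loop (fun σ => σ X ≠ none ∧ σ X = σ A) (go X .right ;; go A .right)).RunsIn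
        (3 * x.length + 1) t (Function.update (Function.update t A (shiftTape j (t A))) X
          (strTape l' x')) := by
  induction x generalizing l t with
  | nil =>
    refine ⟨0, l, [], by simp, rfl, by simp, ?_, (RunsIn.loop_done ?_).congr (by simp) ?_⟩
    · simp [Reads]
    · simp [scan, hX]
    · simp [← hX]
  | cons a x ih =>
    by_cases ha : t A 0 = some a
    · obtain ⟨j, l', x', h1, h2, h3, h4, h5⟩ := ih (a :: l)
        (Function.update (Function.update t A (shiftTape 1 (t A))) X (strTape (a :: l) x))
        (by simp)
      have e : Function.update (Function.update t X (shiftTape 1 (t X))) A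
          (shiftTape 1 (Function.update t X (shiftTape 1 (t X)) A)) =
          Function.update (Function.update t A (shiftTape 1 (t A))) X (strTape (a :: l) x) := by
        funext i
        by_cases h : i = X
        · subst h; simp [hAX.symm, hX, shiftTape_right]
        · by_cases h' : i = A
          · subst h'; simp [h]
          · simp [h, h']
      rw [← e] at h5
      refine ⟨j + 1, l', x', by simp; omega, by simpa using h2, by simp at h3 ⊢; omega, ?_,
        (RunsIn.loop_step ?_ ((runsIn_goRight X _).seq (runsIn_goRight A _)) h5).congr ?_ ?_⟩
      · simp only [ne_eq, hAX, not_false_eq_true, Function.update_of_ne, Function.update_self,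
          shiftTape_apply] at h4
        push_cast
        rw [h4]
        constructor
        · intro h i hi
          cases i with
          | zero => simpa using ha
          | succ i => simpa using h i (by simpa using hi)
        · exact fun h => h.tail
      · simp [scan, hX, ha]
      · simp; omega
      · funext i
        by_cases h : i = X
        · subst h; simp
        · by_cases h' : i = A
          · subst h'; simp [h]
          · simp [h, h']
    · refine ⟨0, l, a :: x, by simp, rfl, by simp, ?_, (RunsIn.loop_done ?_).congr (by simp) ?_⟩
      · simp only [reduceCtorEq, false_and, false_iff]
        intro h
        exact ha (by simpa using h.zero)
      · simp only [scan, hX, strTape_zero, List.head?_cons]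
        exact fun h => ha h.2.symm
      · simp [← hX]

-- The head of `A` stays where the comparison ended. Only the bound on its displacement `j` is
-- needed, since `tryProgram` clears that tape afterwards.
open Classical in
theorem runsIn_compare {A X F : T} (hAX : A ≠ X) (hAF : A ≠ F) (hXF : X ≠ F) (x : List Bool)
    (t : T → ℤ → Option Bool) (hX : t X = strTape [] x) (hF : t F = strTape [] []) :
    ∃ j : ℕ, j ≤ x.length ∧ (compare A X F).RunsIn (5 * x.length + 8) t
      (Function.update (Function.update t A (shiftTape j (t A))) F
        (strTape [] (if Reads (t A) x then [true] else []))) := by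
  obtain ⟨j, l', x', h1, h2, h3, h4, h5⟩ := runsIn_compare_loop hAX [] x t hX
  set t1 := Function.update (Function.update t A (shiftTape j (t A))) X (strTape l' x') with ht1
  have h6 : (cond (fun σ => σ X = none ∧ σ A = none) (put F fun _ => some true) skip).RunsIn 2 t1
      (Function.update t1 F (strTape [] (if Reads (t A) x then [true] else []))) := by
    have h7 : (scan t1 X = none ∧ scan t1 A = none) ↔ Reads (t A) x := by
      rw [← h4]
      simp [scan, ht1, hAX]
    by_cases h : Reads (t A) x
    · refine (RunsIn.cond_pos (h7.2 h) (runsIn_put F _ _)).congr le_rfl ?_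
      simp [h, ht1, hXF.symm, hAF.symm, hF]
    · refine (RunsIn.cond_neg (fun h' => h (h7.1 h')) (runsIn_skip _)).congr le_rfl ?_
      simp [h, ht1, hXF.symm, hAF.symm, ← hF]
  refine ⟨j, h1, (h5.seq (h6.seq (runsIn_rewind X l' x' _ ?_))).congr ?_ ?_⟩
  · simp [ht1, hXF]
  · simp at h3; omega
  · simp at h2
    funext i
    by_cases h : i = X
    · subst h; simp [h2, hXF, hAX.symm, hX]
    · by_cases h' : i = F
      · subst h'; simp [h]
      · simp [h, h', ht1]

/-! ### Clearing a group of tapes -/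

open Classical in
/-- On all tapes in `S`, write as `g` says and move as `d` says. -/
noncomputable def actOn (S : T → Prop) (g : Option Bool → Option Bool) (d : HeadMove) : Block T :=
  act fun σ i => if S i then (g (σ i), d) else (σ i, .stay)

/-- The effect of one `actOn` on a tape. -/
def actFun (g : Option Bool → Option Bool) (d : HeadMove) (f : ℤ → Option Bool) :
    ℤ → Option Bool :=
  shiftTape d.shift (Function.update f 0 (g (f 0)))

open Classical in
/-- Apply `φ` to the tapes in `S`. -/
noncomputable def mapOn (S : T → Prop) (φ : (ℤ → Option Bool) → ℤ → Option Bool)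
    (t : T → ℤ → Option Bool) : T → ℤ → Option Bool :=
  fun i => if S i then φ (t i) else t i

omit [DecidableEq T] in
theorem runsIn_actOn (S : T → Prop) (g : Option Bool → Option Bool) (d : HeadMove)
    (t : T → ℤ → Option Bool) : (actOn S g d).RunsIn 1 t (mapOn S (actFun g d) t) := by
  refine (runsIn_act _ t).congr le_rfl ?_
  funext i
  by_cases h : S i
  · simp [applyAct, mapOn, h, actFun, scan]
  · simp [applyAct, mapOn, h, scan, HeadMove.shift]

/-- Do `P` as many times as there are marks on `C`. -/
noncomputable def sweep (C : T) (P : Block T) : Block T :=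
  loop (fun σ => σ C ≠ none) (go C .right ;; P) ;; rewind C

theorem runsIn_sweep_loop {C : T} {S : T → Prop} (hC : ¬ S C)
    {φ : (ℤ → Option Bool) → ℤ → Option Bool}
    {P : Block T} {m : ℕ} (hP : ∀ t, P.RunsIn m t (mapOn S φ t)) (k j : ℕ)
    (t : T → ℤ → Option Bool)
    (ht : t C = strTape (List.replicate j true) (List.replicate k true)) :
    (loop (fun σ => σ C ≠ none) (go C .right ;; P)).RunsIn ((m + 2) * k + 1) t
      (Function.update (mapOn S φ^[k] t) C (strTape (List.replicate (k + j) true) [])) := by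
  induction k generalizing j t with
  | zero =>
    refine (RunsIn.loop_done ?_).congr (by simp) ?_
    · simp [scan, ht]
    · funext i
      by_cases h : i = C
      · subst h; simp [ht]
      · simp [h, mapOn]
  | succ k ih =>
    rw [List.replicate_succ] at ht
    refine (RunsIn.loop_step ?_ ((runsIn_goRight C _).seq (hP _)) (ih (j + 1) _ ?_)).congr ?_ ?_
    · simp [scan, ht]
    · simp [mapOn, hC, ht, shiftTape_right, List.replicate_succ]
    · apply le_of_eq; ring
    · have h2 : k + (j + 1) = k + 1 + j := by ring
      rw [h2]
      funext i
      by_cases h : i = C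
      · subst h; simp
      · by_cases h' : S i
        · simp [mapOn, h, h', Function.iterate_succ]
        · simp [mapOn, h, h']

theorem runsIn_sweep {C : T} {S : T → Prop} (hC : ¬ S C)
    {φ : (ℤ → Option Bool) → ℤ → Option Bool}
    {P : Block T} {m : ℕ} (hP : ∀ t, P.RunsIn m t (mapOn S φ t)) (k : ℕ)
    (t : T → ℤ → Option Bool) (ht : t C = strTape [] (List.replicate k true)) :
    (sweep C P).RunsIn ((m + 4) * k + 4) t (mapOn S φ^[k] t) := by
  refine ((runsIn_sweep_loop hC hP k 0 t (by simpa using ht)).seq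
    (runsIn_rewind C (List.replicate (k + 0) true) [] _ ?_)).congr ?_ ?_
  · simp
  · simp only [List.length_replicate, add_zero]
    apply le_of_eq; ring
  · funext i
    by_cases h : i = C
    · subst h; simp [mapOn, hC, ht]
    · simp [h]

/-- The block `P`, executed `n + 1` times. -/
def times (P : Block T) : ℕ → Block T
  | 0 => P
  | n + 1 => P ;; times P n

omit [DecidableEq T] in
theorem runsIn_times {P : Block T} {S : T → Prop} {φ : (ℤ → Option Bool) → ℤ → Option Bool}
    {m : ℕ} (hP : ∀ t, P.RunsIn m t (mapOn S φ t)) (n : ℕ) (t : T → ℤ → Option Bool) :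
    (times P n).RunsIn (m * (n + 1)) t (mapOn S φ^[n + 1] t) := by
  induction n generalizing t with
  | zero => exact (show P.RunsIn _ _ _ from hP t).congr (by simp) (by simp)
  | succ n ih =>
    refine ((hP t).seq (ih _)).congr (le_of_eq (by ring)) ?_
    funext i
    by_cases h : S i <;> simp [mapOn, h, Function.iterate_succ]

end Block

/-! ### Supports of tapes -/

/-- All nonblank cells of the tape `f` are between `a` and `b`. -/
def SuppIn (f : ℤ → Option Bool) (a b : ℤ) : Prop := ∀ z, f z ≠ none → a ≤ z ∧ z ≤ b

theorem SuppIn.mono {f : ℤ → Option Bool} {a b a' b' : ℤ} (h : SuppIn f a b) (ha : a' ≤ a)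
    (hb : b ≤ b') : SuppIn f a' b' := fun z hz => ⟨ha.trans (h z hz).1, (h z hz).2.trans hb⟩

theorem SuppIn.shift {f : ℤ → Option Bool} {a b : ℤ} (h : SuppIn f a b) (d : ℤ) :
    SuppIn (shiftTape d f) (a - d) (b - d) := fun z hz => by
  have := h _ hz
  constructor <;> omega

theorem SuppIn.update {f : ℤ → Option Bool} {a b : ℤ} (h : SuppIn f a b) (c : Option Bool)
    {z : ℤ} (ha : a ≤ z) (hb : z ≤ b) : SuppIn (Function.update f z c) a b := fun w hw => by
  by_cases h' : w = z
  · subst h'; exact ⟨ha, hb⟩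
  · rw [Function.update_of_ne h'] at hw
    exact h w hw

theorem suppIn_tapeOf (u : List Bool) : SuppIn (tapeOf u) 0 u.length := fun z hz => by
  unfold tapeOf at hz
  split_ifs at hz with h
  · have : z.toNat < u.length := by
      by_contra h'
      exact hz (List.getElem?_eq_none (by omega))
    omega
  · exact absurd rfl hz

theorem eq_blank_of_suppIn {f : ℤ → Option Bool} {a b : ℤ} (h : SuppIn f a b) (hab : b < a) :
    f = strTape [] [] := by
  rw [strTape_nil_nil]
  funext z
  by_contra hz
  have := h z hz
  omega

theorem suppIn_iterate_left {f : ℤ → Option Bool} {a b : ℤ} (h : SuppIn f a b) (k : ℕ) :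
    SuppIn ((Block.actFun id .left)^[k] f) (a + k) (b + k) := by
  induction k with
  | zero => simpa using h
  | succ k ih =>
    rw [Function.iterate_succ_apply']
    have := ih.shift (-1)
    simp only [Block.actFun, HeadMove.shift, id, Function.update_eq_self]
    refine this.mono ?_ ?_ <;> push_cast <;> omega

/-- Nothing lies to the left of the head, and the scanned cell is blanked before the head leaves it.
So the left end stays at 0 while the right end comes nearer by one with each move. -/
theorem suppIn_iterate_erase {f : ℤ → Option Bool} {b : ℤ} (h : SuppIn f 0 b) (k : ℕ) :
    SuppIn ((Block.actFun (fun _ => none) .right)^[k] f) 0 (b - k) := by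
  induction k with
  | zero => simpa using h
  | succ k ih =>
    rw [Function.iterate_succ_apply']
    intro z hz
    simp only [Block.actFun, HeadMove.shift, shiftTape_apply] at hz
    by_cases h' : z + 1 = 0
    · simp [h'] at hz
    · rw [Function.update_of_ne h'] at hz
      have := ih _ hz
      push_cast
      omega

namespace Block

variable {T : Type} [DecidableEq T]

/-- Erase the tapes in `S`, using the clock `C`. -/
noncomputable def clear (S : T → Prop) (C : T) : Block T :=
  sweep C (times (actOn S id .left) 3) ;;
    sweep C (times (actOn S (fun _ => none) .right) 11)

/-- Moving left 4k times brings all nonblank cells into [0, 11k] as seen from the head; 12k erasing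
moves to the right then leave nothing, as `1 ≤ k`. The final head positions are irrelevant, since a
blank tape looks the same from everywhere. -/
theorem runsIn_clear {C : T} {S : T → Prop} (hC : ¬ S C) (k : ℕ) (hk : 1 ≤ k)
    (t : T → ℤ → Option Bool) (ht : t C = strTape [] (List.replicate k true))
    (hS : ∀ i, S i → SuppIn (t i) (-(4 * k)) (7 * k)) :
    (clear S C).RunsIn (24 * k + 8) t (mapOn S (fun _ => strTape [] []) t) := by
  refine ((runsIn_sweep hC (runsIn_times (runsIn_actOn S id .left) 3) k t ht).seq
    (runsIn_sweep hC (runsIn_times (runsIn_actOn S (fun _ => none) .right) 11) k _ ?_)).congr ?_ ?_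
  · simp [mapOn, hC, ht]
  · omega
  · funext i
    by_cases h : S i
    · simp only [mapOn, h, if_true, ← Function.iterate_mul]
      have h1 := suppIn_iterate_left (hS i h) ((3 + 1) * k)
      have h2 := suppIn_iterate_erase (h1.mono (a' := 0) (by push_cast; omega) le_rfl) ((11 + 1) * k)
      exact eq_blank_of_suppIn h2 (by push_cast; omega)
    · simp [mapOn, h]

end Block

/-! ### Simulation of the reference machine -/

namespace MultitapeTM

/-- The tapes of the program for erasure with the reference machine `U`: two copies of the tapes
of `U`, with a clock for each of them, and the tapes of the program itself. -/
inductive WTape (U : MultitapeTM) : Type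
  | inp | out | x | nb | r | p | num | tmp | mark | sign | halted | found
  | clk (b : Bool)
  | sim (b : Bool) (j : U.Tape)

noncomputable instance (U : MultitapeTM) : DecidableEq (WTape U) := Classical.decEq _

theorem finite_wTape (U : MultitapeTM) : Finite (WTape U) := by
  have := U.finite_tape
  let f : Fin 12 ⊕ Bool ⊕ (Bool × U.Tape) → WTape U := fun s => match s with
    | .inl k => ![.inp, .out, .x, .nb, .r, .p, .num, .tmp, .mark, .sign, .halted, .found] k
    | .inr (.inl b) => .clk b
    | .inr (.inr (b, j)) => .sim b j
  refine Finite.of_surjective f fun i => ?_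
  cases i with
  | inp => exact ⟨.inl 0, rfl⟩
  | out => exact ⟨.inl 1, rfl⟩
  | x => exact ⟨.inl 2, rfl⟩
  | nb => exact ⟨.inl 3, rfl⟩
  | r => exact ⟨.inl 4, rfl⟩
  | p => exact ⟨.inl 5, rfl⟩
  | num => exact ⟨.inl 6, rfl⟩
  | tmp => exact ⟨.inl 7, rfl⟩
  | mark => exact ⟨.inl 8, rfl⟩
  | sign => exact ⟨.inl 9, rfl⟩
  | halted => exact ⟨.inl 10, rfl⟩
  | found => exact ⟨.inl 11, rfl⟩
  | clk b => exact ⟨.inr (.inl b), rfl⟩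
  | sim b j => exact ⟨.inr (.inr (b, j)), rfl⟩

variable (U : MultitapeTM)

/-- The symbol that stops the clock: the clock `true` is unary, the clock `false` never stops. -/
def clkStop (b : Bool) : Option Bool := if b then none else some true

/-- The action of one simulated step of `U`. The head of the tape `mark` moves with the output head
of `U`, and `sign` remembers on which side of the mark that head is. -/
noncomputable def simAct (b : Bool) (σ : WTape U → Option Bool)
    (a : U.Tape → Option Bool × HeadMove) : WTape U → Option Bool × HeadMove
  | .sim b' j => if b' = b then a j else (σ (.sim b' j), .stay)
  | .clk b' => (σ (.clk b'), if b' = b then .right else .stay)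
  | .mark => (σ .mark, (a U.out).2)
  | .sign => (if σ .mark = some true then
      match (a U.out).2 with
      | .right => some true
      | .left => some false
      | .stay => σ .sign
    else σ .sign, .stay)
  | i => (σ i, .stay)

open Classical in
/-- Simulation of `U` until it halts, gets stuck or is stopped by the clock. -/
noncomputable def simBlock (b : Bool) : Block (WTape U) where
  State := U.State
  finite_state := U.finite_state
  entry := U.start
  next := fun q σ =>
    if q = U.halt then (fun i => (if i = .halted then some true else σ i, .stay), none)
    else if σ (.clk b) = clkStop b then (fun i => (σ i, .stay), none)
    else match U.trans q fun j => σ (.sim b j) with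
      | none => (fun i => (σ i, .stay), none)
      | some (q', a) => (U.simAct b σ a, some q')

variable {U}

/-- The simulating tapes `t` represent the configuration `c`. -/
structure Represents (b : Bool) (c : U.Cfg) (t : WTape U → ℤ → Option Bool) : Prop where
  sim : ∀ j, t (.sim b j) = shiftTape (c.head j) (c.cells j)
  mark : t .mark = shiftTape (c.head U.out) (strTape [] [true])
  pos : 0 < c.head U.out → t .sign 0 = some true
  neg : c.head U.out < 0 → t .sign 0 = some false

theorem strTape_singleton_apply (z : ℤ) :
    strTape [] [true] z = if z = 0 then some true else none := by
  rcases z with n | n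
  · rw [Int.ofNat_eq_natCast, strTape_natCast]
    cases n with
    | zero => simp
    | succ n => rw [if_neg (by omega)]; simp
  · rw [strTape_negSucc, if_neg (by omega)]; simp

theorem step_eq_none_of_halt {c : U.Cfg} (h : c.state = U.halt) : U.step c = none := by
  simp [step, h]

theorem step_eq_none_of_trans {c : U.Cfg}
    (h : U.trans c.state (fun i => c.cells i (c.head i)) = none) : U.step c = none := by
  simp [step, h]

theorem step_eq_some {c : U.Cfg} {q' : U.State} {a : U.Tape → Option Bool × HeadMove}
    (hc : c.state ≠ U.halt)
    (h : U.trans c.state (fun i => c.cells i (c.head i)) = some (q', a)) :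
    U.step c = some ⟨q', fun i => c.head i + (a i).2.shift,
      fun i => Function.update (c.cells i) (c.head i) (a i).1⟩ := by
  simp [step, h, hc]

theorem Represents.scan {b : Bool} {c : U.Cfg} {t : WTape U → ℤ → Option Bool}
    (h : Represents b c t) (j : U.Tape) : scan t (.sim b j) = c.cells j (c.head j) := by
  simp [_root_.scan, h.sim]

theorem update_shiftTape (d : ℤ) (f : ℤ → Option Bool) (a : Option Bool) :
    Function.update (shiftTape d f) 0 a = shiftTape d (Function.update f d a) := by
  funext z
  by_cases h : z = 0
  · subst h; simp
  · have : z + d ≠ d := by omega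
    simp [h, this]

/-- A head that moves by at most one cell can change sides only through the marked cell, so it is
enough to update `sign` when the mark is scanned. -/
theorem Represents.step {b : Bool} {c : U.Cfg} {t : WTape U → ℤ → Option Bool}
    (h : Represents b c t) (q' : U.State) (a : U.Tape → Option Bool × HeadMove) :
    Represents b ⟨q', fun i => c.head i + (a i).2.shift,
      fun i => Function.update (c.cells i) (c.head i) (a i).1⟩
      (applyAct (U.simAct b (_root_.scan t) a) t) where
  sim j := by
    simp [applyAct, simAct, h.sim, update_shiftTape, add_comm]
  mark := by
    simp only [applyAct, simAct, _root_.scan, Function.update_eq_self, h.mark, shiftTape_shiftTape]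
    rw [add_comm]
  pos hp := by
    have hm := h.mark
    simp only [applyAct, simAct, _root_.scan, h.mark, shiftTape_apply, zero_add,
      strTape_singleton_apply, HeadMove.shift, add_zero, Function.update_self]
    by_cases h0 : c.head U.out = 0
    · rw [if_pos (by simp [h0])]
      simp only [h0] at hp
      cases ha : (a U.out).2 <;> simp [ha, HeadMove.shift] at hp ⊢
    · rw [if_neg (by simp [h0])]
      refine h.pos ?_
      cases ha : (a U.out).2 <;> simp [ha, HeadMove.shift] at hp <;> omega
  neg hp := by
    have hm := h.mark
    simp only [applyAct, simAct, _root_.scan, h.mark, shiftTape_apply, zero_add,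
      strTape_singleton_apply, HeadMove.shift, add_zero, Function.update_self]
    by_cases h0 : c.head U.out = 0
    · rw [if_pos (by simp [h0])]
      simp only [h0] at hp
      cases ha : (a U.out).2 <;> simp [ha, HeadMove.shift] at hp ⊢
    · rw [if_neg (by simp [h0])]
      refine h.neg ?_
      cases ha : (a U.out).2 <;> simp [ha, HeadMove.shift] at hp <;> omega

/-- The tapes that the simulation leaves alone. -/
def Untouched (b : Bool) : WTape U → Prop
  | .sim b' _ => b' ≠ b
  | .clk b' => b' ≠ b
  | .mark => False
  | .sign => False
  | .halted => False
  | _ => True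

theorem applyAct_simAct_of_untouched {b : Bool} {i : WTape U} (hi : Untouched b i)
    (a : U.Tape → Option Bool × HeadMove) (t : WTape U → ℤ → Option Bool) :
    applyAct (U.simAct b (_root_.scan t) a) t i = t i := by
  cases i with
  | mark => exact hi.elim
  | sign => exact hi.elim
  | clk b' =>
    have : b' ≠ b := hi
    simp [applyAct, simAct, HeadMove.shift, _root_.scan, this]
  | sim b' j =>
    have : b' ≠ b := hi
    simp [applyAct, simAct, HeadMove.shift, _root_.scan, this]
  | _ => simp [applyAct, simAct, HeadMove.shift, _root_.scan]

theorem simBlock_halt {b : Bool} {q : U.State} (hq : q = U.halt) (t : WTape U → ℤ → Option Bool) :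
    (U.simBlock b).Exec q t 1 (Function.update t .halted
      (Function.update (t .halted) 0 (some true))) := by
  have := Block.Exec.exit (B := U.simBlock b) (s := q) (t := t)
    (a := fun i => (if i = .halted then some true else _root_.scan t i, .stay))
    (by simp [simBlock, hq])
  convert this using 1
  funext i
  by_cases h : i = .halted
  · subst h; simp [applyAct, HeadMove.shift]
  · simp [applyAct, HeadMove.shift, h, _root_.scan]

theorem simBlock_stop {b : Bool} {q : U.State} (t : WTape U → ℤ → Option Bool)
    (h : (U.simBlock b).next q (_root_.scan t) = (fun i => (_root_.scan t i, .stay), none)) :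
    (U.simBlock b).Exec q t 1 t := by
  have := Block.Exec.exit h
  rwa [Block.applyAct_stay] at this

-- One statement serves both clocks: after `n` steps either the clock stops or `U` has halted, hence
-- the disjunction `hn`. The last clause covers a stopped and a stuck simulation alike: if the state
-- reached is not halting, then no computation of at most `n` steps halts. The additional step in `k
-- + 1` is the one that leaves the block.
open Classical in
theorem simBlock_exec (b : Bool) (n : ℕ) (c : U.Cfg) (t : WTape U → ℤ → Option Bool)
    (hr : Represents b c t) (hclk : ∀ i : ℕ, i < n → t (.clk b) i ≠ clkStop b)
    (hn : t (.clk b) n = clkStop b ∨ ∃ c', U.stepN n c = some c' ∧ c'.state = U.halt) :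
    ∃ k ≤ n, ∃ c' t', U.stepN k c = some c' ∧ (U.simBlock b).Exec c.state t (k + 1) t' ∧
      Represents b c' t' ∧ t' (.clk b) = shiftTape k (t (.clk b)) ∧
      t' .halted = (if c'.state = U.halt then Function.update (t .halted) 0 (some true)
        else t .halted) ∧
      (∀ i, Untouched b i → t' i = t i) ∧
      (c'.state ≠ U.halt → ∀ m ≤ n, ∀ c'', U.stepN m c = some c'' → c''.state ≠ U.halt) := by
  induction n generalizing c t with
  | zero =>
    by_cases hc : c.state = U.halt
    · refine ⟨0, le_rfl, c, _, rfl, simBlock_halt hc t, ⟨?_, ?_, ?_, ?_⟩, ?_, ?_, ?_, ?_⟩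
      · simpa using hr.sim
      · simpa using hr.mark
      · simpa using hr.pos
      · simpa using hr.neg
      · simp
      · simp [hc]
      · intro i hi
        have : i ≠ .halted := by rintro rfl; exact hi
        simp [this]
      · exact fun h => absurd hc h
    · have hs : t (.clk b) 0 = clkStop b := by
        rcases hn with h | ⟨c', h, h'⟩
        · simpa using h
        · simp only [stepN, Option.some.injEq] at h
          exact absurd (h ▸ h') hc
      refine ⟨0, le_rfl, c, t, rfl, simBlock_stop t ?_, hr, by simp, by simp [hc], by simp, ?_⟩
      · simp [simBlock, hc, _root_.scan, hs]
      · intro _ m hm c'' h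
        obtain rfl : m = 0 := by omega
        simp only [stepN, Option.some.injEq] at h
        exact h ▸ hc
  | succ n ih =>
    by_cases hc : c.state = U.halt
    · refine ⟨0, Nat.zero_le _, c, _, rfl, simBlock_halt hc t, ⟨?_, ?_, ?_, ?_⟩, ?_, ?_, ?_, ?_⟩
      · simpa using hr.sim
      · simpa using hr.mark
      · simpa using hr.pos
      · simpa using hr.neg
      · simp
      · simp [hc]
      · intro i hi
        have : i ≠ .halted := by rintro rfl; exact hi
        simp [this]
      · exact fun h => absurd hc h
    · have hs : t (.clk b) 0 ≠ clkStop b := by simpa using hclk 0 (by omega)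
      have hscan : (fun j => _root_.scan t (.sim b j)) = fun j => c.cells j (c.head j) :=
        funext hr.scan
      cases htr : U.trans c.state (fun i => c.cells i (c.head i)) with
      | none =>
        refine ⟨0, Nat.zero_le _, c, t, rfl, simBlock_stop t ?_, hr, by simp, by simp [hc],
          by simp, ?_⟩
        · have : ¬ _root_.scan t (.clk b) = clkStop b := hs
          simp only [simBlock, hc, this, if_false]
          rw [hscan, htr]
        · intro _ m hm c'' h
          cases m with
          | zero =>
            simp only [stepN, Option.some.injEq] at h
            exact h ▸ hc
          | succ m => simp [stepN, step_eq_none_of_trans htr] at h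
      | some qa =>
        obtain ⟨q', a⟩ := qa
        have hstep := step_eq_some hc htr
        have hclk' : ∀ i : ℕ, applyAct (U.simAct b (_root_.scan t) a) t (.clk b) i =
            t (.clk b) (i + 1 : ℕ) := by
          intro i
          simp [applyAct, simAct, HeadMove.shift, _root_.scan]
        obtain ⟨k, hk, c', t', h1, h2, h3, h4, h5, h6, h7⟩ := ih _ _ (hr.step q' a)
          (fun i hi => by rw [hclk']; exact hclk _ (by omega))
          (by
            rw [hclk']
            refine hn.imp id ?_
            rintro ⟨c', h, h'⟩
            rw [stepN, hstep] at h
            exact ⟨c', h, h'⟩)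
        refine ⟨k + 1, by omega, c', t', ?_, .step ?_ h2, h3, ?_, ?_, ?_, ?_⟩
        · rw [stepN, hstep]; exact h1
        · have : ¬ _root_.scan t (.clk b) = clkStop b := hs
          simp only [simBlock, hc, this, if_false]
          rw [hscan, htr]
        · rw [h4]
          simp [applyAct, simAct, HeadMove.shift, _root_.scan]
        · rw [h5]
          simp [applyAct, simAct, HeadMove.shift, _root_.scan]
        · intro i hi
          rw [h6 i hi, applyAct_simAct_of_untouched hi]
        · intro hc' m hm c'' h
          cases m with
          | zero =>
            simp only [stepN, Option.some.injEq] at h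
            exact h ▸ hc
          | succ m =>
            rw [stepN, hstep] at h
            exact h7 hc' m (by omega) c'' h

/-- Bring the simulated output head back to the cell `0`. -/
noncomputable def home (b : Bool) : Block (WTape U) :=
  .cond (fun σ => σ .sign = some true)
    (.loop (fun σ => σ .mark ≠ some true) (.seq (.go (.sim b U.out) .left) (.go .mark .left)))
    (.loop (fun σ => σ .mark ≠ some true) (.seq (.go (.sim b U.out) .right) (.go .mark .right)))

open Block in
theorem runsIn_home_left (b : Bool) (h : ℕ) (t : WTape U → ℤ → Option Bool)
    (hm : t .mark = shiftTape h (strTape [] [true])) :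
    (loop (fun σ => σ .mark ≠ some true) (go (WTape.sim b U.out) .left ;; go .mark .left)).RunsIn
      (3 * h + 1) t (Function.update (Function.update t (.sim b U.out)
        (shiftTape (-h) (t (.sim b U.out)))) .mark (strTape [] [true])) := by
  induction h generalizing t with
  | zero =>
    refine (RunsIn.loop_done ?_).congr (by simp) ?_
    · simp [scan, hm]
    · simp at hm
      simp [← hm]
  | succ h ih =>
    refine (RunsIn.loop_step ?_ ((runsIn_goLeft _ t).seq (runsIn_goLeft _ _)) (ih _ ?_)).congr ?_ ?_
    · have : (h : ℤ) + 1 ≠ 0 := by omega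
      simp [scan, hm, strTape_singleton_apply, this]
    · simp [hm]
    · omega
    · funext i
      by_cases h1 : i = .mark
      · subst h1; simp
      · by_cases h2 : i = .sim b U.out
        · subst h2; simp [add_comm]
        · simp [h1, h2]

open Block in
theorem runsIn_home_right (b : Bool) (h : ℕ) (t : WTape U → ℤ → Option Bool)
    (hm : t .mark = shiftTape (-h) (strTape [] [true])) :
    (loop (fun σ => σ .mark ≠ some true) (go (WTape.sim b U.out) .right ;; go .mark .right)).RunsIn
      (3 * h + 1) t (Function.update (Function.update t (.sim b U.out)
        (shiftTape h (t (.sim b U.out)))) .mark (strTape [] [true])) := by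
  induction h generalizing t with
  | zero =>
    refine (RunsIn.loop_done ?_).congr (by simp) ?_
    · simp [scan, hm]
    · simp at hm
      simp [← hm]
  | succ h ih =>
    refine (RunsIn.loop_step ?_ ((runsIn_goRight _ t).seq (runsIn_goRight _ _))
      (ih _ ?_)).congr ?_ ?_
    · have : -1 + -(h : ℤ) ≠ 0 := by omega
      simp [scan, hm, strTape_singleton_apply, this]
    · simp [hm]
    · omega
    · funext i
      by_cases h1 : i = .mark
      · subst h1; simp
      · by_cases h2 : i = .sim b U.out
        · subst h2; simp
        · simp [h1, h2]

/-- If `sign` shows `true`, the head is not to the left of the mark, and otherwise it is not to the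
right. On the mark itself `sign` may hold anything, as both loops stop at once. -/
theorem runsIn_home {b : Bool} {c : U.Cfg} {t : WTape U → ℤ → Option Bool}
    (hr : Represents b c t) (k : ℕ) (hk : |c.head U.out| ≤ k) :
    (home b).RunsIn (3 * k + 2) t (Function.update (Function.update t (.sim b U.out)
        (c.cells U.out)) .mark (strTape [] [true])) := by
  have hO := hr.sim U.out
  by_cases hs : _root_.scan t .sign = some true
  · have h0 : 0 ≤ c.head U.out := by
      by_contra h
      have := hr.neg (by omega)
      rw [_root_.scan, this] at hs
      simp at hs
    obtain ⟨h, hh⟩ := Int.eq_ofNat_of_zero_le h0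
    have := hr.mark
    rw [hh] at this hO hk
    refine (Block.RunsIn.cond_pos hs (runsIn_home_left b h t this)).congr ?_ ?_
    · simp at hk; omega
    · simp [hO]
  · have h0 : c.head U.out ≤ 0 := by
      by_contra h
      exact hs (hr.pos (by omega))
    obtain ⟨h, hh⟩ := Int.eq_ofNat_of_zero_le (a := -c.head U.out) (by omega)
    have hh' : c.head U.out = -h := by omega
    have := hr.mark
    rw [hh'] at this hO hk
    refine (Block.RunsIn.cond_neg hs (runsIn_home_right b h t this)).congr ?_ ?_
    · simp at hk; omega
    · simp [hO]

end MultitapeTM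

/-! ### Enumeration of the binary strings -/

/-- The position of a string in the enumeration given by `succStr`. -/
def strIndex : List Bool → ℕ
  | [] => 0
  | b :: w => 2 * strIndex w + 1 + b.toNat

theorem strIndex_succStr (w : List Bool) : strIndex (succStr w) = strIndex w + 1 := by
  induction w with
  | nil => rfl
  | cons b w ih => cases b <;> simp [succStr, strIndex, ih]; omega

/-- `strIndex` evaluates a string in base two with the digits 1 and 2, least significant digit
first. The parity of the value determines the first bit. -/
theorem strIndex_injective : Function.Injective strIndex := by
  intro v
  induction v with
  | nil =>
    intro w h
    cases w with
    | nil => rfl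
    | cons b w => simp only [strIndex] at h; omega
  | cons a v ih =>
    intro w h
    cases w with
    | nil => simp [strIndex] at h
    | cons b w =>
      simp only [strIndex] at h
      have h1 : a = b := by cases a <;> cases b <;> simp at h ⊢ <;> omega
      subst h1
      rw [ih (a₂ := w) (by omega)]

theorem strIndex_iterate (n : ℕ) : strIndex (succStr^[n] []) = n := by
  induction n with
  | zero => rfl
  | succ n ih => rw [Function.iterate_succ_apply', strIndex_succStr, ih]

/-- Injectivity turns `strIndex_iterate` into surjectivity of the enumeration: no candidate program
is missed. -/
theorem iterate_strIndex (w : List Bool) : succStr^[strIndex w] [] = w :=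
  strIndex_injective (strIndex_iterate _)

/-- There are `2 ^ (n + 1) - 1` strings of length at most `n`. For `w` shorter than `x` this limits
the search to `2 ^ x.length` attempts. -/
theorem strIndex_lt (w : List Bool) : strIndex w + 1 < 2 ^ (w.length + 1) := by
  induction w with
  | nil => simp [strIndex]
  | cons b w ih =>
    have : b.toNat ≤ 1 := Bool.toNat_le b
    rw [List.length_cons, pow_succ]
    simp only [strIndex]
    omega

theorem length_le_succStr (w : List Bool) : w.length ≤ (succStr w).length := by
  induction w with
  | nil => simp
  | cons b w ih => cases b <;> simp [succStr, ih]

/-- This is why the first program found is no longer than any other one that would have been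
accepted. -/
theorem length_iterate_succStr_mono (w : List Bool) :
    Monotone fun n => (succStr^[n] w).length :=
  monotone_nat_of_le_succ fun n => by
    rw [Function.iterate_succ_apply']; exact length_le_succStr _

/-! ### Numbers as strings -/

theorem hornerValue_append (k : ℕ) (v w : List Bool) :
    hornerValue k (v ++ w) = hornerValue (hornerValue k v) w := by
  simp [hornerValue]

theorem hornerValue_bits (n : ℕ) : hornerValue 0 n.bits.reverse = n := by
  induction n using Nat.binaryRec' with
  | zero => simp [hornerValue]
  | bit b n h ih =>
    rw [Nat.bits_append_bit n b h, List.reverse_cons, hornerValue_append, ih]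
    simp [hornerValue, Nat.bit_val]

/-- Starting the evaluation at 1 restores the leading binary digit that `natString` drops. The value
is therefore `n + 1`, one mark more than the number meant. -/
theorem hornerValue_natString (n : ℕ) : hornerValue 1 (natString n) = n + 1 := by
  have h := hornerValue_bits (n + 1)
  unfold natString
  have hl : ∀ m : ℕ, m ≠ 0 → m.bits.reverse.head? = some true := by
    intro m
    induction m using Nat.binaryRec' with
    | zero => simp
    | bit b m hb ih =>
      intro _
      rw [Nat.bits_append_bit m b hb, List.reverse_cons]
      by_cases hm : m = 0
      · subst hm; simp [hb rfl]
      · rw [List.head?_append, ih hm]; rfl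
  have h2 := hl (n + 1) (by omega)
  cases hr : (n + 1).bits.reverse with
  | nil => rw [hr] at h2; simp at h2
  | cons a v =>
    rw [hr] at h h2
    simp at h2
    subst h2
    simpa using h

theorem length_natString (n : ℕ) : (natString n).length = Nat.log 2 (n + 1) := by
  unfold natString
  rw [List.length_tail, List.length_reverse, Nat.size_eq_bits_len]
  have h1 : Nat.log 2 (n + 1) < Nat.size (n + 1) := by
    rw [Nat.lt_size]; exact Nat.pow_log_le_self 2 (by omega)
  have h2 : Nat.size (n + 1) ≤ Nat.log 2 (n + 1) + 1 := by
    rw [Nat.size_le]; exact Nat.lt_pow_succ_log_self (by norm_num) _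
  omega

theorem length_natString_le_log (n : ℕ) : (natString n).length ≤ Nat.log 2 n + 1 := by
  rw [length_natString]
  by_cases hn : n = 0
  · subst hn; simp
  · have h1 := Nat.lt_pow_succ_log_self (b := 2) (by norm_num) n
    have : Nat.log 2 (n + 1) < Nat.log 2 n + 1 + 1 := by
      apply Nat.log_lt_of_lt_pow (by omega)
      rw [pow_succ]; omega
    omega

theorem length_natString_le (n : ℕ) : (natString n).length ≤ n := by
  rw [length_natString]
  have := Nat.log_lt_self 2 (x := n + 1) (by omega)
  omega

namespace MultitapeTM

variable {U : MultitapeTM}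

/-! ### What a computation of bounded length can touch -/

/-- A step moves each head by at most one cell and writes only under it. The slack `m` in the
starting configuration grows by one per step and makes the induction work. -/
theorem stepN_bounds {n : ℕ} {c c' : U.Cfg} (m L : ℕ) (i : U.Tape)
    (hh : |c.head i| ≤ m) (hs : SuppIn (c.cells i) (-m) (L + m)) (h : U.stepN n c = some c') :
    |c'.head i| ≤ m + n ∧ SuppIn (c'.cells i) (-(m + n)) (L + m + n) := by
  induction n generalizing c m with
  | zero =>
    simp only [stepN, Option.some.injEq] at h
    subst h
    simpa using ⟨hh, hs⟩
  | succ n ih =>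
    by_cases hc : c.state = U.halt
    · simp [stepN, step_eq_none_of_halt hc] at h
    · cases htr : U.trans c.state (fun i => c.cells i (c.head i)) with
      | none => simp [stepN, step_eq_none_of_trans htr] at h
      | some qa =>
        rw [stepN, step_eq_some hc htr] at h
        have hm : |(qa.2 i).2.shift| ≤ 1 := by cases (qa.2 i).2 <;> simp [HeadMove.shift]
        rw [abs_le] at hh hm
        have := ih (m + 1) ?_ ?_ h
        · push_cast at this
          refine ⟨this.1.trans (by omega), this.2.mono (by omega) (by omega)⟩
        · rw [abs_le]; push_cast; omega
        · exact (hs.update _ (by omega) (by omega)).mono (by push_cast; omega) (by push_cast; omega)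

theorem stepN_init_bounds {n : ℕ} {u : List Bool} {c : U.Cfg}
    (h : U.stepN n (U.init u) = some c) (i : U.Tape) :
    |c.head i| ≤ n ∧ SuppIn (c.cells i) (-n) (u.length + n) := by
  have := stepN_bounds 0 u.length i (by simp [init]) ?_ h
  · simpa using this
  · simp only [init]
    split_ifs
    · simpa using suppIn_tapeOf u
    · exact (suppIn_tapeOf []).mono (by simp) (by simp)

/-- The input head cannot scan a cell at or beyond `b` during these steps. Such cells may still
differ at the end, so only the state and the output tape are compared. -/
theorem stepN_agree {n : ℕ} {b : ℤ} {c c' d : U.Cfg} (hd : U.stepN n c = some d)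
    (hst : c'.state = c.state) (hhd : c'.head = c.head)
    (hcells : ∀ i, i ≠ U.inp → c'.cells i = c.cells i)
    (hin : ∀ z < b, c'.cells U.inp z = c.cells U.inp z) (hb : c.head U.inp + n ≤ b) :
    ∃ d', U.stepN n c' = some d' ∧ d'.state = d.state ∧ d'.cells U.out = d.cells U.out := by
  induction n generalizing c c' with
  | zero =>
    simp only [stepN, Option.some.injEq] at hd
    subst hd
    exact ⟨c', rfl, hst, hcells _ U.inp_ne_out.symm⟩
  | succ n ih =>
    have hscan : (fun i => c'.cells i (c'.head i)) = fun i => c.cells i (c.head i) := by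
      funext i
      rw [hhd]
      by_cases hi : i = U.inp
      · subst hi; exact hin _ (by push_cast at hb; omega)
      · rw [hcells i hi]
    by_cases hc : c.state = U.halt
    · simp [stepN, step_eq_none_of_halt hc] at hd
    · cases htr : U.trans c.state (fun i => c.cells i (c.head i)) with
      | none => simp [stepN, step_eq_none_of_trans htr] at hd
      | some qa =>
        rw [stepN, step_eq_some hc htr] at hd
        have htr' : U.trans c'.state (fun i => c'.cells i (c'.head i)) = some (qa.1, qa.2) := by
          rw [hscan, hst, htr]
        rw [stepN, step_eq_some (hst ▸ hc) htr']
        have hm : (qa.2 U.inp).2.shift ≤ 1 := by cases (qa.2 U.inp).2 <;> simp [HeadMove.shift]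
        refine ih hd rfl ?_ ?_ ?_ ?_
        · simp [hhd]
        · intro i hi; simp [hcells i hi, hhd]
        · intro z hz
          simp only [hhd]
          by_cases hz' : z = c.head U.inp
          · subst hz'; simp
          · simp [hz', hin z hz]
        · push_cast at hb; simp only; omega

/-- Each bit of the program takes two cells of the code, so truncating the program to `s` bits
leaves the first `s` cells alone, and no others are scanned in `s` steps. -/
theorem OutputsWithin.take {s : ℕ} {r x y : List Bool}
    (h : U.OutputsWithin s (pairCode r x) y) : U.OutputsWithin s (pairCode (r.take s) x) y := by
  obtain ⟨n, hn, c, hc, hst, hout⟩ := h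
  have hin : ∀ z < (s : ℤ), (U.init (pairCode (r.take s) x)).cells U.inp z =
      (U.init (pairCode r x)).cells U.inp z := by
    intro z hz
    simp only [init, if_true, tapeOf]
    split_ifs with hz0
    · have key : ∀ (r : List Bool) (s k : ℕ), k < s →
          (pairCode (r.take s) x)[k]? = (pairCode r x)[k]? := by
        intro r
        induction r with
        | nil => simp
        | cons a r ih =>
          intro s k hk
          cases s with
          | zero => omega
          | succ s =>
            rw [List.take_succ_cons, pairCode_cons, pairCode_cons]
            match k with
            | 0 => rfl
            | 1 => rfl
            | k + 2 => simpa using ih s k (by omega)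
      exact key r s z.toNat (by omega)
    · rfl
  obtain ⟨d, h1, h2, h3⟩ := stepN_agree (c' := U.init (pairCode (r.take s) x)) hc rfl rfl
    (fun i hi => by simp [init, hi]) hin (by simp [init]; omega)
  exact ⟨n, hn, d, h1, h2.trans hst, h3.trans hout⟩

/-! ### The search for a program -/

/-- The machine is deterministic and no step leaves the halting state. -/
theorem stepN_halt_unique {n m : ℕ} {c d e : U.Cfg} (hd : U.stepN n c = some d)
    (he : U.stepN m c = some e) (hd' : d.state = U.halt) (he' : e.state = U.halt) : d = e := by
  induction n generalizing c m with
  | zero =>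
    simp only [stepN, Option.some.injEq] at hd
    subst hd
    cases m with
    | zero => simpa [stepN] using he
    | succ m => simp [stepN, step_eq_none_of_halt hd'] at he
  | succ n ih =>
    cases m with
    | zero =>
      simp only [stepN, Option.some.injEq] at he
      subst he
      simp [stepN, step_eq_none_of_halt he'] at hd
    | succ m =>
      cases hs : U.step c with
      | none => simp [stepN, hs] at hd
      | some c1 =>
        rw [stepN, hs] at hd he
        exact ih hd he

variable (U) in
/-- `U` halts on the pair of `w` and the empty string within `T` steps, and `x` can be read on its
output tape from the cell `0` on. -/
def Finds (T : ℕ) (x w : List Bool) : Prop :=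
  ∃ n ≤ T, ∃ c : U.Cfg, U.stepN n (U.init (pairCode w [])) = some c ∧ c.state = U.halt ∧
    Reads (c.cells U.out) x

theorem represents_init {b : Bool} {u : List Bool} {t : WTape U → ℤ → Option Bool}
    (hinp : t (.sim b U.inp) = strTape [] u)
    (hsim : ∀ j, j ≠ U.inp → t (.sim b j) = strTape [] [])
    (hm : t .mark = strTape [] [true]) : Represents b (U.init u) t where
  sim j := by
    by_cases hj : j = U.inp
    · subst hj; simp [init, hinp, strTape_nil_left]
    · simp [init, hj, hsim j hj, strTape_nil_left]
  mark := by simp [init, hm]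
  pos h := by simp [init] at h
  neg h := by simp [init] at h

end MultitapeTM

theorem shiftTape_strTape_append (l q r : List Bool) :
    shiftTape q.length (strTape l (q ++ r)) = strTape (q.reverse ++ l) r := by
  induction q generalizing l with
  | nil => simp
  | cons a q ih =>
    have := ih (a :: l)
    rw [← shiftTape_right, shiftTape_shiftTape] at this
    simpa using this

namespace MultitapeTM

variable {U : MultitapeTM}

open Block

/-- Try the program on the tape `p`. -/
noncomputable def tryProgram (U : MultitapeTM) : Block (WTape U) :=
  pairOut .p (.sim true U.inp) ;; rewind (.sim true U.inp) ;; rewind .p ;;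
    U.simBlock true ;; rewind (.clk true) ;; home true ;;
    cond (fun σ => σ .halted = some true) (compare (.sim true U.out) .x .found) skip ;;
    put .halted (fun _ => none) ;;
    clear (fun i => ∃ j, i = .sim true j) (.clk true) ;;
    cond (fun σ => σ .found = some true) skip (incr .p)

/-- The state of the tapes between two attempts, where `w` is the next program to try. -/
structure SearchState (T : ℕ) (x w : List Bool) (t : WTape U → ℤ → Option Bool) : Prop where
  p : t .p = strTape [] w
  sim : ∀ j, t (.sim true j) = strTape [] []
  mark : t .mark = strTape [] [true]
  x : t .x = strTape [] x
  clk : t (.clk true) = strTape [] (List.replicate T true)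
  halted : t .halted = strTape [] []
  found : t .found = strTape [] []

-- An attempt restores all tapes except `p`, `found` and `sign`, so a failed one leads to the next
-- `SearchState`. A stale `sign` does no harm, since `Represents` does not constrain it while the
-- output head is at 0. The time is linear in `T` because the simulation is clocked and `w` and `x`
-- have length at most `T`.
set_option maxHeartbeats 400000 in
open Classical in
theorem runsIn_tryProgram {T : ℕ} {x w : List Bool} {t : WTape U → ℤ → Option Bool}
    (h : SearchState T x w t) (hw : w.length < T) (hx : x.length ≤ T) :
    ∃ t', (tryProgram U).RunsIn (100 * T + 100) t t' ∧
      t' .p = strTape [] (if U.Finds T x w then w else succStr w) ∧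
      t' .found = strTape [] (if U.Finds T x w then [true] else []) ∧
      ∀ i, i ≠ .p → i ≠ .found → i ≠ .sign → t' i = t i := by
  have s1 := runsIn_pairOut (A := WTape.p) (B := .sim true U.inp) (by simp) w [] t
    (by rw [h.p]; exact reads_strTape _ _) (h.sim _)
  generalize ht1 : Function.update (Function.update t WTape.p (shiftTape w.length (t .p)))
    (.sim true U.inp) (strTape ((pairCode w []).reverse ++ []) []) = t1 at s1
  replace ht1 := ht1.symm
  have s2 := runsIn_rewind (.sim true U.inp) ((pairCode w []).reverse) [] t1 (by simp [ht1])
  generalize ht2 : Function.update t1 (.sim true U.inp)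
    (strTape [] ((pairCode w []).reverse.reverse ++ [])) = t2 at s2
  replace ht2 := ht2.symm
  have s3 := runsIn_rewind .p w.reverse [] t2 (by
    have := shiftTape_length [] w
    simp [ht2, ht1, h.p, this])
  have e3 : Function.update t2 .p (strTape [] (w.reverse.reverse ++ [])) =
      Function.update t (.sim true U.inp) (strTape [] (pairCode w [])) := by
    funext i
    by_cases h1 : i = .p
    · subst h1; simp [h.p]
    · by_cases h2 : i = .sim true U.inp
      · subst h2; simp [ht2]
      · simp [h1, h2, ht2, ht1]
  rw [e3] at s3
  generalize ht3 : Function.update t (.sim true U.inp) (strTape [] (pairCode w [])) = t3 at s3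
  replace ht3 := ht3.symm
  have hr3 : Represents true (U.init (pairCode w [])) t3 := by
    refine represents_init (by simp [ht3]) (fun j hj => ?_) (by simp [ht3, h.mark])
    simp [ht3, hj, h.sim]
  have hclk : ∀ i : ℕ, t3 (.clk true) i = if i < T then some true else none := by
    intro i
    simp only [ht3, ne_eq, reduceCtorEq, not_false_eq_true, Function.update_of_ne, h.clk,
      strTape_natCast, List.getElem?_replicate]
  obtain ⟨k, hk, c, t4, hc, s4, hr4, hclk4, hhalt4, hrest4, hno⟩ := simBlock_exec true T
    (U.init (pairCode w [])) t3 hr3 (fun i hi => by rw [hclk, if_pos hi]; simp [clkStop])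
    (Or.inl (by rw [hclk]; simp [clkStop]))
  have s4' : (U.simBlock true).RunsIn (k + 1) t3 t4 := ⟨k + 1, le_rfl, s4⟩
  have hclk4' : t4 (.clk true) =
      strTape (List.replicate k true) (List.replicate (T - k) true) := by
    have := shiftTape_strTape_append [] (List.replicate k true) (List.replicate (T - k) true)
    rw [hclk4]
    simp only [ht3, ne_eq, reduceCtorEq, not_false_eq_true, Function.update_of_ne, h.clk]
    rw [List.replicate_append_replicate, Nat.add_sub_cancel' hk] at this
    simpa using this
  have s5 := runsIn_rewind (.clk true) _ _ t4 hclk4'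
  rw [List.reverse_replicate, List.replicate_append_replicate, Nat.add_sub_cancel' hk] at s5
  generalize ht5 : Function.update t4 (.clk true) (strTape [] (List.replicate T true)) = t5 at s5
  replace ht5 := ht5.symm
  have hr5 : Represents true c t5 := by
    refine ⟨fun j => ?_, ?_, ?_, ?_⟩
    · simp [ht5, hr4.sim]
    · simp [ht5, hr4.mark]
    · simpa [ht5] using hr4.pos
    · simpa [ht5] using hr4.neg
  have hb := fun i => stepN_init_bounds hc i
  have s6 := runsIn_home hr5 k (hb _).1
  generalize ht6 : Function.update (Function.update t5 (.sim true U.out)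
        (c.cells U.out)) .mark (strTape [] [true]) = t6 at s6
  replace ht6 := ht6.symm
  have hx6 : t6 .x = strTape [] x := by
    simp [ht6, ht5, hrest4 .x trivial, ht3, h.x]
  have hf6 : t6 .found = strTape [] [] := by
    simp [ht6, ht5, hrest4 .found trivial, ht3, h.found]
  have hh6 : t6 .halted = strTape [] (if c.state = U.halt then [true] else []) := by
    simp only [ht6, ne_eq, reduceCtorEq, not_false_eq_true, Function.update_of_ne, ht5, hhalt4,
      ht3, h.halted]
    split_ifs <;> simp
  -- The simulated configuration decides the question: it is the unique halting configuration if one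
  -- is reached within `T` steps.
  have hfinds : U.Finds T x w ↔ c.state = U.halt ∧ Reads (c.cells U.out) x := by
    constructor
    · rintro ⟨n, hn, c', hc', hst, hre⟩
      by_cases hcs : c.state = U.halt
      · rw [stepN_halt_unique hc hc' hcs hst]
        exact ⟨hst, hre⟩
      · exact absurd hst (hno hcs n hn c' hc')
    · rintro ⟨h1, h2⟩
      exact ⟨k, hk, c, hc, h1, h2⟩
  obtain ⟨j, hj, s7⟩ : ∃ j : ℕ, j ≤ x.length ∧
      (cond (fun σ => σ .halted = some true) (compare (.sim true U.out) .x .found) skip).RunsIn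
        (5 * x.length + 9) t6
      (Function.update (Function.update t6 (.sim true U.out)
        (shiftTape j (t6 (.sim true U.out)))) .found
        (strTape [] (if U.Finds T x w then [true] else []))) := by
    by_cases hcs : c.state = U.halt
    · obtain ⟨j, hj, s⟩ := runsIn_compare (A := .sim true U.out) (X := .x) (F := .found)
        (by simp) (by simp) (by simp) x t6 hx6 hf6
      refine ⟨j, hj, (RunsIn.cond_pos ?_ s).congr (by omega) ?_⟩
      · simp [scan, hh6, hcs]
      · have : Reads (t6 (.sim true U.out)) x ↔ U.Finds T x w := by
          rw [hfinds]; simp [ht6, hcs]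
        simp [this]
    · refine ⟨0, by simp, (RunsIn.cond_neg ?_ (runsIn_skip _)).congr (by omega) ?_⟩
      · simp [scan, hh6, hcs]
      · have : ¬ U.Finds T x w := fun h => hcs (hfinds.1 h).1
        simp [this, ← hf6]
  generalize ht7 : Function.update (Function.update t6 (.sim true U.out)
        (shiftTape j (t6 (.sim true U.out)))) .found
        (strTape [] (if U.Finds T x w then [true] else [])) = t7 at s7
  replace ht7 := ht7.symm
  have s8 := runsIn_put .halted (fun _ => none) t7
  have e8 : Function.update t7 .halted (Function.update (t7 .halted) 0 none) =
      Function.update t7 .halted (strTape [] []) := by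
    have e : t7 .halted = t6 .halted := by simp [ht7]
    have e' : Function.update (strTape [] []) 0 none = strTape [] [] := by
      rw [strTape_nil_nil]; funext z; simp
    rw [e, hh6]
    split_ifs
    · rw [update_strTape_singleton]
    · rw [e']
  rw [e8] at s8
  generalize ht8 : Function.update t7 .halted (strTape [] []) = t8 at s8
  replace ht8 := ht8.symm
  have hk8 : t8 (.clk true) = strTape [] (List.replicate T true) := by
    simp [ht8, ht7, ht6, ht5]
  -- The input has length at most 2T and every head is at most T away from its start, so the
  -- nonblank cells lie in [-2T, 4T] as seen from the head. On the output tape the displacement is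
  -- `j`, at most `x.length`, hence at most T.
  have s9 := runsIn_clear (C := .clk true) (S := fun i => ∃ j : U.Tape, i = .sim true j)
    (by simp) T (by omega) t8 hk8 (by
      rintro _ ⟨i, rfl⟩
      have hbi := hb i
      have hlen : ((pairCode w []).length : ℤ) = 2 * w.length + 1 := by
        rw [length_pairCode]; simp
      rw [hlen, abs_le] at hbi
      by_cases hi : i = U.out
      · subst hi
        have e : t8 (.sim true U.out) = shiftTape j (c.cells U.out) := by
          simp [ht8, ht7, ht6]
        rw [e]
        exact (hbi.2.shift j).mono (by omega) (by omega)
      · have e : t8 (.sim true i) = shiftTape (c.head i) (c.cells i) := by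
          simp [ht8, ht7, ht6, ht5, hi, hr4.sim]
        rw [e]
        exact (hbi.2.shift _).mono (by omega) (by omega))
  generalize ht9 : mapOn (fun i => ∃ j : U.Tape, i = .sim true j) (fun _ => strTape [] []) t8 = t9 at s9
  replace ht9 := ht9.symm
  have hp9 : t9 .p = strTape [] w := by
    simp [ht9, mapOn, ht8, ht7, ht6, ht5, hrest4 .p trivial, ht3, h.p]
  have hf9 : t9 .found = strTape [] (if U.Finds T x w then [true] else []) := by
    simp [ht9, mapOn, ht8, ht7]
  have s10 : (cond (fun σ => σ .found = some true) skip (incr .p)).RunsIn (5 * w.length + 6) t9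
      (Function.update t9 .p (strTape [] (if U.Finds T x w then w else succStr w))) := by
    by_cases hF : U.Finds T x w
    · refine (RunsIn.cond_pos ?_ (runsIn_skip _)).congr (n := 1 + 1) (by omega) ?_
      · simp [scan, hf9, hF]
      · simp [hF, ← hp9]
    · refine RunsIn.congr (n := 5 * w.length + 5 + 1)
        (RunsIn.cond_neg ?_ (runsIn_incr WTape.p w t9 hp9)) (by omega) ?_
      · simp [scan, hf9, hF]
      · simp [hF]
  refine ⟨_, (s1.seq (s2.seq (s3.seq (s4'.seq (s5.seq (s6.seq (s7.seq
    (s8.seq (s9.seq s10))))))))).mono ?_, by simp, by simp [hf9], ?_⟩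
  · rw [List.length_reverse, length_pairCode]
    simp
    omega
  · intro i h1 h2 h3
    cases i with
    | p => exact absurd rfl h1
    | found => exact absurd rfl h2
    | sign => exact absurd rfl h3
    | mark => simp [ht9, mapOn, ht8, ht7, ht6, h.mark]
    | halted => simp [ht9, mapOn, ht8, h.halted]
    | clk b =>
      cases b with
      | true => simp [ht9, mapOn, hk8, h.clk]
      | false =>
        have := hrest4 (.clk false) (by simp [Untouched])
        simp [ht9, mapOn, ht8, ht7, ht6, ht5, this, ht3]
    | sim b j =>
      cases b with
      | true => simp [ht9, mapOn, h.sim]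
      | false =>
        have := hrest4 (.sim false j) (by simp [Untouched])
        simp [ht9, mapOn, ht8, ht7, ht6, ht5, this, ht3]
    | inp => simp [ht9, mapOn, ht8, ht7, ht6, ht5, hrest4 .inp trivial, ht3]
    | out => simp [ht9, mapOn, ht8, ht7, ht6, ht5, hrest4 .out trivial, ht3]
    | x => simp [ht9, mapOn, ht8, ht7, ht6, ht5, hrest4 .x trivial, ht3]
    | nb => simp [ht9, mapOn, ht8, ht7, ht6, ht5, hrest4 .nb trivial, ht3]
    | r => simp [ht9, mapOn, ht8, ht7, ht6, ht5, hrest4 .r trivial, ht3]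
    | num => simp [ht9, mapOn, ht8, ht7, ht6, ht5, hrest4 .num trivial, ht3]
    | tmp => simp [ht9, mapOn, ht8, ht7, ht6, ht5, hrest4 .tmp trivial, ht3]

/-- Find the first program that outputs the string on the tape `x`. -/
noncomputable def search (U : MultitapeTM) : Block (WTape U) :=
  loop (fun σ => σ .found ≠ some true) (tryProgram U)

/-- Induction on the distance `n` to a string known to be accepted; the search may stop earlier, at
`k`. Lengths never decrease along the enumeration, so the bound on the last string holds for all
strings tried. -/
theorem runsIn_search {T : ℕ} {x : List Bool} (hx : x.length ≤ T) (n : ℕ) (w : List Bool)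
    (hn : U.Finds T x (succStr^[n] w)) (hlen : (succStr^[n] w).length < T)
    (t : WTape U → ℤ → Option Bool) (h : SearchState T x w t) :
    ∃ k ≤ n, ∃ t', (search U).RunsIn ((100 * T + 101) * (n + 1) + 1) t t' ∧
      U.Finds T x (succStr^[k] w) ∧ t' .p = strTape [] (succStr^[k] w) ∧
      ∀ i, i ≠ .p → i ≠ .found → i ≠ .sign → t' i = t i := by
  induction n generalizing w t with
  | zero =>
    obtain ⟨t', s, hp, hf, hrest⟩ := runsIn_tryProgram h hlen hx
    have hn' : U.Finds T x w := hn
    rw [if_pos hn'] at hp hf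
    refine ⟨0, le_rfl, t', (RunsIn.loop_step ?_ s (RunsIn.loop_done ?_)).mono (by omega), hn, hp,
      hrest⟩
    · simp [scan, h.found]
    · simp [scan, hf]
  | succ n ih =>
    have hw : w.length < T :=
      (length_iterate_succStr_mono w (Nat.zero_le (n + 1))).trans_lt hlen
    obtain ⟨t1, s, hp, hf, hrest⟩ := runsIn_tryProgram h hw hx
    by_cases hF : U.Finds T x w
    · rw [if_pos hF] at hp hf
      refine ⟨0, by omega, t1, (RunsIn.loop_step ?_ s (RunsIn.loop_done ?_)).mono ?_, hF, hp,
        hrest⟩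
      · simp [scan, h.found]
      · simp [scan, hf]
      · have : (100 * T + 101) * (n + 1 + 1) = (100 * T + 101) * (n + 1) + (100 * T + 101) := by
          ring
        omega
    · rw [if_neg hF] at hp hf
      obtain ⟨k, hk, t', s', hF', hp', hrest'⟩ := ih (succStr w) hn hlen t1 (by
        refine ⟨hp, fun j => ?_, ?_, ?_, ?_, ?_, hf⟩
        · rw [hrest _ (by simp) (by simp) (by simp), h.sim]
        · rw [hrest _ (by simp) (by simp) (by simp), h.mark]
        · rw [hrest _ (by simp) (by simp) (by simp), h.x]
        · rw [hrest _ (by simp) (by simp) (by simp), h.clk]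
        · rw [hrest _ (by simp) (by simp) (by simp), h.halted])
      refine ⟨k + 1, by omega, t', (RunsIn.loop_step ?_ s s').mono (le_of_eq (by ring)), hF', hp',
        fun i h1 h2 h3 => (hrest' i h1 h2 h3).trans (hrest i h1 h2 h3)⟩
      simp [scan, h.found]

end MultitapeTM

/-! ### Decoding the input, and the forward and backward computations -/

namespace MultitapeTM

variable {U : MultitapeTM}

open Block

/-- Read a self-delimiting string from the input tape: its length, in binary, goes to `nb`, the
string itself to `r`. -/
noncomputable def parse (U : MultitapeTM) : Block (WTape U) :=
  unpair .inp .nb ;; rewind .nb ;; horner .nb .num .tmp ;; rewind .nb ;;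
    put .num (fun _ => none) ;; go .num .right ;; copyCount .num .inp .r ;; rewind .r

theorem runsIn_parse (r q : List Bool) (t : WTape U → ℤ → Option Bool)
    (hinp : Reads (t .inp) (pairCode (natString r.length) (r ++ q)))
    (hnb : t .nb = strTape [] []) (hnum : t .num = strTape [] []) (htmp : t .tmp = strTape [] [])
    (hr : t .r = strTape [] []) :
    ∃ t', (parse U).RunsIn (100 * r.length + 100) t t' ∧ Reads (t' .inp) q ∧
      t' .nb = strTape [] (natString r.length) ∧ t' .r = strTape [] r ∧
      ∀ i, i ≠ .inp → i ≠ .nb → i ≠ .r → t' i = t i := by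
  have hlen := length_natString_le r.length
  have s1 := runsIn_unpair (A := WTape.inp) (B := .nb) (by simp) _ _ [] t hinp hnb
  generalize ht1 : Function.update _ WTape.nb _ = t1 at s1
  replace ht1 := ht1.symm
  have s2 := runsIn_rewind .nb (natString r.length).reverse [] t1 (by simp [ht1])
  generalize ht2 : Function.update _ WTape.nb _ = t2 at s2
  replace ht2 := ht2.symm
  have hnb2 : t2 .nb = strTape [] (natString r.length) := by simp [ht2]
  have s3 := runsIn_horner (A := .nb) (B := .num) (C := .tmp) (by simp) (by simp) (by simp)
    (natString r.length) t2 (hnb2 ▸ reads_strTape _ _) (by simp [ht2, ht1, hnum])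
    (by simp [ht2, ht1, htmp])
  rw [hornerValue_natString, hnb2, shiftTape_length] at s3
  generalize ht3 : Function.update _ WTape.num _ = t3 at s3
  replace ht3 := ht3.symm
  have s4 := runsIn_rewind .nb ((natString r.length).reverse ++ []) [] t3 (by simp [ht3])
  generalize ht4 : Function.update _ WTape.nb _ = t4 at s4
  replace ht4 := ht4.symm
  -- Horner's scheme has produced `r.length + 1` marks; blanking one and stepping over it leaves as
  -- many marks as `r` has bits.
  have s5 := runsIn_put .num (fun _ => none) t4
  generalize ht5 : Function.update _ WTape.num _ = t5 at s5
  replace ht5 := ht5.symm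
  have s6 := runsIn_goRight .num t5
  generalize ht6 : Function.update _ WTape.num _ = t6 at s6
  replace ht6 := ht6.symm
  have hinp6 : t6 .inp = shiftTape (2 * (natString r.length).length + 1) (t .inp) := by
    simp [ht6, ht5, ht4, ht3, ht2, ht1]
  have s7 := runsIn_copyCount (A := .inp) (B := .r) (C := .num) (by simp) (by simp) (by simp)
    r q [] t6 (by rw [hinp6]; exact hinp.pair_snd)
    (by simp [ht6, ht5, ht4, ht3, ht2, ht1, hr])
    (by
      simp only [ht6, ht5, ht4, ht3, Function.update_self, ne_eq, reduceCtorEq, not_false_eq_true,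
        Function.update_of_ne]
      rw [List.replicate_succ, erase_shiftTape_right])
  generalize ht7 : Function.update _ WTape.num _ = t7 at s7
  replace ht7 := ht7.symm
  have s8 := runsIn_rewind .r (r.reverse ++ []) [] t7 (by simp [ht7])
  refine ⟨_, (s1.seq (s2.seq (s3.seq (s4.seq (s5.seq (s6.seq (s7.seq s8))))))).mono ?_,
    ?_, ?_, ?_, ?_⟩
  · simp; omega
  · have : Reads (t6 .inp) (r ++ q) := by rw [hinp6]; exact hinp.pair_snd
    simpa [ht7] using this.drop
  · simp [ht7, ht6, ht5, ht4]
  · simp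
  · intro i h1 h2 h3
    by_cases h4 : i = .num
    · subst h4; simp [ht7, hnum]
    · simp [h1, h2, h3, h4, ht7, ht6, ht5, ht4, ht3, ht2, ht1]

/-- Run `U` until it halts. -/
noncomputable def runU (U : MultitapeTM) : Block (WTape U) :=
  U.simBlock false ;; home false ;; put .halted (fun _ => none)

/-- The clock `false` is stopped only by the symbol `true`, which a blank tape never shows; the
simulation ends because `U` halts. Walking the output head home takes about three steps per
simulated step. -/
theorem runsIn_runU {u : List Bool} {t : WTape U → ℤ → Option Bool}
    (hinp : t (.sim false U.inp) = strTape [] u)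
    (hsim : ∀ j, j ≠ U.inp → t (.sim false j) = strTape [] [])
    (hm : t .mark = strTape [] [true]) (hclk : t (.clk false) = strTape [] [])
    (hh : t .halted = strTape [] []) {n : ℕ} {c : U.Cfg}
    (hc : U.stepN n (U.init u) = some c) (hst : c.state = U.halt) :
    ∃ t', (runU U).RunsIn (4 * n + 4) t t' ∧ t' (.sim false U.out) = c.cells U.out ∧
      ∀ i, (∀ j, i ≠ .sim false j) → i ≠ .clk false → i ≠ .sign → t' i = t i := by
  obtain ⟨k, hk, c', t1, hc', s1, hr1, -, hh1, hrest, hno⟩ := simBlock_exec false n (U.init u) t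
    (represents_init hinp hsim hm) (by simp [hclk, clkStop, strTape_nil_nil])
    (Or.inr ⟨c, hc, hst⟩)
  have hst' : c'.state = U.halt := by
    by_contra h
    exact hno h n le_rfl c hc hst
  obtain rfl := stepN_halt_unique hc hc' hst hst'
  have s1' : (U.simBlock false).RunsIn (k + 1) t t1 := ⟨k + 1, le_rfl, s1⟩
  have s2 := runsIn_home hr1 k (stepN_init_bounds hc' _).1
  generalize ht2 : Function.update _ WTape.mark _ = t2 at s2
  replace ht2 := ht2.symm
  have s3 := runsIn_put WTape.halted (fun _ => none) t2
  refine ⟨_, (s1'.seq (s2.seq s3)).mono (by omega), by simp [ht2], ?_⟩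
  · intro i h1 h2 h3
    by_cases h4 : i = .mark
    · subst h4; simp [ht2, hm]
    · by_cases h5 : i = .halted
      · subst h5
        simp only [Function.update_self, ne_eq, reduceCtorEq, not_false_eq_true,
          Function.update_of_ne, ht2, hh1, hst', if_true, hh, update_strTape_nil,
          update_strTape_singleton]
      · have : Untouched false i := by
          cases i with
          | sim b j => exact fun h => h1 j (h ▸ rfl)
          | clk b => exact fun h => h2 (h ▸ rfl)
          | mark => exact h4 rfl
          | sign => exact h3 rfl
          | halted => exact h5 rfl
          | _ => trivial
        simp [ht2, h1, h4, h5, hrest i this]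

/-- The forward direction: from `x` on its tape and the self-delimiting program for the time bound
on the input tape, find a program for `x`. -/
noncomputable def forward (U : MultitapeTM) : Block (WTape U) :=
  parse U ;; pairOut .r (.sim false U.inp) ;; rewind .r ;; copy .x (.sim false U.inp) ;;
    rewind .x ;; rewind (.sim false U.inp) ;; runU U ;;
    horner (.sim false U.out) (.clk true) .tmp ;; search U ;;
    emit .out [false, true] ;; pairOut .nb .out ;; copy .r .out ;; copy .p .out ;; rewind .out

-- The output of `U` on `r` and `x` becomes the unary clock of the search, with `τ + 1` marks. The
-- string `w` is not given to the program: it only guarantees that the search ends, bounds its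
-- duration and bounds the length of its result.
set_option maxHeartbeats 400000 in
theorem runsIn_forward {x r w : List Bool} {s τ : ℕ} {t : WTape U → ℤ → Option Bool}
    (hinp : Reads (t .inp) (pairCode (natString r.length) r)) (hx : t .x = strTape [] x)
    (hm : t .mark = strTape [] [true])
    (ht : ∀ i, i ≠ .inp → i ≠ .x → i ≠ .mark → t i = strTape [] [])
    (hr : U.OutputsWithin s (pairCode r x) (natString τ)) (hτ : x.length ≤ τ)
    (hw : U.Finds (τ + 1) x w) (hwx : w.length < x.length) :
    ∃ w', U.Finds (τ + 1) x w' ∧ w'.length ≤ w.length ∧ ∃ t',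
      (forward U).RunsIn (400 * (r.length + s + 2 ^ x.length * (τ + 1) + 1)) t t' ∧
      t' .out = strTape [] (false :: true :: pairCode (natString r.length) (r ++ w')) := by
  obtain ⟨t1, s1, -, hnb1, hr1, hrest1⟩ := runsIn_parse r [] t (by simpa using hinp)
    (ht _ (by simp) (by simp) (by simp)) (ht _ (by simp) (by simp) (by simp))
    (ht _ (by simp) (by simp) (by simp)) (ht _ (by simp) (by simp) (by simp))
  have ht1 : ∀ i, i ≠ .inp → i ≠ .x → i ≠ .mark → i ≠ .nb → i ≠ .r → t1 i = strTape [] [] :=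
    fun i h1 h2 h3 h4 h5 => by rw [hrest1 i h1 h4 h5, ht i h1 h2 h3]
  have hx1 : t1 .x = strTape [] x := by rw [hrest1 _ (by simp) (by simp) (by simp), hx]
  have hm1 : t1 .mark = strTape [] [true] := by rw [hrest1 _ (by simp) (by simp) (by simp), hm]
  have s2 := runsIn_pairOut (A := .r) (B := .sim false U.inp) (by simp) r [] t1
    (hr1 ▸ reads_strTape _ _) (ht1 _ (by simp) (by simp) (by simp) (by simp) (by simp))
  rw [hr1, shiftTape_length] at s2
  generalize ht2 : Function.update _ (WTape.sim false U.inp) _ = t2 at s2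
  replace ht2 := ht2.symm
  have s3 := runsIn_rewind .r (r.reverse ++ []) [] t2 (by simp [ht2])
  generalize ht3 : Function.update _ WTape.r _ = t3 at s3
  replace ht3 := ht3.symm
  have hx3 : t3 .x = strTape [] x := by simp [ht3, ht2, hx1]
  have s4 := runsIn_copy (A := .x) (B := .sim false U.inp) (by simp) x
    ((pairCode r []).reverse ++ []) t3 (hx3 ▸ reads_strTape _ _) (by simp [ht3, ht2])
  rw [hx3, shiftTape_length] at s4
  generalize ht4 : Function.update _ (WTape.sim false U.inp) _ = t4 at s4
  replace ht4 := ht4.symm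
  have s5 := runsIn_rewind .x (x.reverse ++ []) [] t4 (by simp [ht4])
  generalize ht5 : Function.update _ WTape.x _ = t5 at s5
  replace ht5 := ht5.symm
  have s6 := runsIn_rewind (.sim false U.inp) (x.reverse ++ ((pairCode r []).reverse ++ [])) [] t5
    (by simp [ht5, ht4])
  have e6 : (x.reverse ++ ((pairCode r []).reverse ++ [])).reverse ++ [] = pairCode r x := by
    rw [pairCode_eq_append r x]; simp
  rw [e6] at s6
  generalize ht6 : Function.update _ (WTape.sim false U.inp) _ = t6 at s6
  replace ht6 := ht6.symm
  obtain ⟨n, hn, c, hc, hst, hout⟩ := hr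
  have hblank6 : ∀ i, i ≠ .inp → i ≠ .x → i ≠ .mark → i ≠ .nb → i ≠ .r →
      i ≠ .sim false U.inp → t6 i = strTape [] [] := by
    intro i h1 h2 h3 h4 h5 h6
    simp [ht6, ht5, ht4, ht3, ht2, ht1 i h1 h2 h3 h4 h5, h2, h5, h6]
  obtain ⟨t7, s7, ho7, hrest7⟩ := runsIn_runU (t := t6) (u := pairCode r x) (by simp [ht6])
    (fun j hj => hblank6 _ (by simp) (by simp) (by simp) (by simp) (by simp) (by simpa using hj))
    (by simp [ht6, ht5, ht4, ht3, ht2, hm1])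
    (hblank6 _ (by simp) (by simp) (by simp) (by simp) (by simp) (by simp))
    (hblank6 _ (by simp) (by simp) (by simp) (by simp) (by simp) (by simp)) hc hst
  have hblank7 : ∀ i, (∀ j, i ≠ .sim false j) → i ≠ .clk false → i ≠ .sign → i ≠ .inp → i ≠ .x →
      i ≠ .mark → i ≠ .nb → i ≠ .r → t7 i = strTape [] [] :=
    fun i h1 h2 h3 h4 h5 h6 h7 h8 => by
      rw [hrest7 i h1 h2 h3, hblank6 i h4 h5 h6 h7 h8 (h1 _)]
  have hx7 : t7 .x = strTape [] x := by
    rw [hrest7 .x (by simp) (by simp) (by simp)]; simp [ht6, ht5]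
  have hm7 : t7 .mark = strTape [] [true] := by
    rw [hrest7 .mark (by simp) (by simp) (by simp)]; simp [ht6, ht5, ht4, ht3, ht2, hm1]
  have hnb7 : t7 .nb = strTape [] (natString r.length) := by
    rw [hrest7 .nb (by simp) (by simp) (by simp)]; simp [ht6, ht5, ht4, ht3, ht2, hnb1]
  have hr7 : t7 .r = strTape [] r := by
    rw [hrest7 .r (by simp) (by simp) (by simp)]; simp [ht6, ht5, ht4, ht3]
  have s8 := runsIn_horner (A := .sim false U.out) (B := .clk true) (C := .tmp) (by simp)
    (by simp) (by simp) (natString τ) t7 (by rw [ho7, hout]; exact reads_tapeOf _)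
    (by apply hblank7 <;> simp) (by apply hblank7 <;> simp)
  rw [hornerValue_natString] at s8
  generalize ht8 : Function.update _ (WTape.clk true) _ = t8 at s8
  replace ht8 := ht8.symm
  have hb8 : ∀ i, (∀ j, i ≠ .sim false j) → i ≠ .clk false → i ≠ .sign → i ≠ .inp → i ≠ .x →
      i ≠ .mark → i ≠ .nb → i ≠ .r → i ≠ .clk true → t8 i = strTape [] [] := by
    intro i h1 h2 h3 h4 h5 h6 h7 h8 h9
    simp [ht8, h1, h9, hblank7 i h1 h2 h3 h4 h5 h6 h7 h8]
  have hS : SearchState (τ + 1) x [] t8 := by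
    refine ⟨?_, fun j => ?_, ?_, ?_, ?_, ?_, ?_⟩
    · apply hb8 <;> simp
    · apply hb8 <;> simp
    · simp [ht8, hm7]
    · simp [ht8, hx7]
    · simp [ht8]
    · apply hb8 <;> simp
    · apply hb8 <;> simp
  -- The enumeration starts at the empty string, so `w` is reached after `strIndex w` successors.
  obtain ⟨k, hk, t9, s9, hF, hp9, hrest9⟩ := runsIn_search (by omega) (strIndex w) []
    (by rwa [iterate_strIndex]) (by rw [iterate_strIndex]; omega) t8 hS
  have hlen := length_iterate_succStr_mono [] hk
  simp only [iterate_strIndex] at hlen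
  generalize succStr^[k] [] = w' at hF hp9 hlen
  have ho9 : t9 .out = strTape [] [] := by
    rw [hrest9 _ (by simp) (by simp) (by simp)]
    apply hb8 <;> simp
  have hnb9 : t9 .nb = strTape [] (natString r.length) := by
    rw [hrest9 _ (by simp) (by simp) (by simp)]; simp [ht8, hnb7]
  have hr9 : t9 .r = strTape [] r := by
    rw [hrest9 _ (by simp) (by simp) (by simp)]; simp [ht8, hr7]
  have s10 := runsIn_emit .out [false, true] [] t9 ho9
  generalize ht10 : Function.update _ WTape.out _ = t10 at s10
  replace ht10 := ht10.symm
  have s11 := runsIn_pairOut (A := .nb) (B := .out) (by simp) (natString r.length)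
    ([false, true].reverse ++ []) t10
    (by simp only [ht10, ne_eq, reduceCtorEq, not_false_eq_true, Function.update_of_ne, hnb9]
        exact reads_strTape _ _) (by simp [ht10])
  generalize ht11 : Function.update _ WTape.out _ = t11 at s11
  replace ht11 := ht11.symm
  have s12 := runsIn_copy (A := .r) (B := .out) (by simp) r
    ((pairCode (natString r.length) []).reverse ++ ([false, true].reverse ++ [])) t11
    (by simp only [ht11, ht10, ne_eq, reduceCtorEq, not_false_eq_true, Function.update_of_ne, hr9]
        exact reads_strTape _ _) (by simp [ht11])
  generalize ht12 : Function.update _ WTape.out _ = t12 at s12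
  replace ht12 := ht12.symm
  have s13 := runsIn_copy (A := .p) (B := .out) (by simp) w'
    (r.reverse ++ ((pairCode (natString r.length) []).reverse ++ ([false, true].reverse ++ []))) t12
    (by simp only [ht12, ht11, ht10, ne_eq, reduceCtorEq, not_false_eq_true,
          Function.update_of_ne, hp9]
        exact reads_strTape _ _) (by simp [ht12])
  generalize ht13 : Function.update _ WTape.out _ = t13 at s13
  replace ht13 := ht13.symm
  have s14 := runsIn_rewind .out (w'.reverse ++ (r.reverse ++
    ((pairCode (natString r.length) []).reverse ++ ([false, true].reverse ++ [])))) [] t13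
    (by simp [ht13])
  refine ⟨w', hF, hlen, _, (s1.seq (s2.seq (s3.seq (s4.seq (s5.seq (s6.seq (s7.seq (s8.seq
    (s9.seq (s10.seq (s11.seq (s12.seq (s13.seq s14))))))))))))).mono ?_, ?_⟩
  · have hl := length_natString_le r.length
    -- Here `w.length < x.length` turns the number of attempts into the factor `2 ^ x.length`.
    have h2 : (100 * (τ + 1) + 101) * (strIndex w + 1) ≤
        (100 * (τ + 1) + 101) * 2 ^ x.length := by
      refine Nat.mul_le_mul_left _ ?_
      have := strIndex_lt w
      have h3 : 2 ^ (w.length + 1) ≤ 2 ^ x.length := Nat.pow_le_pow_right (by norm_num) hwx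
      omega
    have h3 : (100 * (τ + 1) + 101) * 2 ^ x.length ≤ 201 * (2 ^ x.length * (τ + 1)) := by
      have : 101 * 2 ^ x.length ≤ 101 * (2 ^ x.length * (τ + 1)) :=
        Nat.mul_le_mul_left _ (Nat.le_mul_of_pos_right _ (by omega))
      nlinarith
    have h4 : τ + 1 ≤ 2 ^ x.length * (τ + 1) := Nat.le_mul_of_pos_left _ (by positivity)
    have h5 := h2.trans h3
    simp only [List.length_append, List.length_reverse, length_pairCode, List.length_nil,
      List.length_cons]
    clear * - hl h4 h5 hlen hn hwx hτ
    generalize 2 ^ x.length * (τ + 1) = N at *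
    generalize (100 * (τ + 1) + 101) * (strIndex w + 1) = M at *
    omega
  · rw [pairCode_eq_append _ (r ++ w')]
    simp

/-- The backward direction: recover `x` from the self-delimiting program for the time bound followed
by a program for `x` on the input tape. -/
noncomputable def backward (U : MultitapeTM) : Block (WTape U) :=
  parse U ;; copy .inp .p ;; rewind .p ;; pairOut .p (.sim false U.inp) ;;
    rewind (.sim false U.inp) ;; runU U ;; copy (.sim false U.out) .x ;; rewind .x ;;
    pairOut .x .out ;; pairOut .nb .out ;; copy .r .out ;; rewind .out

-- The program needs no clock: `w` halts within `T` steps by `hw`, and `T` enters only the time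
-- bound. `Finds` promises no more than a string readable up to the first blank, which is exactly
-- what `copy` takes.
set_option maxHeartbeats 400000 in
theorem runsIn_backward {x r w : List Bool} {T : ℕ} {t : WTape U → ℤ → Option Bool}
    (hinp : Reads (t .inp) (pairCode (natString r.length) (r ++ w)))
    (hm : t .mark = strTape [] [true])
    (ht : ∀ i, i ≠ .inp → i ≠ .mark → t i = strTape [] []) (hw : U.Finds T x w) :
    ∃ t', (backward U).RunsIn (200 * (r.length + w.length + T + x.length + 1)) t t' ∧
      t' .out = strTape [] (pairCode x (pairCode (natString r.length) r)) := by
  obtain ⟨t1, s1, hinp1, hnb1, hr1, hrest1⟩ := runsIn_parse r w t hinp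
    (ht _ (by simp) (by simp)) (ht _ (by simp) (by simp)) (ht _ (by simp) (by simp))
    (ht _ (by simp) (by simp))
  have ht1 : ∀ i, i ≠ .inp → i ≠ .mark → i ≠ .nb → i ≠ .r → t1 i = strTape [] [] :=
    fun i h1 h2 h3 h4 => by rw [hrest1 i h1 h3 h4, ht i h1 h2]
  have hm1 : t1 .mark = strTape [] [true] := by rw [hrest1 _ (by simp) (by simp) (by simp), hm]
  have s2 := runsIn_copy (A := .inp) (B := .p) (by simp) w [] t1 hinp1 (by apply ht1 <;> simp)
  generalize ht2 : Function.update _ WTape.p _ = t2 at s2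
  replace ht2 := ht2.symm
  have s3 := runsIn_rewind .p (w.reverse ++ []) [] t2 (by simp [ht2])
  generalize ht3 : Function.update _ WTape.p _ = t3 at s3
  replace ht3 := ht3.symm
  have hp3 : t3 .p = strTape [] w := by simp [ht3]
  have s4 := runsIn_pairOut (A := .p) (B := .sim false U.inp) (by simp) w [] t3
    (hp3 ▸ reads_strTape _ _) (by
      have := ht1 (.sim false U.inp) (by simp) (by simp) (by simp) (by simp)
      simp [ht3, ht2, this])
  generalize ht4 : Function.update _ (WTape.sim false U.inp) _ = t4 at s4
  replace ht4 := ht4.symm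
  have s5 := runsIn_rewind (.sim false U.inp) ((pairCode w []).reverse ++ []) [] t4
    (by simp [ht4])
  generalize ht5 : Function.update _ (WTape.sim false U.inp) _ = t5 at s5
  replace ht5 := ht5.symm
  have hblank5 : ∀ i, i ≠ .inp → i ≠ .mark → i ≠ .nb → i ≠ .r → i ≠ .p →
      i ≠ .sim false U.inp → t5 i = strTape [] [] := by
    intro i h1 h2 h3 h4 h5 h6
    simp [ht5, ht4, ht3, ht2, ht1 i h1 h2 h3 h4, h1, h5, h6]
  obtain ⟨n, hn, c, hc, hst, hout⟩ := hw
  obtain ⟨t6, s6, ho6, hrest6⟩ := runsIn_runU (t := t5) (u := pairCode w []) (by simp [ht5])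
    (fun j hj => hblank5 _ (by simp) (by simp) (by simp) (by simp) (by simp) (by simpa using hj))
    (by simp [ht5, ht4, ht3, ht2, hm1])
    (by apply hblank5 <;> simp) (by apply hblank5 <;> simp) hc hst
  have hx6 : t6 .x = strTape [] [] := by
    rw [hrest6 _ (by simp) (by simp) (by simp)]; apply hblank5 <;> simp
  have ho6' : t6 .out = strTape [] [] := by
    rw [hrest6 _ (by simp) (by simp) (by simp)]; apply hblank5 <;> simp
  have hnb6 : t6 .nb = strTape [] (natString r.length) := by
    rw [hrest6 _ (by simp) (by simp) (by simp)]; simp [ht5, ht4, ht3, ht2, hnb1]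
  have hr6 : t6 .r = strTape [] r := by
    rw [hrest6 _ (by simp) (by simp) (by simp)]; simp [ht5, ht4, ht3, ht2, hr1]
  have s7 := runsIn_copy (A := .sim false U.out) (B := .x) (by simp) x [] t6 (by rwa [ho6]) hx6
  generalize ht7 : Function.update _ WTape.x _ = t7 at s7
  replace ht7 := ht7.symm
  have s8 := runsIn_rewind .x (x.reverse ++ []) [] t7 (by simp [ht7])
  generalize ht8 : Function.update _ WTape.x _ = t8 at s8
  replace ht8 := ht8.symm
  have hx8 : t8 .x = strTape [] x := by simp [ht8]
  have s9 := runsIn_pairOut (A := .x) (B := .out) (by simp) x [] t8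
    (hx8 ▸ reads_strTape _ _) (by simp [ht8, ht7, ho6'])
  generalize ht9 : Function.update _ WTape.out _ = t9 at s9
  replace ht9 := ht9.symm
  have hnb9 : t9 .nb = strTape [] (natString r.length) := by simp [ht9, ht8, ht7, hnb6]
  have s10 := runsIn_pairOut (A := .nb) (B := .out) (by simp) (natString r.length)
    ((pairCode x []).reverse ++ []) t9 (hnb9 ▸ reads_strTape _ _) (by simp [ht9])
  generalize ht10 : Function.update _ WTape.out _ = t10 at s10
  replace ht10 := ht10.symm
  have hr10 : t10 .r = strTape [] r := by simp [ht10, ht9, ht8, ht7, hr6]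
  have s11 := runsIn_copy (A := .r) (B := .out) (by simp) r
    ((pairCode (natString r.length) []).reverse ++ ((pairCode x []).reverse ++ [])) t10
    (hr10 ▸ reads_strTape _ _) (by simp [ht10])
  generalize ht11 : Function.update _ WTape.out _ = t11 at s11
  replace ht11 := ht11.symm
  have s12 := runsIn_rewind .out (r.reverse ++ ((pairCode (natString r.length) []).reverse ++
    ((pairCode x []).reverse ++ []))) [] t11 (by simp [ht11])
  refine ⟨_, (s1.seq (s2.seq (s3.seq (s4.seq (s5.seq (s6.seq (s7.seq (s8.seq
    (s9.seq (s10.seq (s11.seq s12))))))))))).mono ?_, ?_⟩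
  · have hl := length_natString_le r.length
    simp only [List.length_append, List.length_reverse, length_pairCode, List.length_nil]
    omega
  · rw [pairCode_eq_append x (pairCode _ r), pairCode_eq_append _ r]
    simp

end MultitapeTM

/-! ### The exchange of the two codes -/

namespace MultitapeTM

variable {U : MultitapeTM}

open Block

/-- The forward direction for a nonempty string `x`: without further input, `x` itself is the
bits to be erased. -/
noncomputable def erase (U : MultitapeTM) : Block (WTape U) :=
  (unpair .inp .x ;; rewind .x) ;; cond (fun σ => σ .inp = none)
    (emit .out [false, false] ;; copy .x .out ;; rewind .out) (forward U)

/-- The inverse of `erase`. -/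
noncomputable def restore (U : MultitapeTM) : Block (WTape U) :=
  go .inp .right ;; cond (fun σ => σ .inp = none) (emit .out [false] ;; rewind .out)
    (cond (fun σ => σ .inp = some false)
      (go .inp .right ;; copy .inp .x ;; rewind .x ;; pairOut .x .out ;; rewind .out)
      (go .inp .right ;; backward U))

/-- The program that erases or restores a string, depending on the first bit of the input. -/
noncomputable def exchange (U : MultitapeTM) : Block (WTape U) :=
  put .mark (fun _ => some true) ;; cond (fun σ => σ .inp = some true) (erase U) (restore U)

/-- The tapes with the string `u` on the input tape. -/
noncomputable def startTapes (U : MultitapeTM) (u : List Bool) : WTape U → ℤ → Option Bool :=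
  fun i => if i = .inp then strTape [] u else strTape [] []

/-- The program `exchange` turns `u` into `v` within `n` steps. -/
def Exchanges (U : MultitapeTM) (n : ℕ) (u v : List Bool) : Prop :=
  ∃ t', (exchange U).RunsIn n (startTapes U u) t' ∧ Reads (t' .out) v

/-- The code of a pair begins with `true` exactly when its first component is nonempty, so the first
bit reveals the direction. The mark written beforehand is the reference point for every simulated
output head. -/
theorem exchanges_of_erase {a : Bool} {x y v : List Bool} {n : ℕ}
    (h : ∃ t', (erase U).RunsIn n (Function.update (startTapes U (pairCode (a :: x) y)) .mark
      (strTape [] [true])) t' ∧ t' .out = strTape [] v) :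
    U.Exchanges (n + 2) (pairCode (a :: x) y) v := by
  obtain ⟨t', s, hv⟩ := h
  have s1 := runsIn_put (WTape.mark (U := U)) (fun _ => some true)
    (startTapes U (pairCode (a :: x) y))
  have e : Function.update (startTapes U (pairCode (a :: x) y) .mark) 0 (some true) =
      strTape [] [true] := by
    simp [startTapes]
  rw [e] at s1
  refine ⟨t', (s1.seq (RunsIn.cond_pos ?_ s)).mono (by omega), hv ▸ reads_strTape _ _⟩
  simp [scan, startTapes, pairCode_cons]

theorem exchanges_of_restore {y v : List Bool} {n : ℕ}
    (h : ∃ t', (restore U).RunsIn n (Function.update (startTapes U (pairCode [] y)) .mark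
      (strTape [] [true])) t' ∧ t' .out = strTape [] v) :
    U.Exchanges (n + 2) (pairCode [] y) v := by
  obtain ⟨t', s, hv⟩ := h
  have s1 := runsIn_put (WTape.mark (U := U)) (fun _ => some true)
    (startTapes U (pairCode [] y))
  have e : Function.update (startTapes U (pairCode [] y) .mark) 0 (some true) =
      strTape [] [true] := by
    simp [startTapes]
  rw [e] at s1
  refine ⟨t', (s1.seq (RunsIn.cond_neg ?_ s)).mono (by omega), hv ▸ reads_strTape _ _⟩
  simp [scan, startTapes, pairCode_nil]

theorem runsIn_load (x y : List Bool) (t : WTape U → ℤ → Option Bool)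
    (ht : t = Function.update (startTapes U (pairCode x y)) .mark (strTape [] [true])) :
    ∃ t', (unpair .inp .x ;; rewind .x).RunsIn (7 * x.length + 5) t t' ∧ Reads (t' .inp) y ∧
      t' .x = strTape [] x ∧ t' .mark = strTape [] [true] ∧
      ∀ i, i ≠ .inp → i ≠ .x → i ≠ .mark → t' i = strTape [] [] := by
  have hinp : Reads (t .inp) (pairCode x y) := by
    simpa [ht, startTapes] using reads_strTape [] (pairCode x y)
  have s1 := runsIn_unpair (A := WTape.inp) (B := .x) (by simp) x y [] t hinp
    (by simp [ht, startTapes])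
  generalize ht1 : Function.update _ WTape.x _ = t1 at s1
  replace ht1 := ht1.symm
  have s2 := runsIn_rewind .x (x.reverse ++ []) [] t1 (by simp [ht1])
  refine ⟨_, (s1.seq s2).mono (by simp; omega), ?_, by simp, ?_, ?_⟩
  · simpa [ht1] using hinp.pair_snd
  · simp [ht1, ht]
  · intro i h1 h2 h3
    simp [ht1, ht, startTapes, h1, h2, h3]

/-- The fallback for strings without a shorter program: the blank after the code of `x` selects it,
and the flag `false` tells `restore` that `x` follows literally. -/
theorem exchanges_pair_nil {x : List Bool} (hx : x ≠ []) :
    U.Exchanges (20 * x.length + 50) (pairCode x []) (pairCode [] (false :: x)) := by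
  obtain ⟨a, x, rfl⟩ := List.exists_cons_of_ne_nil hx
  refine (exchanges_of_erase (n := 20 * (a :: x).length + 48) ?_)
  obtain ⟨t1, s1, hinp1, hx1, -, hrest1⟩ := runsIn_load (U := U) (a :: x) [] _ rfl
  have s2 := runsIn_emit .out [false, false] [] t1 (hrest1 _ (by simp) (by simp) (by simp))
  generalize ht2 : Function.update _ WTape.out _ = t2 at s2
  replace ht2 := ht2.symm
  have hx2 : t2 .x = strTape [] (a :: x) := by simp [ht2, hx1]
  have s3 := runsIn_copy (A := WTape.x) (B := .out) (by simp) (a :: x)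
    ([false, false].reverse ++ []) t2 (hx2 ▸ reads_strTape _ _) (by simp [ht2])
  generalize ht3 : Function.update _ WTape.out _ = t3 at s3
  replace ht3 := ht3.symm
  have s4 := runsIn_rewind .out ((a :: x).reverse ++ ([false, false].reverse ++ [])) [] t3
    (by simp [ht3])
  refine ⟨_, (s1.seq (RunsIn.cond_pos ?_ (s2.seq (s3.seq s4)))).mono ?_, ?_⟩
  · simp [scan, hinp1.zero]
  · simp; omega
  · simp [pairCode_nil]

theorem exchanges_nil_pair (x : List Bool) :
    U.Exchanges (20 * x.length + 50) (pairCode [] (false :: x)) (pairCode x []) := by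
  refine (exchanges_of_restore (n := 20 * x.length + 48) ?_)
  have s1 := runsIn_goRight WTape.inp
    (Function.update (startTapes U (pairCode [] (false :: x))) .mark (strTape [] [true]))
  generalize ht1 : Function.update _ WTape.inp _ = t1 at s1
  replace ht1 := ht1.symm
  have hinp1 : t1 .inp = strTape [false] (false :: x) := by
    simp [ht1, startTapes, pairCode_nil, shiftTape_right]
  have s2 := runsIn_goRight WTape.inp t1
  generalize ht2 : Function.update _ WTape.inp _ = t2 at s2
  replace ht2 := ht2.symm
  have hinp2 : t2 .inp = strTape [false, false] x := by simp [ht2, hinp1, shiftTape_right]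
  have s3 := runsIn_copy (A := WTape.inp) (B := .x) (by simp) x [] t2
    (hinp2 ▸ reads_strTape _ _) (by simp [ht2, ht1, startTapes])
  generalize ht3 : Function.update _ WTape.x _ = t3 at s3
  replace ht3 := ht3.symm
  have s4 := runsIn_rewind .x (x.reverse ++ []) [] t3 (by simp [ht3])
  generalize ht4 : Function.update _ WTape.x _ = t4 at s4
  replace ht4 := ht4.symm
  have hx4 : t4 .x = strTape [] x := by simp [ht4]
  have s5 := runsIn_pairOut (A := WTape.x) (B := .out) (by simp) x [] t4
    (hx4 ▸ reads_strTape _ _) (by simp [ht4, ht3, ht2, ht1, startTapes])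
  generalize ht5 : Function.update _ WTape.out _ = t5 at s5
  replace ht5 := ht5.symm
  have s6 := runsIn_rewind .out ((pairCode x []).reverse ++ []) [] t5 (by simp [ht5])
  refine ⟨_, (s1.seq (RunsIn.cond_neg ?_ (RunsIn.cond_pos ?_
    (s2.seq (s3.seq (s4.seq (s5.seq s6))))))).mono ?_, ?_⟩
  · simp [scan, hinp1]
  · simp [scan, hinp1]
  · simp [length_pairCode]; omega
  · simp

/-- The empty string is its own partner. Its code begins with `false`, so it is treated in the
restoring branch. -/
theorem exchanges_nil_nil : U.Exchanges 20 (pairCode [] []) (pairCode [] []) := by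
  refine (exchanges_of_restore (n := 18) ?_)
  have s1 := runsIn_goRight WTape.inp
    (Function.update (startTapes U (pairCode [] [])) .mark (strTape [] [true]))
  generalize ht1 : Function.update _ WTape.inp _ = t1 at s1
  replace ht1 := ht1.symm
  have hinp1 : t1 .inp = strTape [false] [] := by
    simp [ht1, startTapes, pairCode_nil, shiftTape_right]
  have s2 := runsIn_emit .out [false] [] t1 (by simp [ht1, startTapes])
  generalize ht2 : Function.update _ WTape.out _ = t2 at s2
  replace ht2 := ht2.symm
  have s3 := runsIn_rewind .out ([false].reverse ++ []) [] t2 (by simp [ht2])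
  refine ⟨_, (s1.seq (RunsIn.cond_pos ?_ (s2.seq s3))).mono ?_, ?_⟩
  · simp [scan, hinp1]
  · simp
  · simp [pairCode_nil]

theorem exchanges_forward {x r w : List Bool} {s τ : ℕ} (hr : U.OutputsWithin s (pairCode r x)
      (natString τ)) (hτ : x.length ≤ τ) (hw : U.Finds (τ + 1) x w)
    (hwx : w.length < x.length) :
    ∃ w', U.Finds (τ + 1) x w' ∧ w'.length ≤ w.length ∧
      U.Exchanges (500 * (r.length + s + 2 ^ x.length * (τ + 1) + 1))
        (pairCode x (pairCode (natString r.length) r))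
        (pairCode [] (true :: pairCode (natString r.length) (r ++ w'))) := by
  obtain ⟨a, x, rfl⟩ := List.exists_cons_of_ne_nil (l := x) (by rintro rfl; simp at hwx)
  obtain ⟨t1, s1, hinp1, hx1, hm1, hrest1⟩ :=
    runsIn_load (U := U) (a :: x) (pairCode (natString r.length) r) _ rfl
  obtain ⟨w', h1, h2, t', s2, ho⟩ := runsIn_forward hinp1 hx1 hm1 hrest1 hr hτ hw hwx
  refine ⟨w', h1, h2, ?_⟩
  have h4 : τ + 1 ≤ 2 ^ (a :: x).length * (τ + 1) := Nat.le_mul_of_pos_left _ (by positivity)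
  generalize 2 ^ (a :: x).length * (τ + 1) = N at *
  have h5 := exchanges_of_erase (U := U) (a := a) (x := x) (n := 498 * (r.length + s + N + 1))
    ⟨t', (s1.seq (RunsIn.cond_neg ?_ s2)).mono (by omega), by rw [ho]⟩
  · rw [pairCode_nil]
    obtain ⟨t', s, hv⟩ := h5
    exact ⟨t', s.mono (by omega), hv⟩
  -- A pair code is never empty, even for an empty `r`. So the blank that selects the literal branch
  -- does not appear.
  · have := hinp1.zero
    rw [scan, this]
    cases natString r.length <;> simp [pairCode_nil, pairCode_cons]

theorem exchanges_backward {x r w : List Bool} {T : ℕ} (hw : U.Finds T x w) :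
    U.Exchanges (300 * (r.length + w.length + T + x.length + 1))
      (pairCode [] (true :: pairCode (natString r.length) (r ++ w)))
      (pairCode x (pairCode (natString r.length) r)) := by
  have s1 := runsIn_goRight WTape.inp
    (Function.update (startTapes U (pairCode []
      (true :: pairCode (natString r.length) (r ++ w)))) .mark (strTape [] [true]))
  generalize ht1 : Function.update _ WTape.inp _ = t1 at s1
  replace ht1 := ht1.symm
  have hinp1 : t1 .inp = strTape [false] (true :: pairCode (natString r.length) (r ++ w)) := by
    rw [pairCode_nil] at ht1
    simp [ht1, startTapes, shiftTape_right]
  have s2 := runsIn_goRight WTape.inp t1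
  generalize ht2 : Function.update _ WTape.inp _ = t2 at s2
  replace ht2 := ht2.symm
  have hinp2 : t2 .inp = strTape [true, false] (pairCode (natString r.length) (r ++ w)) := by
    simp [ht2, hinp1, shiftTape_right]
  obtain ⟨t', s3, ho⟩ := runsIn_backward (t := t2) (hinp2 ▸ reads_strTape _ _)
    (by simp [ht2, ht1]) (fun i h1 h2 => by simp [ht2, ht1, startTapes, h1, h2]) hw
  obtain ⟨t', s, hv⟩ := exchanges_of_restore (U := U)
    ⟨t', s1.seq (RunsIn.cond_neg (by simp [scan, hinp1]) (RunsIn.cond_neg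
      (by simp [scan, hinp1]) (s2.seq s3))), ho⟩
  exact ⟨t', s.mono (by omega), hv⟩

end MultitapeTM

/-! ### Reversible machines -/

/-- The opposite head movement. -/
def HeadMove.neg : HeadMove → HeadMove
  | .left => .right
  | .stay => .stay
  | .right => .left

@[simp] theorem HeadMove.shift_neg (d : HeadMove) : d.neg.shift = -d.shift := by
  cases d <;> simp [HeadMove.neg, HeadMove.shift]

/-- A reversible multitape program: a partial injection of pairs of a state and scanned symbols,
where the head movements after a step are determined by the new state. -/
structure RevProgram (X : Type) where
  State : Type
  finite_state : Finite State
  start : State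
  halt : State
  move : State → X → HeadMove
  rel : State → (X → Option Bool) → State → (X → Option Bool) → Prop
  functional : ∀ {q σ q₁ σ₁ q₂ σ₂}, rel q σ q₁ σ₁ → rel q σ q₂ σ₂ → q₁ = q₂ ∧ σ₁ = σ₂
  injective : ∀ {q σ q₁ σ₁ q₂ σ₂}, rel q₁ σ₁ q σ → rel q₂ σ₂ q σ → q₁ = q₂ ∧ σ₁ = σ₂
  not_rel_halt : ∀ {σ q' σ'}, ¬ rel halt σ q' σ'
  not_rel_start : ∀ {q σ σ'}, ¬ rel q σ start σ'
  move_start : ∀ i, move start i = .stay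
  move_halt : ∀ i, move halt i = .stay

namespace RevProgram

variable {X : Type}

/-- The symbols under the heads, where each tape is given by its head position and its cells. -/
def read (s : X → ℤ × (ℤ → Option Bool)) : X → Option Bool := fun i => (s i).2 (s i).1

/-- Write the symbols `σ` and move the heads by `d`. -/
def write (s : X → ℤ × (ℤ → Option Bool)) (σ : X → Option Bool) (d : X → HeadMove) :
    X → ℤ × (ℤ → Option Bool) :=
  fun i => ((s i).1 + (d i).shift, Function.update (s i).2 (s i).1 (σ i))

/-- `P.Steps q s n q' s'`: from the state `q` and the tapes `s` one gets in `n` steps to `q'` and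
`s'`. -/
inductive Steps (P : RevProgram X) : P.State → (X → ℤ × (ℤ → Option Bool)) → ℕ →
    P.State → (X → ℤ × (ℤ → Option Bool)) → Prop
  | refl (q s) : Steps P q s 0 q s
  | step {q s q₁ σ n q' s'} : P.rel q (read s) q₁ σ →
      Steps P q₁ (write s σ (P.move q₁)) n q' s' → Steps P q s (n + 1) q' s'

/-- The program turns the tapes `s` into `s'` in `n` steps. -/
def Transforms (P : RevProgram X) (n : ℕ) (s s' : X → ℤ × (ℤ → Option Bool)) : Prop :=
  P.Steps P.start s n P.halt s'

theorem Steps.trans {P : RevProgram X} {q q' q'' : P.State} {s s' s'' n m}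
    (h : P.Steps q s n q' s') (h' : P.Steps q' s' m q'' s'') :
    P.Steps q s (m + n) q'' s'' := by
  induction h with
  | refl => exact h'
  | step hr _ ih => exact .step hr (ih h')

theorem Steps.one {P : RevProgram X} {q q' : P.State} {s s'} {σ : X → Option Bool}
    (hr : P.rel q (read s) q' σ) (hs : write s σ (P.move q') = s') : P.Steps q s 1 q' s' := by
  subst hs
  exact .step hr (.refl _ _)

theorem write_read_stay (s : X → ℤ × (ℤ → Option Bool)) {d : X → HeadMove}
    (hd : ∀ i, d i = .stay) : write s (read s) d = s := by
  funext i
  simp [write, read, hd, HeadMove.shift]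

/-- Sequential composition. -/
def seq (P Q : RevProgram X) : RevProgram X where
  State := P.State ⊕ Q.State
  finite_state := by
    have := P.finite_state
    have := Q.finite_state
    infer_instance
  start := .inl P.start
  halt := .inr Q.halt
  move := Sum.elim P.move Q.move
  rel := fun q σ q' σ' => match q, q' with
    | .inl q, .inl q' => P.rel q σ q' σ'
    | .inl q, .inr q' => q = P.halt ∧ q' = Q.start ∧ σ' = σ
    | .inr _, .inl _ => False
    | .inr q, .inr q' => Q.rel q σ q' σ'
  functional := by
    rintro (q | q) σ (q₁ | q₁) σ₁ (q₂ | q₂) σ₂ h h'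
    · have := P.functional h h'; simpa using this
    · obtain ⟨rfl, -, -⟩ := h'; exact (P.not_rel_halt h).elim
    · obtain ⟨rfl, -, -⟩ := h; exact (P.not_rel_halt h').elim
    · obtain ⟨-, rfl, rfl⟩ := h; obtain ⟨-, rfl, rfl⟩ := h'; simp
    · exact h.elim
    · exact h.elim
    · exact h'.elim
    · have := Q.functional h h'; simpa using this
  injective := by
    rintro (q | q) σ (q₁ | q₁) σ₁ (q₂ | q₂) σ₂ h h'
    · have := P.injective h h'; simpa using this
    · exact h'.elim
    · exact h.elim
    · exact h.elim
    · obtain ⟨rfl, -, rfl⟩ := h; obtain ⟨rfl, -, rfl⟩ := h'; simp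
    · obtain ⟨-, rfl, -⟩ := h; exact (Q.not_rel_start h').elim
    · obtain ⟨-, rfl, -⟩ := h'; exact (Q.not_rel_start h).elim
    · have := Q.injective h h'; simpa using this
  not_rel_halt := by
    rintro σ (q | q) σ' h
    · exact h
    · exact Q.not_rel_halt h
  not_rel_start := by
    rintro (q | q) σ σ' h
    · exact P.not_rel_start h
    · exact h
  move_start := P.move_start
  move_halt := Q.move_halt

/-- The additional step links the halting state of `P` to the start of `Q`; it writes what it reads,
and entering a start state moves no head. -/
theorem Transforms.seq {P Q : RevProgram X} {n m s s' s''} (h : P.Transforms n s s')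
    (h' : Q.Transforms m s' s'') : (P.seq Q).Transforms (n + m + 1) s s'' := by
  have hP : ∀ {q s n q' s'}, P.Steps q s n q' s' →
      (P.seq Q).Steps (.inl q) s n (.inl q') s' := by
    intro q s n q' s' h
    induction h with
    | refl => exact .refl _ _
    | @step q s q₁ σ n q' s' hr _ ih => exact .step (P := P.seq Q) (q₁ := .inl q₁) hr ih
  have hQ : ∀ {q s n q' s'}, Q.Steps q s n q' s' →
      (P.seq Q).Steps (.inr q) s n (.inr q') s' := by
    intro q s n q' s' h
    induction h with
    | refl => exact .refl _ _
    | @step q s q₁ σ n q' s' hr _ ih => exact .step (P := P.seq Q) (q₁ := .inr q₁) hr ih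
  have hmid : (P.seq Q).Steps (.inl P.halt) s' 1 (.inr Q.start) s' :=
    .one (σ := read s') ⟨rfl, rfl, rfl⟩ (write_read_stay _ Q.move_start)
  have := ((hP h).trans hmid).trans (hQ h')
  have e : n + m + 1 = m + (1 + n) := by ring
  rw [e]
  exact this

/-- The inverse program. -/
def symm (P : RevProgram X) : RevProgram X where
  State := P.State
  finite_state := P.finite_state
  start := P.halt
  halt := P.start
  move := fun q i => (P.move q i).neg
  rel := fun q σ q' σ' => P.rel q' σ' q σ
  functional := P.injective
  injective := P.functional
  not_rel_halt := P.not_rel_start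
  not_rel_start := P.not_rel_halt
  move_start := fun i => by rw [P.move_halt]; rfl
  move_halt := fun i => by rw [P.move_start]; rfl

/-- Undo the movement that was made when the state `q` was entered. -/
def unmove (P : RevProgram X) (q : P.State) (s : X → ℤ × (ℤ → Option Bool)) :
    X → ℤ × (ℤ → Option Bool) :=
  fun i => ((s i).1 - (P.move q i).shift, (s i).2)

/-- A step writes first and then moves as its new state says. Backwards, the movement has to be
undone before the written symbols can be read, so the inverse program meets the state `q` with the
heads where they were before `q` was entered; `unmove` expresses this. -/
theorem Steps.symm {P : RevProgram X} {q q' : P.State} {s s' n} (h : P.Steps q s n q' s') :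
    P.symm.Steps q' (P.unmove q' s') n q (P.unmove q s) := by
  induction h with
  | refl => exact .refl _ _
  | @step q s q₁ σ n q' s' hr _ ih =>
    have h1 : read (P.unmove q₁ (write s σ (P.move q₁))) = σ := by
      funext i; simp [read, unmove, write]
    have h2 : P.symm.Steps q₁ (P.unmove q₁ (write s σ (P.move q₁))) 1 q (P.unmove q s) := by
      refine .one (P := P.symm) (σ := read s) (show P.rel q (read s) q₁ _ from h1.symm ▸ hr) ?_
      funext i
      simp [write, unmove, RevProgram.symm, read, sub_eq_add_neg]
    have := ih.trans h2
    rwa [add_comm] at this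

theorem Transforms.symm {P : RevProgram X} {n s s'} (h : P.Transforms n s s') :
    P.symm.Transforms n s' s := by
  have h1 : P.unmove P.halt s' = s' := by
    funext i; simp [unmove, P.move_halt, HeadMove.shift]
  have h2 : P.unmove P.start s = s := by
    funext i; simp [unmove, P.move_start, HeadMove.shift]
  have := Steps.symm h
  rwa [h1, h2] at this

/-- The program with its tapes permuted. -/
def relabel (P : RevProgram X) (e : X ≃ X) : RevProgram X where
  State := P.State
  finite_state := P.finite_state
  start := P.start
  halt := P.halt
  move := fun q i => P.move q (e i)
  rel := fun q σ q' σ' => P.rel q (σ ∘ e.symm) q' (σ' ∘ e.symm)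
  functional := fun h h' => by
    have := P.functional h h'
    exact ⟨this.1, e.symm.surjective.injective_comp_right this.2⟩
  injective := fun h h' => by
    have := P.injective h h'
    exact ⟨this.1, e.symm.surjective.injective_comp_right this.2⟩
  not_rel_halt := P.not_rel_halt
  not_rel_start := P.not_rel_start
  move_start := fun i => P.move_start _
  move_halt := fun i => P.move_halt _

theorem Transforms.relabel {P : RevProgram X} {n s s'} (h : P.Transforms n s s') (e : X ≃ X) :
    (P.relabel e).Transforms n (s ∘ e) (s' ∘ e) := by
  have : ∀ {q s n q' s'}, P.Steps q s n q' s' →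
      (P.relabel e).Steps q (s ∘ e) n q' (s' ∘ e) := by
    intro q s n q' s' h
    induction h with
    | refl => exact .refl _ _
    | @step q s q₁ σ n q' s' hr _ ih =>
      refine .step (P := P.relabel e) (q₁ := q₁) (σ := σ ∘ e) ?_ ih
      have h1 : read (s ∘ e) ∘ e.symm = read s := by funext i; simp [read]
      have h2 : (σ ∘ e) ∘ e.symm = σ := by funext i; simp
      simp only [RevProgram.relabel, h1, h2]
      exact hr
  exact this h

open Classical in
/-- The Turing machine that a reversible program describes. -/
noncomputable def toTM [Finite X] (P : RevProgram X) (inp out : X) (h : inp ≠ out) :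
    MultitapeTM where
  State := P.State
  finite_state := P.finite_state
  Tape := X
  finite_tape := inferInstance
  inp := inp
  out := out
  inp_ne_out := h
  start := P.start
  halt := P.halt
  trans := fun q σ => if h : ∃ a : P.State × (X → Option Bool), P.rel q σ a.1 a.2 then
      some (h.choose.1, fun i => (h.choose.2 i, P.move h.choose.1 i))
    else none

section toTM

variable [Finite X] {P : RevProgram X} {inp out : X} {h : inp ≠ out}

theorem trans_toTM {q q' : P.State} {σ σ' : X → Option Bool} (hr : P.rel q σ q' σ') :
    (P.toTM inp out h).trans q σ = some (q', fun i => (σ' i, P.move q' i)) := by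
  have hex : ∃ a : P.State × (X → Option Bool), P.rel q σ a.1 a.2 := ⟨(q', σ'), hr⟩
  have h1 := P.functional hex.choose_spec hr
  refine (dif_pos hex).trans ?_
  rw [h1.1, h1.2]

theorem step_toTM {c c' : (P.toTM inp out h).Cfg} (hs : (P.toTM inp out h).step c = some c') :
    ∃ σ : X → Option Bool, P.rel c.state (fun i => c.cells i (c.head i)) c'.state σ ∧
      c'.head = (fun i => c.head i + (P.move c'.state i).shift) ∧
      c'.cells = fun i => Function.update (c.cells i) (c.head i) (σ i) := by
  unfold MultitapeTM.step at hs
  split_ifs at hs with h1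
  simp only [Option.map_eq_some_iff] at hs
  obtain ⟨a, ha, rfl⟩ := hs
  by_cases hex : ∃ a : P.State × (X → Option Bool),
      P.rel c.state (fun i => c.cells i (c.head i)) a.1 a.2
  · obtain ⟨⟨q', σ'⟩, hr⟩ := hex
    have := (trans_toTM (inp := inp) (out := out) (h := h) hr).symm.trans ha
    obtain rfl := Option.some.inj this
    exact ⟨σ', hr, rfl, rfl⟩
  · exact absurd ((dif_neg hex).symm.trans ha) (by simp)

/-- The new state determines the movements, hence the old head positions; the cells there show the
symbols written. Injectivity of `rel` yields the old state and the old symbols, and all other cells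
are unchanged. -/
theorem reversible_toTM : (P.toTM inp out h).Reversible := by
  intro c₁ c₂ c h₁ h₂
  obtain ⟨σ₁, r₁, e₁, f₁⟩ := step_toTM h₁
  obtain ⟨σ₂, r₂, e₂, f₂⟩ := step_toTM h₂
  have hhead : c₁.head = c₂.head := by
    funext i
    have := congrFun (e₁.symm.trans e₂) i
    simpa using this
  have hσ : σ₁ = σ₂ := by
    funext i
    have := congrFun (congrFun (f₁.symm.trans f₂) i) (c₁.head i)
    simpa [hhead] using this
  subst hσ
  have hinj := P.injective r₁ r₂
  refine MultitapeTM.Cfg.ext hinj.1 hhead ?_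
  funext i z
  by_cases hz : z = c₁.head i
  · subst hz
    have := congrFun hinj.2 i
    simpa [hhead] using this
  · have := congrFun (congrFun (f₁.symm.trans f₂) i) z
    simpa [hz, hhead ▸ hz] using this

theorem stepN_toTM {q q' : P.State} {s s' : X → ℤ × (ℤ → Option Bool)} {n : ℕ}
    (hs : P.Steps q s n q' s') :
    (P.toTM inp out h).stepN n ⟨q, fun i => (s i).1, fun i => (s i).2⟩ =
      some ⟨q', fun i => (s' i).1, fun i => (s' i).2⟩ := by
  induction hs with
  | refl => rfl
  | @step q s q₁ σ n q' s' hr _ ih =>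
    have hq : q ≠ P.halt := by rintro rfl; exact P.not_rel_halt hr
    have hstep := MultitapeTM.step_eq_some (U := P.toTM inp out h)
      (c := ⟨q, fun i => (s i).1, fun i => (s i).2⟩) hq (trans_toTM hr)
    rw [MultitapeTM.stepN, hstep]
    exact ih

open Classical in
theorem replacesWithin_toTM {n : ℕ} {u v : List Bool}
    (hs : P.Transforms n (fun i => (0, if i = inp then tapeOf u else tapeOf []))
      (fun i => (0, if i = out then tapeOf v else tapeOf []))) :
    (P.toTM inp out h).ReplacesWithin n u v :=
  ⟨n, le_rfl, stepN_toTM hs⟩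

end toTM

end RevProgram

/-! ### Reversible simulation of a program block -/

/-- The tapes of the reversible simulation of the block `B`: those of `B`, history tapes, and one
tape for a copy of the result. -/
inductive HistTape {T : Type} (B : Block T) : Type
  | work (i : T)
  | hist (x : B.State × (T → Option Bool))
  | copy

/-- The states of the reversible simulation with history. -/
inductive LogState {T : Type} (B : Block T) : Type
  | start
  | read (s : B.State)
  | log (x : B.State × (T → Option Bool))
  | halt

/-- The states of the reversible copying program. -/
inductive CopyState : Type
  | start | back | right | left | settle | halt

namespace Block

variable {T : Type} (B : Block T)

theorem finite_histTape [Finite T] : Finite (HistTape B) := by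
  have := B.finite_state
  let f : T ⊕ (B.State × (T → Option Bool)) ⊕ Unit → HistTape B := fun s => match s with
    | .inl i => .work i
    | .inr (.inl x) => .hist x
    | .inr (.inr _) => .copy
  refine Finite.of_surjective f fun i => ?_
  cases i with
  | work i => exact ⟨.inl i, rfl⟩
  | hist x => exact ⟨.inr (.inl x), rfl⟩
  | copy => exact ⟨.inr (.inr ()), rfl⟩

theorem finite_logState [Finite T] : Finite (LogState B) := by
  have := B.finite_state
  let f : Bool ⊕ B.State ⊕ (B.State × (T → Option Bool)) → LogState B := fun s => match s with
    | .inl false => .start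
    | .inl true => .halt
    | .inr (.inl s) => .read s
    | .inr (.inr x) => .log x
  refine Finite.of_surjective f fun i => ?_
  cases i with
  | start => exact ⟨.inl false, rfl⟩
  | halt => exact ⟨.inl true, rfl⟩
  | read s => exact ⟨.inr (.inl s), rfl⟩
  | log x => exact ⟨.inr (.inr x), rfl⟩

variable {B}

open Classical in
/-- The symbols on the history tapes that record `x`. -/
noncomputable def mark (x x' : B.State × (T → Option Bool)) : Option Bool :=
  some (decide (x' = x))

theorem mark_injective {x y : B.State × (T → Option Bool)} (h : mark (B := B) x = mark y) :
    x = y := by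
  have := congrFun h x
  simpa [mark] using this

/-- The symbols written when `x` is recorded. -/
noncomputable def logWrite (x : B.State × (T → Option Bool)) (σ : HistTape B → Option Bool) :
    HistTape B → Option Bool
  | .work i => ((B.next x.1 x.2).1 i).1
  | .hist x' => mark x x'
  | .copy => σ .copy

/-- The steps of the simulation with history. -/
inductive LogRel (B : Block T) : LogState B → (HistTape B → Option Bool) → LogState B →
    (HistTape B → Option Bool) → Prop
  | start {σ σ' s} : (∀ x, σ (.hist x) = none) → s = B.entry → σ' = σ →
      LogRel B .start σ (.read s) σ'
  | read {s σ σ' x} : (∀ x, σ (.hist x) = none) → x = (s, fun i => σ (.work i)) →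
      σ' = logWrite x σ → LogRel B (.read s) σ (.log x) σ'
  | next {x σ σ' s} : (∀ x', σ (.hist x') = mark x x') → (B.next x.1 x.2).2 = some s → σ' = σ →
      LogRel B (.log x) σ (.read s) σ'
  | exit {x σ σ'} : (∀ x', σ (.hist x') = mark x x') → (B.next x.1 x.2).2 = none → σ' = σ →
      LogRel B (.log x) σ .halt σ'

theorem logRel_functional {q σ q₁ σ₁ q₂ σ₂} (h₁ : LogRel B q σ q₁ σ₁)
    (h₂ : LogRel B q σ q₂ σ₂) : q₁ = q₂ ∧ σ₁ = σ₂ := by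
  cases h₁ with
  | start a b c =>
    cases h₂ with
    | start a' b' c' => subst b c b' c'; exact ⟨rfl, rfl⟩
  | read a b c =>
    cases h₂ with
    | read a' b' c' => subst b b' c c'; exact ⟨rfl, rfl⟩
  | next a b c =>
    cases h₂ with
    | next a' b' c' => rw [b] at b'; cases b'; subst c c'; exact ⟨rfl, rfl⟩
    | exit a' b' c' => rw [b] at b'; cases b'
  | exit a b c =>
    cases h₂ with
    | next a' b' c' => rw [b] at b'; cases b'
    | exit a' b' c' => subst c c'; exact ⟨rfl, rfl⟩

/-- A state `log x` contains the overwritten symbols and the previous state, and the history cells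
were blank before. A state `read s` may have many predecessors, but the record under the history
heads names the right one; blank history cells single out the start. -/
theorem logRel_injective [Nonempty T] {q σ q₁ σ₁ q₂ σ₂} (h₁ : LogRel B q₁ σ₁ q σ)
    (h₂ : LogRel B q₂ σ₂ q σ) : q₁ = q₂ ∧ σ₁ = σ₂ := by
  cases h₁ with
  | start a b c =>
    subst c
    cases h₂ with
    | start a' b' c' => subst c'; exact ⟨rfl, rfl⟩
    | @next x _ _ _ a' b' c' =>
      subst c'
      have := (a x).symm.trans (a' x)
      simp [mark] at this
  | read a b c =>
    cases h₂ with
    | read a' b' c' =>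
      subst b
      obtain ⟨rfl, hw⟩ := Prod.mk.inj b'
      refine ⟨rfl, funext fun i => ?_⟩
      cases i with
      | work i => exact congrFun hw i
      | hist x => rw [a, a']
      | copy => exact congrFun (c.symm.trans c') .copy
  | @next x _ _ _ a b c =>
    subst c
    cases h₂ with
    | start a' b' c' =>
      subst c'
      have := (a' x).symm.trans (a x)
      simp [mark] at this
    | next a' b' c' =>
      subst c'
      have := mark_injective (funext fun x => (a x).symm.trans (a' x))
      subst this
      exact ⟨rfl, rfl⟩
  | exit a b c =>
    subst c
    cases h₂ with
    | exit a' b' c' =>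
      subst c'
      have := mark_injective (funext fun x => (a x).symm.trans (a' x))
      subst this
      exact ⟨rfl, rfl⟩

variable (B) in
/-- The head movements of the simulation with history. -/
def logMove : LogState B → HistTape B → HeadMove
  | .read _, .hist _ => .right
  | .log x, .work i => ((B.next x.1 x.2).1 i).2
  | _, _ => .stay

variable (B) in
/-- The reversible simulation of `B` with history. -/
noncomputable def logged [Finite T] [Nonempty T] : RevProgram (HistTape B) where
  State := LogState B
  finite_state := finite_logState B
  start := .start
  halt := .halt
  move := logMove B
  rel := LogRel B
  functional := logRel_functional
  injective := logRel_injective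
  not_rel_halt := by intro σ q' σ' h; cases h
  not_rel_start := by intro q σ σ' h; cases h
  move_start := fun i => by cases i <;> rfl
  move_halt := fun i => by cases i <;> rfl

/-- The tapes of the reversible simulation, put together. -/
def joinTapes (w : T → ℤ × (ℤ → Option Bool))
    (h : B.State × (T → Option Bool) → ℤ × (ℤ → Option Bool)) (c : ℤ × (ℤ → Option Bool)) :
    HistTape B → ℤ × (ℤ → Option Bool)
  | .work i => w i
  | .hist x => h x
  | .copy => c

/-- Each step of `B` becomes two, because movements may depend only on the state entered: entering
`log x` moves the work heads, which `x` determines, and entering `read` advances the history heads.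
-/
theorem logged_exec [Finite T] [Nonempty T] {s : B.State} {t t' : T → ℤ → Option Bool} {n : ℕ}
    (he : B.Exec s t n t') (w : T → ℤ × (ℤ → Option Bool))
    (h : B.State × (T → Option Bool) → ℤ × (ℤ → Option Bool))
    (hw : ∀ i, t i = shiftTape (w i).1 (w i).2)
    (hh : ∀ x (z : ℤ), 0 ≤ z → (h x).2 ((h x).1 + z) = none) :
    ∃ w' h', (∀ i, t' i = shiftTape (w' i).1 (w' i).2) ∧
      ∀ c, B.logged.Steps (.read s) (joinTapes w h c) (2 * n) .halt (joinTapes w' h' c) := by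
  have key : ∀ {s : B.State} {t : T → ℤ → Option Bool} (w : T → ℤ × (ℤ → Option Bool))
      (h : B.State × (T → Option Bool) → ℤ × (ℤ → Option Bool)),
      (∀ i, t i = shiftTape (w i).1 (w i).2) →
      (∀ x (z : ℤ), 0 ≤ z → (h x).2 ((h x).1 + z) = none) →
      ∃ w₁ h₁, (∀ i, applyAct (B.next s (scan t)).1 t i = shiftTape (w₁ i).1 (w₁ i).2) ∧
        (∀ x, (h₁ x).2 (h₁ x).1 = mark (s, scan t) x) ∧
        (∀ x (z : ℤ), 0 < z → (h₁ x).2 ((h₁ x).1 + z) = none) ∧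
        ∀ c, B.logged.Steps (.read s) (joinTapes w h c) 1 (.log (s, scan t))
          (joinTapes w₁ h₁ c) := by
    intro s t w h hw hh
    refine ⟨fun i => ((w i).1 + ((B.next s (scan t)).1 i).2.shift,
      Function.update (w i).2 (w i).1 ((B.next s (scan t)).1 i).1),
      fun x => ((h x).1, Function.update (h x).2 (h x).1 (mark (s, scan t) x)), ?_, ?_, ?_, ?_⟩
    · intro i
      simp [applyAct, hw, MultitapeTM.update_shiftTape, add_comm]
    · simp
    · intro x z hz
      have : (h x).1 + z ≠ (h x).1 := by omega
      simp [this, hh x z hz.le]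
    · intro c
      have hscan : scan t = fun i => RevProgram.read (joinTapes (B := B) w h c) (.work i) := by
        funext i; simp [scan, RevProgram.read, joinTapes, hw]
      refine .one (.read (fun x => by simpa [RevProgram.read, joinTapes] using hh x 0 le_rfl)
        (by rw [hscan]) rfl) ?_
      funext i
      cases i <;> simp [RevProgram.write, joinTapes, logWrite, logged, logMove, HeadMove.shift,
        RevProgram.read]
  induction he generalizing w h with
  | @exit s t a hn =>
    obtain ⟨w₁, h₁, e1, e2, e3, e4⟩ := key (s := s) w h hw hh
    rw [hn] at e1
    refine ⟨w₁, h₁, e1, fun c => (e4 c).trans (.one (.exit (fun x => ?_) (by rw [hn]) rfl) ?_)⟩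
    · simp [RevProgram.read, joinTapes, e2]
    · exact RevProgram.write_read_stay _ fun i => by cases i <;> rfl
  | @step s t a s' n t' hn _ ih =>
    obtain ⟨w₁, h₁, e1, e2, e3, e4⟩ := key (s := s) w h hw hh
    rw [hn] at e1
    obtain ⟨w', h', f1, f2⟩ := ih w₁ (fun x => ((h₁ x).1 + 1, (h₁ x).2)) e1 (by
      intro x z hz
      have := e3 x (1 + z) (by omega)
      simpa [add_assoc] using this)
    refine ⟨w', h', f1, fun c => ?_⟩
    have hstep : B.logged.Steps (.log (s, scan t)) (joinTapes w₁ h₁ c) 1 (.read s')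
        (joinTapes w₁ (fun x => ((h₁ x).1 + 1, (h₁ x).2)) c) := by
      refine .one (.next (fun x => ?_) (by rw [hn]) rfl) ?_
      · simp [RevProgram.read, joinTapes, e2]
      · funext i
        cases i <;> simp [RevProgram.write, joinTapes, logged, logMove, HeadMove.shift,
          RevProgram.read]
    have := ((e4 c).trans hstep).trans (f2 c)
    exact this

/-- The order of the quantifiers matters: the final work and history tapes do not depend on the tape
`c`, so the run can be undone after `c` has received the result. -/
theorem logged_transforms [Finite T] [Nonempty T] {t t' : T → ℤ → Option Bool} {n : ℕ}
    (he : B.Exec B.entry t n t') (w : T → ℤ × (ℤ → Option Bool))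
    (hw : ∀ i, t i = shiftTape (w i).1 (w i).2) :
    ∃ w' h', (∀ i, t' i = shiftTape (w' i).1 (w' i).2) ∧
      ∀ c, B.logged.Transforms (2 * n + 1) (joinTapes w (fun _ => (0, tapeOf [])) c)
        (joinTapes w' h' c) := by
  -- Entering the first `read` state already moves the history heads, so the first record goes to
  -- the cell 1.
  obtain ⟨w', h', f1, f2⟩ := logged_exec he w (fun _ => (1, tapeOf [])) hw
    (by simp [tapeOf_nil])
  refine ⟨w', h', f1, fun c => ?_⟩
  have hstep : B.logged.Steps .start (joinTapes w (fun _ => (0, tapeOf [])) c) 1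
      (.read B.entry) (joinTapes w (fun _ => (1, tapeOf [])) c) := by
    refine .one (.start (fun x => ?_) rfl rfl) ?_
    · simp [RevProgram.read, joinTapes, tapeOf_nil]
    · funext i
      cases i <;> simp [RevProgram.write, joinTapes, logged, logMove, HeadMove.shift,
        RevProgram.read]
  exact hstep.trans (f2 c)

end Block

/-! ### Reversible copying -/

namespace RevProgram

theorem finite_copyState : Finite CopyState :=
  Finite.of_surjective (![.start, .back, .right, .left, .settle, .halt] : Fin 6 → CopyState)
    fun q => by
      cases q with
      | start => exact ⟨0, rfl⟩
      | back => exact ⟨1, rfl⟩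
      | right => exact ⟨2, rfl⟩
      | left => exact ⟨3, rfl⟩
      | settle => exact ⟨4, rfl⟩
      | halt => exact ⟨5, rfl⟩

variable {X : Type} [DecidableEq X]

/-- The steps of the program that copies the string on `A` to `C`. -/
inductive CopyRel (A C : X) : CopyState → (X → Option Bool) → CopyState → (X → Option Bool) → Prop
  | start {σ σ'} : σ' = σ → CopyRel A C .start σ .back σ'
  | back {σ σ'} : σ C = none → σ' = σ → CopyRel A C .back σ .right σ'
  | right {σ σ'} (b : Bool) : σ A = some b → σ C = none → σ' = Function.update σ C (some b) →
      CopyRel A C .right σ .right σ'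
  | turn {σ σ'} : σ A = none → σ C = none → σ' = σ → CopyRel A C .right σ .left σ'
  | left {σ σ'} (b : Bool) : σ A = some b → σ C = some b → σ' = σ → CopyRel A C .left σ .left σ'
  | settle {σ σ'} : σ C = none → σ' = σ → CopyRel A C .left σ .settle σ'
  | halt {σ σ'} : σ' = σ → CopyRel A C .settle σ .halt σ'

/-- The head movements of the copying program. -/
def copyMove (A C : X) (q : CopyState) (i : X) : HeadMove :=
  if i = A ∨ i = C then
    match q with
    | .back => .left
    | .right => .right
    | .left => .left
    | .settle => .right
    | _ => .stay
  else .stay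

/-- The reversible program that copies the string on `A` to `C`. -/
def copier (A C : X) : RevProgram X where
  State := CopyState
  finite_state := finite_copyState
  start := .start
  halt := .halt
  move := copyMove A C
  rel := CopyRel A C
  functional := by
    intro q σ q₁ σ₁ q₂ σ₂ h₁ h₂
    cases h₁ <;> cases h₂ <;> simp_all
  injective := by
    intro q σ q₁ σ₁ q₂ σ₂ h₁ h₂
    cases h₁ with
    -- The state `right` is entered after copying a bit or from `back`; the symbol on `C` is a bit
    -- in the first case and a blank in the second.
    | right b a c e =>
      cases h₂ with
      | right b' a' c' e' =>
        refine ⟨rfl, funext fun i => ?_⟩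
        by_cases hi : i = C
        · subst hi; rw [c, c']
        · have := congrFun (e.symm.trans e') i
          simpa [hi] using this
      | back a' e' => subst e e'; simp at a'
    | back a e =>
      cases h₂ with
      | right b' a' c' e' => rw [← e, e'] at a; simp at a
      | back a' e' => exact ⟨rfl, e.symm.trans e'⟩
    | _ => cases h₂ <;> simp_all
  not_rel_halt := by intro σ q' σ' h; cases h
  not_rel_start := by intro q σ σ' h; cases h
  move_start := fun i => by simp [copyMove]
  move_halt := fun i => by simp [copyMove]

/-- The tapes during copying. -/
def copyTapes (s : X → ℤ × (ℤ → Option Bool)) (A C : X) (k : ℤ) (g : ℤ → Option Bool) :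
    X → ℤ × (ℤ → Option Bool) :=
  Function.update (Function.update s A ((s A).1 + k, (s A).2)) C (k, g)

theorem copier_step {A C : X} (hAC : A ≠ C) (s : X → ℤ × (ℤ → Option Bool)) (k : ℤ)
    (g : ℤ → Option Bool) {q q' : CopyState}
    (hr : CopyRel A C q (read (copyTapes s A C k g)) q' (read (copyTapes s A C k g)))
    {d : HeadMove} (hd : ∀ i, copyMove A C q' i = if i = A ∨ i = C then d else .stay) :
    (copier A C).Steps q (copyTapes s A C k g) 1 q' (copyTapes s A C (k + d.shift) g) := by
  refine .one (P := copier A C) hr ?_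
  have hd' : ∀ i, (copier A C).move q' i = if i = A ∨ i = C then d else .stay := hd
  funext i
  by_cases h : i = C
  · subst h; simp [write, hd', copyTapes, read]
  · by_cases h' : i = A
    · subst h'; simp [write, hd', copyTapes, read, h, add_assoc]
    · simp [write, hd', copyTapes, read, h, h', HeadMove.shift]

theorem update_tapeOf (u : List Bool) (b : Bool) :
    Function.update (tapeOf u) u.length (some b) = tapeOf (u ++ [b]) := by
  funext z
  simp only [tapeOf, Function.update_apply]
  by_cases hz : 0 ≤ z
  · obtain ⟨n, rfl⟩ := Int.eq_ofNat_of_zero_le hz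
    rcases lt_trichotomy n u.length with h | h | h
    · have : (n : ℤ) ≠ u.length := by omega
      simp [this, List.getElem?_append_left h]
    · subst h; simp
    · have h1 : (n : ℤ) ≠ u.length := by omega
      have h2 : (u ++ [b])[n]? = none := List.getElem?_eq_none (by simp; omega)
      simp [h1, h2, h.le]
  · have : z ≠ u.length := by omega
    simp [hz, this]

theorem copier_right {A C : X} (hAC : A ≠ C) (s : X → ℤ × (ℤ → Option Bool)) (u v : List Bool)
    (hA : ∀ i : ℕ, i < v.length → (s A).2 ((s A).1 + (u.length + i : ℕ)) = v[i]?) :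
    (copier A C).Steps .right (copyTapes s A C u.length (tapeOf u)) v.length .right
      (copyTapes s A C (u ++ v).length (tapeOf (u ++ v))) := by
  induction v generalizing u with
  | nil => simpa using Steps.refl (P := copier A C) _ _
  | cons b v ih =>
    have h0 : (s A).2 ((s A).1 + u.length) = some b := by simpa using hA 0 (by simp)
    have hstep : (copier A C).Steps .right (copyTapes s A C u.length (tapeOf u)) 1 .right
        (copyTapes s A C (u ++ [b]).length (tapeOf (u ++ [b]))) := by
      refine .one (P := copier A C) (CopyRel.right b ?_ ?_ rfl) ?_
      · simp [read, copyTapes, hAC, h0]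
      · simp [read, copyTapes, tapeOf]
      · funext i
        by_cases h : i = C
        · subst h
          simp [write, copier, copyMove, copyTapes, update_tapeOf, HeadMove.shift]
        · by_cases h' : i = A
          · subst h'; simp [write, copier, copyMove, copyTapes, read, h, add_assoc, HeadMove.shift]
          · simp [write, copier, copyMove, copyTapes, read, h, h', HeadMove.shift]
    have h2 := ih (u ++ [b]) (fun i hi => by
      have := hA (i + 1) (by simpa using hi)
      rw [List.length_append, List.length_singleton]
      have e : u.length + 1 + i = u.length + (i + 1) := by ring
      rw [e, this, List.getElem?_cons_succ])
    have := hstep.trans h2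
    simpa using this

theorem copier_left {A C : X} (hAC : A ≠ C) (s : X → ℤ × (ℤ → Option Bool)) (v : List Bool)
    (hA : ∀ i : ℕ, i < v.length → (s A).2 ((s A).1 + i) = v[i]?) (k : ℕ) (hk : k ≤ v.length) :
    (copier A C).Steps .left (copyTapes s A C (k - 1) (tapeOf v)) k .left
      (copyTapes s A C (-1) (tapeOf v)) := by
  induction k with
  | zero => simpa using Steps.refl (P := copier A C) _ _
  | succ k ih =>
    have hstep := copier_step (q := .left) (q' := .left) hAC s k (tapeOf v)
      (.left v[k] (by simp [read, copyTapes, hAC, hA k (by omega)])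
        (by simp [read, copyTapes, tapeOf]) rfl) (d := .left) (fun i => rfl)
    have := hstep.trans (ih (by omega))
    simpa [HeadMove.shift] using this

/-- Entering `right` always moves to the right, so the heads first step back in order to meet the
first bit in that state. The way home ends at the blank of `C` at the cell -1; `A` cannot be tested
there, as it may be nonblank to the left of the string. -/
theorem copier_transforms {A C : X} (hAC : A ≠ C) (s : X → ℤ × (ℤ → Option Bool)) (v : List Bool)
    (hA : Reads (shiftTape (s A).1 (s A).2) v) (hC : s C = (0, tapeOf [])) :
    (copier A C).Transforms (2 * v.length + 5) s (Function.update s C (0, tapeOf v)) := by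
  have hA' : ∀ i : ℕ, i ≤ v.length → (s A).2 ((s A).1 + i) = v[i]? := by
    intro i hi
    have := hA i hi
    rwa [shiftTape_apply, add_comm] at this
  have e0 : ∀ g, copyTapes s A C 0 g = Function.update s C (0, g) := by
    intro g; simp [copyTapes]
  have es : s = copyTapes s A C 0 (tapeOf []) := by rw [e0, ← hC]; simp
  have s1 := copier_step (q := .start) (q' := .back) hAC s 0 (tapeOf []) (.start rfl) (d := .left)
    (fun i => rfl)
  have s2 := copier_step (q := .back) (q' := .right) hAC s (0 + HeadMove.left.shift) (tapeOf [])
    (.back (by simp [read, copyTapes, tapeOf]) rfl) (d := .right) (fun i => rfl)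
  have s3 := copier_right hAC s [] v (fun i hi => by simpa using hA' i hi.le)
  have s4 := copier_step (q := .right) (q' := .left) hAC s v.length (tapeOf v)
    (.turn (by simp [read, copyTapes, hAC, hA']) (by simp [read, copyTapes, tapeOf]) rfl)
    (d := .left) (fun i => rfl)
  have s5 := copier_left hAC s v (fun i hi => hA' i hi.le) v.length le_rfl
  have s6 := copier_step (q := .left) (q' := .settle) hAC s (-1) (tapeOf v)
    (.settle (by simp [read, copyTapes, tapeOf]) rfl) (d := .right) (fun i => rfl)
  have s7 := copier_step (q := .settle) (q' := .halt) hAC s 0 (tapeOf v) (.halt rfl) (d := .stay)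
    (fun i => by simp [copyMove])
  simp only [HeadMove.shift, neg_add_cancel, add_zero, List.length_nil, List.nil_append,
    Nat.cast_zero, ← sub_eq_add_neg] at s1 s2 s3 s4 s6 s7
  have := (((((s1.trans s2).trans s3).trans s4).trans s5).trans s6).trans s7
  rw [← es, e0] at this
  have e : 1 + (1 + (v.length + (1 + (v.length + (1 + 1))))) = 2 * v.length + 5 := by ring
  rwa [e] at this

end RevProgram

/-! ### Computing, copying, uncomputing, and the removal of the input -/

namespace Block

variable {T : Type}

noncomputable instance (B : Block T) : DecidableEq (HistTape B) := Classical.decEq _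

/-- The reversible program that keeps the input of `B` and writes a copy of what can be read on the
tape `out` at the end. -/
noncomputable def computeCopy [Finite T] [Nonempty T] (B : Block T) (out : T) :
    RevProgram (HistTape B) :=
  (B.logged.seq (RevProgram.copier (.work out) .copy)).seq B.logged.symm

/-- The inverse run removes the history and the scratch work but ignores the tape `copy`, where the
result survives. -/
theorem computeCopy_transforms [Finite T] [Nonempty T] {B : Block T} {out : T} {n : ℕ}
    {t t' : T → ℤ → Option Bool} {v : List Bool} (he : B.Exec B.entry t n t')
    (hv : Reads (t' out) v) :
    (B.computeCopy out).Transforms (4 * n + 2 * v.length + 9)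
      (joinTapes (fun i => (0, t i)) (fun _ => (0, tapeOf [])) (0, tapeOf []))
      (joinTapes (fun i => (0, t i)) (fun _ => (0, tapeOf [])) (0, tapeOf v)) := by
  obtain ⟨w', h', hw', hs⟩ := logged_transforms he (fun i => (0, t i)) (by simp)
  have s2 := RevProgram.copier_transforms (A := HistTape.work out) (C := .copy) (by simp)
    (joinTapes w' h' (0, tapeOf [])) v (by simpa [joinTapes, ← hw'] using hv) rfl
  have e : Function.update (joinTapes (B := B) w' h' (0, tapeOf [])) .copy (0, tapeOf v) =
      joinTapes w' h' (0, tapeOf v) := by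
    funext i
    cases i <;> simp [joinTapes]
  rw [e] at s2
  have := ((hs (0, tapeOf [])).seq s2).seq (hs (0, tapeOf v)).symm
  have e : 2 * n + 1 + (2 * v.length + 5) + 1 + (2 * n + 1) + 1 = 4 * n + 2 * v.length + 9 := by
    ring
  rwa [e] at this

open Classical in
/-- The tapes with the string `u` on the tape `inp` and blanks elsewhere. -/
noncomputable def inputTapes (inp : T) (u : List Bool) : T → ℤ → Option Bool :=
  fun i => if i = inp then tapeOf u else tapeOf []

/-- A program that exchanges `u` and `v` can be replaced by a reversible machine that turns `u` into
`v` cleanly, with a constant slowdown. -/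
theorem exists_reversible [Finite T] (B : Block T) (inp out : T) :
    ∃ R : MultitapeTM, R.Reversible ∧ ∀ (n : ℕ) (u v : List Bool) (t t' : T → ℤ → Option Bool),
      B.RunsIn n (inputTapes inp u) t → Reads (t out) v →
      B.RunsIn n (inputTapes inp v) t' → Reads (t' out) u →
      R.ReplacesWithin (8 * n + 2 * u.length + 2 * v.length + 20) u v := by
  classical
  have : Nonempty T := ⟨inp⟩
  have := finite_histTape B
  -- The first half leaves `u` on the input tape and `v` on `copy`. The inverse of computing `u`
  -- from `v` expects them the other way round; after the swap it erases `u` and keeps `v` on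
  -- `copy`, the output tape of the machine.
  let e : HistTape B ≃ HistTape B := Equiv.swap (.work inp) .copy
  let P := (B.computeCopy out).seq ((B.computeCopy out).symm.relabel e)
  refine ⟨P.toTM (.work inp) .copy (by simp), RevProgram.reversible_toTM, ?_⟩
  rintro n u v t t' ⟨k, hk, he⟩ hv ⟨k', hk', he'⟩ hu
  have s1 := computeCopy_transforms he hv
  have s2 := (computeCopy_transforms he' hu).symm.relabel e
  have e1 : (joinTapes (B := B) (fun i => (0, inputTapes inp v i)) (fun _ => (0, tapeOf []))
      (0, tapeOf u)) ∘ e = joinTapes (fun i => (0, inputTapes inp u i)) (fun _ => (0, tapeOf []))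
      (0, tapeOf v) := by
    funext i
    by_cases h1 : i = .copy
    · subst h1; simp [e, joinTapes, inputTapes]
    · by_cases h2 : i = .work inp
      · subst h2; simp [e, joinTapes, inputTapes]
      · simp only [e, Function.comp_apply, Equiv.swap_apply_of_ne_of_ne h2 h1]
        cases i with
        | work i =>
          have : i ≠ inp := fun h => h2 (h ▸ rfl)
          simp [joinTapes, inputTapes, this]
        | hist x => rfl
        | copy => exact absurd rfl h1
  rw [e1] at s2
  have s3 := s1.seq s2
  have hle : 4 * k + 2 * v.length + 9 + (4 * k' + 2 * u.length + 9) + 1 ≤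
      8 * n + 2 * u.length + 2 * v.length + 20 := by omega
  have e2 : joinTapes (B := B) (fun i => (0, inputTapes inp u i)) (fun _ => (0, tapeOf []))
      (0, tapeOf []) = fun i => (0, if i = .work inp then tapeOf u else tapeOf []) := by
    funext i
    cases i <;> simp [joinTapes, inputTapes]
  have e3 : (joinTapes (B := B) (fun i => (0, inputTapes inp v i)) (fun _ => (0, tapeOf []))
      (0, tapeOf [])) ∘ e = fun i => (0, if i = .copy then tapeOf v else tapeOf []) := by
    funext i
    by_cases h1 : i = .copy
    · subst h1; simp [e, joinTapes, inputTapes]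
    · by_cases h2 : i = .work inp
      · subst h2; simp [e, joinTapes]
      · simp only [e, Function.comp_apply, Equiv.swap_apply_of_ne_of_ne h2 h1]
        cases i with
        | work i =>
          have : i ≠ inp := fun h => h2 (h ▸ rfl)
          simp [joinTapes, inputTapes, this]
        | hist x => simp [joinTapes]
        | copy => exact absurd rfl h1
  rw [e2, e3] at s3
  obtain ⟨m, hm, h⟩ := RevProgram.replacesWithin_toTM (h := by simp) (P := P) (inp := .work inp)
    (out := .copy) (by convert s3)
  exact ⟨m, hm.trans hle, h⟩

end Block

/-! ### The cost bound -/

namespace MultitapeTM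

variable {U : MultitapeTM}

theorem exists_of_timeC_eq {s a : ℕ} {x y : List Bool} (h : U.timeC s x y = (a : ℕ∞)) :
    ∃ p : List Bool, U.OutputsWithin s (pairCode p y) x ∧ p.length = a := by
  have hlt : U.timeC s x y < ((a + 1 : ℕ) : ℕ∞) := by rw [h]; exact_mod_cast Nat.lt_succ_self a
  simp only [timeC, iInf_lt_iff] at hlt
  obtain ⟨p, hp, hlt⟩ := hlt
  have h1 : p.length < a + 1 := by exact_mod_cast hlt
  have h2 : (a : ℕ∞) ≤ p.length := h ▸ iInf₂_le p hp
  have h3 : a ≤ p.length := by exact_mod_cast h2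
  exact ⟨p, hp, by omega⟩

/-- Truncated to `s` bits, a shortest program still works, so it had no more bits than that. This
keeps the time for handling `r` within the bound. -/
theorem le_of_timeC_eq {s b : ℕ} {x y : List Bool} (h : U.timeC s x y = (b : ℕ∞)) : b ≤ s := by
  obtain ⟨p, hp, rfl⟩ := exists_of_timeC_eq h
  have h2 : (p.length : ℕ∞) ≤ (p.take s).length := h ▸ iInf₂_le (p.take s) hp.take
  have h3 : p.length ≤ (p.take s).length := by exact_mod_cast h2
  rw [List.length_take] at h3
  omega

theorem irrevCost_le {R : MultitapeTM} {s c : ℕ} {x y p q : List Bool}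
    (h : R.ReplacesWithin s (pairCode x p) (pairCode y q)) (hc : p.length + q.length ≤ c) :
    R.irrevCost s x y ≤ (c : ℕ∞) :=
  (iInf_le_of_le p (iInf₂_le q h)).trans (by exact_mod_cast hc)

theorem ReplacesWithin.mono {R : MultitapeTM} {s s' : ℕ} {u v : List Bool}
    (h : R.ReplacesWithin s u v) (hs : s ≤ s') : R.ReplacesWithin s' u v := by
  obtain ⟨n, hn, h⟩ := h
  exact ⟨n, hn.trans hs, h⟩

theorem Exchanges.mono {n m : ℕ} {u v : List Bool} (h : U.Exchanges n u v) (hnm : n ≤ m) :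
    U.Exchanges m u v := by
  obtain ⟨t', s, hv⟩ := h
  exact ⟨t', s.mono hnm, hv⟩

theorem startTapes_eq (u : List Bool) : startTapes U u = Block.inputTapes .inp u := by
  funext i
  simp [startTapes, Block.inputTapes, strTape_nil_left]

end MultitapeTM

open MultitapeTM in
theorem mainTheorem4 (U : MultitapeTM) :
    ∃ R : MultitapeTM, R.Reversible ∧ ∃ c : ℕ,
      ∀ (t : ℕ → ℕ) (x : List Bool), x.length ≤ t x.length →
        ∀ s : ℕ, s ≤ 2 ^ x.length * t x.length →
          ∀ a b : ℕ, U.timeC (t x.length) x [] = (a : ℕ∞) →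
            U.timeC s (natString (t x.length)) x = (b : ℕ∞) →
              R.irrevCost (c * (2 ^ x.length * t x.length + 1)) x [] ≤
                ((a + 2 * b + 4 * Nat.log 2 b + c : ℕ) : ℕ∞) := by
  have := finite_wTape U
  obtain ⟨R, hR, hrep⟩ := (exchange U).exists_reversible .inp .out
  have hrep' : ∀ (n : ℕ) (u v : List Bool), U.Exchanges n u v → U.Exchanges n v u →
      R.ReplacesWithin (8 * n + 2 * u.length + 2 * v.length + 20) u v := by
    rintro n u v ⟨t, h, hv⟩ ⟨t', h', hu⟩
    rw [startTapes_eq] at h h'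
    exact hrep n u v t t' h hv h' hu
  -- A generous constant: the dominant term is 8 · 500 · (6N + 1) for N = 2^|x| · τ, to which the
  -- lengths of the codes are added.
  refine ⟨R, hR, 100000, fun t x hx s hs a b ha hb => ?_⟩
  generalize t x.length = τ at *
  rcases eq_or_ne x [] with rfl | hx0
  · refine irrevCost_le ((hrep' _ _ _ exchanges_nil_nil exchanges_nil_nil).mono ?_) (by simp)
    simp [length_pairCode]
    omega
  have hx1 : 1 ≤ x.length := List.length_pos_of_ne_nil hx0
  have hτ : τ ≤ 2 ^ x.length * τ := Nat.le_mul_of_pos_left _ (by positivity)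
  have hτ1 : 2 ^ x.length * (τ + 1) ≤ 2 * (2 ^ x.length * τ) := by
    rw [mul_add, mul_one, two_mul]
    exact Nat.add_le_add_left (Nat.le_mul_of_pos_right _ (by omega)) _
  -- Erasing `x` literally costs one bit more than its length, which is affordable exactly in this
  -- case. Otherwise the shortest program is shorter than `x`, as the time bound for the search
  -- requires.
  by_cases hax : x.length ≤ a
  · refine irrevCost_le ((hrep' _ _ _ (exchanges_pair_nil hx0) (exchanges_nil_pair x)).mono ?_) ?_
    · generalize 2 ^ x.length * τ = N at *
      simp only [length_pairCode, List.length_nil, List.length_cons]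
      omega
    · simp only [List.length_nil, List.length_cons]
      omega
  · obtain ⟨w, ⟨n, hn, c, hc, hst, hout⟩, rfl⟩ := exists_of_timeC_eq ha
    have hbs := le_of_timeC_eq hb
    obtain ⟨r, hr, rfl⟩ := exists_of_timeC_eq hb
    obtain ⟨w', hw', hlen, hex⟩ := exchanges_forward (w := w) hr hx
      ⟨n, by omega, c, hc, hst, by rw [hout]; exact reads_tapeOf x⟩ (by omega)
    have hex' := exchanges_backward (r := r) hw'
    have hl := length_natString_le_log r.length
    have hl' := length_natString_le r.length
    generalize 2 ^ x.length * τ = N at *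
    generalize 2 ^ x.length * (τ + 1) = M at *
    have hmax : 300 * (r.length + w'.length + (τ + 1) + x.length + 1) ≤
        500 * (3 * N + 3 * N + 1) := by omega
    refine irrevCost_le ((hrep' (500 * (3 * N + 3 * N + 1)) _ _ (hex.mono (by omega))
      (hex'.mono hmax)).mono ?_) ?_
    · simp only [length_pairCode, List.length_nil, List.length_cons, List.length_append]
      omega
    -- With ℓ the length of `natString r.length`, the provided bits number 2ℓ + 1 + |r| and the
    -- erased ones 2ℓ + 2 + |r| + |w'|. Then ℓ ≤ log |r| + 1 gives the bound with 7 as additive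
    -- constant.
    · simp only [length_pairCode, List.length_cons, List.length_append]
      omega
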